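/- Let $\vartheta > 1/2$ be a real number and suppose that the primes have admissible level of distribution $\vartheta$, that is, for all $\varepsilon > 0$ and $A > 0$, $$\sum_{q \le x^{\vartheta-\varepsilon}} \max_{\substack{a \bmod q\\ (a,q)=1}} \Bigl| \sum_{\substack{p \le x,\ p \text{ prime}\\ p \equiv a\ (\mathrm{mod}\ q)}} \log p - \frac{x}{\varphi(q)} \Bigr| \ll_{\varepsilon, A} \frac{x}{(\log x)^A} \qquad (x \to \infty).$$ Then there are constants $C(\vartheta)$ and $C_0(\vartheta)$ such that for every real $x > C_0(\vartheta)$ the interval $[x, x + C(\vartheta)]$ contains an integer $d$ which can be written in infinitely many ways as the difference of two consecutive primes, i.e. $p_{n+1} - p_n = d$ for infinitely many $n$, where $p_n$ denotes the $n$-th prime. -/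

import Mathlib

open scoped Asymptotics

/-- `θ(x; q, a)`, the sum of `log p` over the primes `p ≤ x` with `p ≡ a (mod q)`. -/
noncomputable def primeTheta (x : ℝ) (q : ℕ) (a : ZMod q) : ℝ :=
  ∑ p ∈ (Finset.Icc 1 ⌊x⌋₊).filter (fun p : ℕ => p.Prime ∧ (p : ZMod q) = a), Real.log p

/-- The largest error `|θ(x; q, a) - x / φ(q)|` over the reduced residue classes `a` modulo `q`.
For `q ≥ 1` the index type is finite and nonempty, so the supremum is a maximum. -/
noncomputable def maxThetaError (x : ℝ) (q : ℕ) : ℝ :=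
  ⨆ a : (ZMod q)ˣ, |primeTheta x q (a : ZMod q) - x / (Nat.totient q : ℝ)|

/-- The primes have the admissible level of distribution `ϑ`: for all `ε > 0` and `A > 0`,
the sum of the maximal errors over the moduli `1 ≤ q ≤ x ^ (ϑ - ε)` is
`O_{ε, A} (x / (log x) ^ A)` as `x → ∞`. -/
def PrimesHaveLevel (ϑ : ℝ) : Prop :=
  ∀ ε : ℝ, 0 < ε → ∀ A : ℝ, 0 < A →
    (fun x : ℝ => ∑ q ∈ Finset.Icc 1 ⌊x ^ (ϑ - ε)⌋₊, maxThetaError x q)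
      =O[Filter.atTop] (fun x : ℝ => x / (Real.log x) ^ A)

/-- `d` is the difference of two consecutive primes in infinitely many ways. -/
def IsDePolignac (d : ℕ) : Prop :=
  {n : ℕ | Nat.nth Nat.Prime (n + 1) = Nat.nth Nat.Prime n + d}.Infinite

/-! A sieve argument produces prime pairs, and a combinatorial argument turns them into bounded
gaps.

Combinatorics. For some `k`, every admissible `k`-element set `H` has a difference that occurs
infinitely often between consecutive primes. The sieve only gives two primes among the `n + h`, but
it leaves the residues of `n` modulo small primes free. Each shift below `max H` outside `H` is
therefore made composite by a prime of its own, and neighbouring primes among the `n + h` become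
consecutive (`HasPrimePairs.exists_isDePolignac_sub`). If the set of such differences had
arbitrarily long gaps, a greedy choice would build an admissible `k`-tuple with all its differences
in gaps (`exists_bounded_gaps_of_meets_differences`).

Sieve (`exists_hasPrimePairs`). This is the Goldston–Pintz–Yıldırım method with squarefree moduli
written as sets of primes. Let `W` be the product of the primes up to `D₀`, `c = φ(W)/W`, `L = η log
N`, and let `P` be the primes in `(D₀, e^L]`. Each `n` in `(N, 2N]` in the prescribed classes is
weighted by the square of a Selberg sum with diagonal variables `y(U) = (L - log ∏ U)₊ ^ l`. If no
such `n` had two primes among the `n + h`, the weighted sum of `log (n + h)` over the prime `n + h`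
would be at most `(log N + log 3)` times the sum of the weights.

No asymptotics of the main terms are needed. With `M j` the moment of `(k-1)/(p-k)` with exponent
`j`, the prime sum for each shift is at least about `N/W · c/(l+1)² · M (2l+2)`
(`le_sum_prime_mul_tupleSieve`). The sum of the weights is about `N/W` times the moment of `k/(p-k)`
with exponent `2l`, and splitting off `1/(p-k)` bounds that moment by about `c/(2l+1) · M (2l+1)`
(`sum_prod_add_posPart_pow_le`). The recursion `sub_mul_subsetMoment_le` gives `M (2l+2) ≥
(L-C)/(2l+1) · M (2l+1)` when `k = (2l+1)²`. The contradiction then needs `(l+1)² < η (2l+1)²` up to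
a factor near 1, which holds for large `l` once `η > 1/4`. Moduli reach `W N^(2η)`, so `2η < ϑ` is
required; this is where `ϑ > 1/2` enters. -/

/-- A finite set of shifts is admissible if it misses a residue class modulo every prime. -/
def IsAdmissible (H : Finset ℕ) : Prop :=
  ∀ p : ℕ, p.Prime → ∃ a : ℕ, ∀ h ∈ H, ¬ p ∣ a + h

/-- For every `k`-element set `H` of shifts there are infinitely many `n` in any prescribed
residue classes modulo the primes up to `D₀` (compatible with `H`) such that two of the numbers
`n + h` are prime. -/
def HasPrimePairs (k : ℕ) : Prop :=
  ∀ H : Finset ℕ, H.card = k → ∃ D₁ : ℕ, ∀ D₀ ≥ D₁, ∀ r : ℕ → ℕ,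
    (∀ p, p.Prime → p ≤ D₀ → ∀ h ∈ H, ¬ p ∣ r p + h) →
    ∀ N₀ : ℕ, ∃ n > N₀, (∀ p, p.Prime → p ≤ D₀ → n ≡ r p [MOD p]) ∧
      ∃ h ∈ H, ∃ h' ∈ H, h < h' ∧ (n + h).Prime ∧ (n + h').Prime

/-! ### From prime pairs in residue classes to consecutive primes -/

theorem nth_prime_succ_of_consecutive {p q : ℕ} (hp : p.Prime) (hq : q.Prime) (hpq : p < q)
    (h : ∀ m, p < m → m < q → ¬ m.Prime) :
    Nat.nth Nat.Prime (Nat.count Nat.Prime p + 1) = q := by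
  have h1 : Nat.nth Nat.Prime (Nat.count Nat.Prime p) = p := Nat.nth_count hp
  have h2 : p < Nat.nth Nat.Prime (Nat.count Nat.Prime p + 1) := by
    conv_lhs => rw [← h1]
    exact Nat.nth_strictMono Nat.infinite_setOfPred_prime (Nat.lt_succ_self _)
  have h3 : (Nat.nth Nat.Prime (Nat.count Nat.Prime p + 1)).Prime :=
    Nat.nth_mem_of_infinite Nat.infinite_setOfPred_prime _
  refine le_antisymm ?_ ?_
  · by_contra! hlt
    have := Nat.le_nth_of_lt_nth_succ hlt hq
    omega
  · by_contra! hlt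
    exact h _ h2 hlt h3

theorem isDePolignac_of_frequently {h h' : ℕ} (hlt : h < h')
    (hinf : {n : ℕ | (n + h).Prime ∧ (n + h').Prime ∧
      ∀ m, n + h < m → m < n + h' → ¬ m.Prime}.Infinite) :
    IsDePolignac (h' - h) := by
  have hinj : Set.InjOn (fun n => Nat.count Nat.Prime (n + h))
      {n : ℕ | (n + h).Prime ∧ (n + h').Prime ∧ ∀ m, n + h < m → m < n + h' → ¬ m.Prime} := by
    intro a ha b hb hab
    have := Nat.count_injective ha.1 hb.1 hab
    omega
  refine (hinf.image hinj).mono ?_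
  rintro _ ⟨n, ⟨h1, h2, h3⟩, rfl⟩
  simp only [Set.mem_ofPred_eq]
  rw [nth_prime_succ_of_consecutive h1 h2 (by omega) h3, Nat.nth_count h1]
  omega

/-- Every `h ≤ max H` outside `H` receives its own prime `P h > max H`, and `n ≡ -h` modulo `P h`
makes `n + h` composite. This is compatible with `H`, since `P h` cannot divide a nonzero difference
of absolute value at most `max H`. -/
theorem HasPrimePairs.exists_isDePolignac_sub {k : ℕ} (hk : HasPrimePairs k) {H : Finset ℕ}
    (hcard : H.card = k) (hH : IsAdmissible H) :
    ∃ h ∈ H, ∃ h' ∈ H, h < h' ∧ IsDePolignac (h' - h) := by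
  classical
  obtain ⟨D₁, hD₁⟩ := hk H hcard
  set B := H.sup id with hB
  have hHB : ∀ h ∈ H, h ≤ B := fun h hh => Finset.le_sup (f := id) hh
  -- the prime that is to divide `n + h`
  set P : ℕ → ℕ := fun h => Nat.nth Nat.Prime (h + B) with hP
  have hPinj : Function.Injective P := fun a b hab => by
    have := (Nat.nth_strictMono Nat.infinite_setOfPred_prime).injective hab
    omega
  have hPprime : ∀ h, (P h).Prime := fun h => Nat.nth_mem_of_infinite Nat.infinite_setOfPred_prime _
  have hPgt : ∀ h, B < P h := fun h => by
    have := Nat.add_two_le_nth_prime (h + B)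
    simp only [hP]; omega
  choose! a ha using hH
  -- `(p - 1) * h` represents `-h` modulo `p`. The remaining primes get the class supplied by
  -- admissibility.
  set r : ℕ → ℕ := fun p =>
    if hp : ∃ h, h ≤ B ∧ h ∉ H ∧ P h = p then (p - 1) * hp.choose else a p with hr
  have hrP : ∀ h ≤ B, h ∉ H → r (P h) = (P h - 1) * h := by
    intro h hhB hhH
    have hex : ∃ h', h' ≤ B ∧ h' ∉ H ∧ P h' = P h := ⟨h, hhB, hhH, rfl⟩
    have : hex.choose = h := hPinj hex.choose_spec.2.2
    simp only [hr, dif_pos hex, this]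
  have key : ∀ h, ((P h - 1) * h) + h = P h * h := fun h => by
    have := (hPprime h).one_lt
    obtain ⟨m, hm⟩ : ∃ m, P h = m + 1 := ⟨P h - 1, by omega⟩
    rw [hm, Nat.add_sub_cancel]; ring
  set D₀ := max D₁ (P B) with hD₀
  have hPle : ∀ h ≤ B, P h ≤ D₀ := fun h hh => le_trans
    ((Nat.nth_strictMono Nat.infinite_setOfPred_prime).monotone (by omega)) (le_max_right _ _)
  have hcomp : ∀ p, p.Prime → p ≤ D₀ → ∀ h ∈ H, ¬ p ∣ r p + h := by
    intro p hp _ h hh hdvd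
    by_cases hex : ∃ h', h' ≤ B ∧ h' ∉ H ∧ P h' = p
    · obtain ⟨h', hB', hH', rfl⟩ := hex
      rw [hrP h' hB' hH'] at hdvd
      have e1 : h ≠ h' := fun e => hH' (e ▸ hh)
      have h1 : (P h' : ℤ) ∣ (h : ℤ) - h' := by
        have h2 : (P h' : ℤ) ∣ (((P h' - 1) * h' + h : ℕ) : ℤ) := by exact_mod_cast hdvd
        have h3 : (P h' : ℤ) ∣ (((P h' - 1) * h' + h' : ℕ) : ℤ) := by
          rw [key]; push_cast; exact dvd_mul_right _ _
        have := dvd_sub h2 h3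
        push_cast at this
        simpa using this
      have h4 := Int.le_of_dvd (abs_pos.2 (sub_ne_zero.2 (by exact_mod_cast e1)))
        ((dvd_abs _ _).2 h1)
      have h5 := hPgt h'
      have h6 := hHB h hh
      have : |(h : ℤ) - h'| ≤ B := abs_le.2 ⟨by omega, by omega⟩
      omega
    · simp only [hr, dif_neg hex] at hdvd
      exact ha p hp h hh hdvd
  have hmain := hD₁ D₀ (le_max_left _ _) r hcomp
  -- consecutive primes with both shifts in `H` occur for arbitrarily large `n`
  have hcons : ∀ N₀ : ℕ, ∃ n > N₀, ∃ x ∈ H ×ˢ H, x.1 < x.2 ∧ (n + x.1).Prime ∧ (n + x.2).Prime ∧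
      ∀ m, n + x.1 < m → m < n + x.2 → ¬ m.Prime := by
    intro N₀
    -- Taking `n > D₀` excludes `n + h = P h`. The next prime after `n + h₁` is then found at the
    -- least later shift in `H` giving a prime.
    obtain ⟨n, hn, hmod, h₁, hh₁, h₂, hh₂, hlt, hp₁, hp₂⟩ := hmain (max N₀ D₀)
    set T := H.filter (fun h => h₁ < h ∧ (n + h).Prime) with hT
    have hTne : T.Nonempty := ⟨h₂, by simp [hT, hh₂, hlt, hp₂]⟩
    have hmin := T.min'_mem hTne
    set h' := T.min' hTne with hh'
    simp only [hT, Finset.mem_filter] at hmin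
    refine ⟨n, lt_of_le_of_lt (le_max_left _ _) hn, (h₁, h'), by simp [hh₁, hmin.1], hmin.2.1,
      hp₁, hmin.2.2, ?_⟩
    intro m hm1 hm2 hmp
    simp only at hm1 hm2
    obtain ⟨h, rfl⟩ : ∃ h, m = n + h := ⟨m - n, by omega⟩
    by_cases hhH : h ∈ H
    · have : h' ≤ h := T.min'_le h (by simp [hT, hhH, hmp]; omega)
      omega
    · have hhB : h ≤ B := by have := hHB _ hmin.1; omega
      have h1 : n + h ≡ r (P h) + h [MOD P h] := (hmod _ (hPprime h) (hPle h hhB)).add_right h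
      rw [hrP h hhB hhH, key] at h1
      have h2 : P h ∣ n + h := (Nat.modEq_zero_iff_dvd.1
        (h1.trans (Nat.modEq_zero_iff_dvd.2 (dvd_mul_right _ _))))
      have h3 := (Nat.prime_dvd_prime_iff_eq (hPprime h) hmp).1 h2
      have h4 := hPle h hhB
      have : D₀ ≤ max N₀ D₀ := le_max_right _ _
      omega
  -- Pigeonhole: otherwise each of the finitely many pairs of shifts would occur for finitely many
  -- `n` only.
  by_contra! hcon
  have hfin : ∀ x ∈ H ×ˢ H, {n : ℕ | x.1 < x.2 ∧ (n + x.1).Prime ∧ (n + x.2).Prime ∧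
      ∀ m, n + x.1 < m → m < n + x.2 → ¬ m.Prime}.Finite := by
    intro x hx
    rw [Finset.mem_product] at hx
    by_cases hlt : x.1 < x.2
    · by_contra hinf
      refine hcon x.1 hx.1 x.2 hx.2 hlt (isDePolignac_of_frequently hlt ?_)
      refine Set.Infinite.mono ?_ hinf
      exact fun n hn => hn.2
    · simp [hlt]
  have hfin' := Set.Finite.biUnion (H ×ˢ H).finite_toSet hfin
  obtain ⟨N₀, hN₀⟩ := hfin'.bddAbove
  obtain ⟨n, hn, x, hx, hx'⟩ := hcons N₀
  have := hN₀ (Set.mem_biUnion hx hx')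
  omega

/-! ### Bounded gaps from differences of admissible tuples -/

/-- A prime up to `H.card` divides every element, so `a = 1` works. A larger prime has more residue
classes than `H` has elements. -/
theorem isAdmissible_of_factorial_dvd {H : Finset ℕ} (hH : ∀ h ∈ H, (H.card).factorial ∣ h) :
    IsAdmissible H := by
  classical
  intro p hp
  by_cases hle : p ≤ H.card
  · refine ⟨1, fun h hh hdvd => hp.one_lt.ne' ?_⟩
    have h1 : p ∣ h := ((Nat.dvd_factorial hp.pos hle).trans (hH h hh))
    exact Nat.dvd_one.1 ((Nat.dvd_add_iff_left h1).2 hdvd)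
  · by_contra! hcon
    push Not at hle
    have := Fact.mk hp
    have hsurj : (Finset.univ : Finset (ZMod p)) ⊆ H.image (fun h : ℕ => -(h : ZMod p)) := by
      intro z _
      obtain ⟨h, hh, hdvd⟩ := hcon z.val
      refine Finset.mem_image.2 ⟨h, hh, ?_⟩
      have : ((z.val + h : ℕ) : ZMod p) = 0 := (ZMod.natCast_eq_zero_iff _ _).2 hdvd
      push_cast at this
      rw [ZMod.natCast_zmod_val] at this
      exact (eq_neg_of_add_eq_zero_left this).symm
    have := (Finset.card_le_card hsurj).trans Finset.card_image_le
    rw [Finset.card_univ, ZMod.card] at this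
    omega

/-- A set of integers that meets the difference set of every admissible `k`-tuple has bounded
gaps. -/
theorem exists_bounded_gaps_of_meets_differences {D : ℕ → Prop} {k : ℕ}
    (hD : ∀ H : Finset ℕ, H.card = k → IsAdmissible H →
      ∃ h ∈ H, ∃ h' ∈ H, h < h' ∧ D (h' - h)) :
    ∃ C C₀ : ℝ, ∀ x : ℝ, C₀ < x → ∃ d : ℕ, (d : ℝ) ∈ Set.Icc x (x + C) ∧ D d := by
  classical
  by_contra! hgap
  -- Greedy construction. Multiples of `k.factorial` are used so that the set of size `k` is
  -- admissible.
  have hbuild : ∀ j : ℕ, ∃ H : Finset ℕ, H.card = j ∧ (∀ h ∈ H, k.factorial ∣ h) ∧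
      ∀ h ∈ H, ∀ h' ∈ H, h < h' → ¬ D (h' - h) := by
    intro j
    induction j with
    | zero => exact ⟨∅, by simp⟩
    | succ j ih =>
      obtain ⟨H, hc, hdvd, hno⟩ := ih
      set B := H.sup id with hB
      have hHB : ∀ h ∈ H, h ≤ B := fun h hh => Finset.le_sup (f := id) hh
      -- The gap has room for the spread `B` of the earlier elements, for rounding up to a multiple
      -- of `k.factorial`, and for the ceiling of `x`. All differences `m - h` then fall into it.
      obtain ⟨x, hx0, hx⟩ := hgap (B + k.factorial + 1) 0
      have hkpos : 0 < k.factorial := Nat.factorial_pos k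
      -- the least multiple of `k.factorial` that exceeds `⌈x⌉₊ + B`
      set m := k.factorial * ((⌈x⌉₊ + B) / k.factorial + 1) with hm
      have hm1 : ⌈x⌉₊ + B < m := Nat.lt_mul_div_succ _ hkpos
      have hm2 : m ≤ ⌈x⌉₊ + B + k.factorial := by
        have := Nat.mul_div_le (⌈x⌉₊ + B) k.factorial
        rw [hm, mul_add, mul_one]; omega
      have hx1 : x ≤ ⌈x⌉₊ := Nat.le_ceil x
      have hx2 : (⌈x⌉₊ : ℝ) < x + 1 := Nat.ceil_lt_add_one hx0.le
      have hmH : m ∉ H := fun h => by have := hHB m h; omega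
      refine ⟨insert m H, by rw [Finset.card_insert_of_notMem hmH, hc], ?_, ?_⟩
      · intro h hh
        rcases Finset.mem_insert.1 hh with rfl | hh
        · exact dvd_mul_right _ _
        · exact hdvd h hh
      · intro h hh h' hh' hlt
        rcases Finset.mem_insert.1 hh with rfl | hh
        · rcases Finset.mem_insert.1 hh' with rfl | hh'
          · omega
          · have := hHB h' hh'; omega
        · rcases Finset.mem_insert.1 hh' with rfl | hh'
          · refine hx _ ⟨?_, ?_⟩
            · have h1 := hHB h hh
              have : ⌈x⌉₊ ≤ m - h := by omega
              exact hx1.trans (by exact_mod_cast this)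
            · have : m - h ≤ ⌈x⌉₊ + B + k.factorial := by omega
              have : ((m - h : ℕ) : ℝ) ≤ ⌈x⌉₊ + B + k.factorial := by exact_mod_cast this
              linarith
          · exact hno h hh h' hh' hlt
  obtain ⟨H, hc, hdvd, hno⟩ := hbuild k
  obtain ⟨h, hh, h', hh', hlt, hDd⟩ := hD H hc (isAdmissible_of_factorial_dvd (by rwa [hc]))
  exact hno h hh h' hh' hlt hDd

/-! ### Selberg's quadratic form over sets of primes -/

section SubsetSums

variable {ι : Type*} [DecidableEq ι]

theorem sum_powerset_filter_superset {M : Type*} [AddCommMonoid M] {P U : Finset ι} (hU : U ⊆ P)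
    (f : Finset ι → M) :
    ∑ S ∈ P.powerset with U ⊆ S, f S = ∑ T ∈ (P \ U).powerset, f (U ∪ T) := by
  symm
  refine Finset.sum_nbij' (fun T => U ∪ T) (fun S => S \ U) ?_ ?_ ?_ ?_ ?_
  · intro T hT
    rw [Finset.mem_powerset] at hT
    simp only [Finset.mem_filter, Finset.mem_powerset, Finset.subset_union_left, and_true]
    exact Finset.union_subset hU (hT.trans Finset.sdiff_subset)
  · intro S hS
    simp only [Finset.mem_filter, Finset.mem_powerset] at hS ⊢
    exact Finset.sdiff_subset_sdiff hS.1 le_rfl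
  · intro T hT
    rw [Finset.mem_powerset] at hT
    rw [Finset.union_sdiff_left]
    exact Finset.sdiff_eq_self_of_disjoint (Finset.disjoint_of_subset_left hT Finset.sdiff_disjoint)
  · intro S hS
    simp only [Finset.mem_filter] at hS
    exact Finset.union_sdiff_of_subset hS.2
  · intros; rfl

theorem sum_powerset_powerset {M : Type*} [AddCommMonoid M] (P : Finset ι)
    (f : Finset ι → Finset ι → M) :
    ∑ U ∈ P.powerset, ∑ V ∈ U.powerset, f U V =
      ∑ V ∈ P.powerset, ∑ T ∈ (P \ V).powerset, f (V ∪ T) V := by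
  rw [Finset.sum_comm' (s' := fun V => P.powerset.filter (V ⊆ ·)) (t' := P.powerset)]
  · refine Finset.sum_congr rfl fun V hV => ?_
    exact sum_powerset_filter_superset (Finset.mem_powerset.1 hV) (fun U => f U V)
  · intro U V
    simp only [Finset.mem_powerset, Finset.mem_filter]
    exact ⟨fun h => ⟨⟨h.1, h.2⟩, h.2.trans h.1⟩, fun h => ⟨h.1.1, h.1.2⟩⟩

/-- Diagonalisation of the quadratic form attached to the density `w`. -/
theorem sum_sum_mul_prod_union_eq {P : Finset ι} {w : ι → ℝ} (hw : ∀ p ∈ P, w p ≠ 0)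
    (l : Finset ι → ℝ) :
    ∑ S ∈ P.powerset, ∑ T ∈ P.powerset, l S * l T * ∏ p ∈ S ∪ T, w p =
      ∑ U ∈ P.powerset, (∏ p ∈ U, ((w p)⁻¹ - 1)) *
        (∑ T ∈ (P \ U).powerset, l (U ∪ T) * ∏ p ∈ U ∪ T, w p) ^ 2 := by
  -- The product over `S ∪ T` is the product over `S` times that over `T`, times `∏ w⁻¹` over `S ∩
  -- T`. Writing `w⁻¹ = 1 + (w⁻¹ - 1)` expands the last factor over `U ⊆ S ∩ T`.
  have h1 : ∀ S ∈ P.powerset, ∀ T ∈ P.powerset, l S * l T * ∏ p ∈ S ∪ T, w p =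
      ∑ U ∈ P.powerset, if U ⊆ S ∧ U ⊆ T then
        (∏ p ∈ U, ((w p)⁻¹ - 1)) * ((l S * ∏ p ∈ S, w p) * (l T * ∏ p ∈ T, w p)) else 0 := by
    intro S hS T hT
    rw [Finset.mem_powerset] at hS hT
    rw [← Finset.sum_filter, ← Finset.sum_mul]
    have : P.powerset.filter (fun U => U ⊆ S ∧ U ⊆ T) = (S ∩ T).powerset := by
      ext U
      simp only [Finset.mem_filter, Finset.mem_powerset, Finset.subset_inter_iff]
      exact ⟨fun h => h.2, fun h => ⟨h.1.trans hS, h⟩⟩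
    rw [this, ← Finset.prod_one_add]
    have h2 : ∏ p ∈ S ∩ T, (1 + ((w p)⁻¹ - 1)) = ∏ p ∈ S ∩ T, (w p)⁻¹ :=
      Finset.prod_congr rfl fun p _ => by ring
    have h3 : (∏ p ∈ S ∩ T, (w p)⁻¹) * ∏ p ∈ S ∩ T, w p = 1 := by
      rw [← Finset.prod_mul_distrib]
      exact Finset.prod_eq_one fun p hp =>
        inv_mul_cancel₀ (hw p (hS (Finset.mem_inter.1 hp).1))
    have h4 := Finset.prod_union_inter (s₁ := S) (s₂ := T) (f := w)
    rw [h2]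
    linear_combination (-(l S * l T * ∏ p ∈ S ∪ T, w p)) * h3 +
      l S * l T * (∏ p ∈ S ∩ T, (w p)⁻¹) * h4
  rw [Finset.sum_congr rfl fun S hS => Finset.sum_congr rfl fun T hT => h1 S hS T hT]
  rw [Finset.sum_congr rfl fun S _ => Finset.sum_comm, Finset.sum_comm]
  refine Finset.sum_congr rfl fun U hU => ?_
  rw [← sum_powerset_filter_superset (Finset.mem_powerset.1 hU) (fun S => l S * ∏ p ∈ S, w p),
    sq, Finset.sum_mul_sum, Finset.mul_sum, Finset.sum_filter]
  refine Finset.sum_congr rfl fun S _ => ?_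
  split_ifs with hS
  · rw [Finset.mul_sum, Finset.sum_filter]
    refine Finset.sum_congr rfl fun T _ => ?_
    by_cases hT : U ⊆ T <;> simp [hS, hT]
  · simp [hS]

/-- The sieve weights obtained from the diagonal variables `y` for the density `w`. -/
noncomputable def selbergLambda (P : Finset ι) (w : ι → ℝ) (y : Finset ι → ℝ) (S : Finset ι) : ℝ :=
  (-1) ^ S.card * (∏ p ∈ S, (w p)⁻¹) *
    ∑ T ∈ (P \ S).powerset, y (S ∪ T) * ∏ p ∈ S ∪ T, w p / (1 - w p)

/-- After interchanging summations, the alternating sum over the subsets of a fixed `V` of products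
of `-(v/w)` is `∏ (1 - v/w)`. Two densities are needed: the weights are built for `w = k/p`, while
the sum over primes has density `v = (k-1)/(p-1)`. -/
theorem sum_selbergLambda_mul_prod (P U : Finset ι) (w v : ι → ℝ)
    (y : Finset ι → ℝ) :
    ∑ T ∈ (P \ U).powerset, selbergLambda P w y (U ∪ T) * ∏ p ∈ U ∪ T, v p =
      (-1) ^ U.card * (∏ p ∈ U, v p / w p * (w p / (1 - w p))) *
        ∑ T ∈ (P \ U).powerset, y (U ∪ T) * ∏ p ∈ T, (1 - v p / w p) * (w p / (1 - w p)) := by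
  have hdisj : ∀ T ∈ (P \ U).powerset, Disjoint U T := fun T hT =>
    Finset.disjoint_of_subset_right (Finset.mem_powerset.1 hT) Finset.disjoint_sdiff
  let F : Finset ι → Finset ι → ℝ := fun V T => (-1) ^ U.card * (∏ p ∈ U, v p / w p) *
    (∏ p ∈ T, -(v p / w p)) * (y (U ∪ V) * ∏ p ∈ U ∪ V, w p / (1 - w p))
  have h1 : ∀ T ∈ (P \ U).powerset, selbergLambda P w y (U ∪ T) * ∏ p ∈ U ∪ T, v p =
      ∑ T' ∈ ((P \ U) \ T).powerset, F (T ∪ T') T := by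
    intro T hT
    simp only [selbergLambda, F]
    rw [Finset.card_union_of_disjoint (hdisj T hT), Finset.prod_union (hdisj T hT),
      Finset.prod_union (hdisj T hT), ← Finset.mul_sum, sdiff_sdiff_left, Finset.sup_eq_union]
    simp only [Finset.prod_neg, div_eq_mul_inv, Finset.prod_mul_distrib, Finset.union_assoc]
    ring
  rw [Finset.sum_congr rfl h1, ← sum_powerset_powerset (P \ U) F, Finset.mul_sum]
  refine Finset.sum_congr rfl fun V hV => ?_
  simp only [F]
  rw [← Finset.sum_mul, ← Finset.mul_sum, ← Finset.prod_one_add, Finset.prod_union (hdisj V hV)]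
  simp only [Finset.prod_mul_distrib, ← sub_eq_add_neg]
  ring

theorem sum_selbergLambda_quadratic {P : Finset ι} {w v : ι → ℝ} (hv : ∀ p ∈ P, v p ≠ 0)
    (y : Finset ι → ℝ) :
    ∑ S ∈ P.powerset, ∑ T ∈ P.powerset,
        selbergLambda P w y S * selbergLambda P w y T * ∏ p ∈ S ∪ T, v p =
      ∑ U ∈ P.powerset, (∏ p ∈ U, ((v p)⁻¹ - 1)) *
        ((∏ p ∈ U, v p / w p * (w p / (1 - w p))) *
          ∑ T ∈ (P \ U).powerset, y (U ∪ T) *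
            ∏ p ∈ T, (1 - v p / w p) * (w p / (1 - w p))) ^ 2 := by
  rw [sum_sum_mul_prod_union_eq hv]
  refine Finset.sum_congr rfl fun U _ => ?_
  rw [sum_selbergLambda_mul_prod, mul_assoc, mul_pow _ (_ * _),
    ← pow_mul, mul_comm U.card, pow_mul]
  simp

/-- For `v = w` every factor `1 - v/w` vanishes, so only the term `T = ∅` survives. -/
theorem sum_selbergLambda_quadratic_self {P : Finset ι} {w : ι → ℝ} (hw : ∀ p ∈ P, w p ≠ 0)
    (hw1 : ∀ p ∈ P, w p ≠ 1) (y : Finset ι → ℝ) :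
    ∑ S ∈ P.powerset, ∑ T ∈ P.powerset,
        selbergLambda P w y S * selbergLambda P w y T * ∏ p ∈ S ∪ T, w p =
      ∑ U ∈ P.powerset, (∏ p ∈ U, w p / (1 - w p)) * y U ^ 2 := by
  rw [sum_selbergLambda_quadratic hw]
  refine Finset.sum_congr rfl fun U hU => ?_
  rw [Finset.mem_powerset] at hU
  have h1 : ∑ T ∈ (P \ U).powerset, y (U ∪ T) *
      ∏ p ∈ T, (1 - w p / w p) * (w p / (1 - w p)) = y U := by
    rw [Finset.sum_eq_single ∅]
    · simp
    · intro T hT hne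
      obtain ⟨p, hp⟩ := Finset.nonempty_iff_ne_empty.2 hne
      have hpP := Finset.sdiff_subset (Finset.mem_powerset.1 hT hp)
      rw [Finset.prod_eq_zero hp, mul_zero]
      rw [div_self (hw p hpP), sub_self, zero_mul]
    · simp
  rw [h1, mul_pow, ← mul_assoc]
  congr 1
  rw [← Finset.prod_pow, ← Finset.prod_mul_distrib]
  refine Finset.prod_congr rfl fun p hp => ?_
  have h2 := hw p (hU hp)
  have h3 : 1 - w p ≠ 0 := sub_ne_zero.2 (hw1 p (hU hp)).symm
  field_simp

end SubsetSums

/-! ### Lower bounds for sums over squarefree numbers by sums over all integers -/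

section SubsetSumInequalities

variable {ι : Type*} [DecidableEq ι]

theorem sum_powerset_union_of_disjoint {M : Type*} [AddCommMonoid M] {P Q : Finset ι}
    (h : Disjoint P Q) (f : Finset ι → M) :
    ∑ U ∈ (P ∪ Q).powerset, f U = ∑ S ∈ P.powerset, ∑ T ∈ Q.powerset, f (S ∪ T) := by
  rw [← Finset.sum_product']
  symm
  refine Finset.sum_nbij' (fun x => x.1 ∪ x.2) (fun U => (U ∩ P, U ∩ Q)) ?_ ?_ ?_ ?_ ?_
  · rintro ⟨S, T⟩ hx
    simp only [Finset.mem_product, Finset.mem_powerset] at hx ⊢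
    exact Finset.union_subset_union hx.1 hx.2
  · intro U _
    simp [Finset.inter_subset_right]
  · rintro ⟨S, T⟩ hx
    simp only [Finset.mem_product, Finset.mem_powerset] at hx
    have h1 : T ∩ P = ∅ := Finset.disjoint_iff_inter_eq_empty.1
      (Finset.disjoint_of_subset_left hx.2 h.symm)
    have h2 : S ∩ Q = ∅ := Finset.disjoint_iff_inter_eq_empty.1
      (Finset.disjoint_of_subset_left hx.1 h)
    simp [Finset.union_inter_distrib_right, h1, h2, Finset.inter_eq_left.2 hx.1,
      Finset.inter_eq_left.2 hx.2]
  · intro U hU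
    rw [Finset.mem_powerset] at hU
    simp [← Finset.inter_union_distrib_left, Finset.inter_eq_left.2 hU]
  · intros; rfl

/-- Dropping the elements of `P` from the argument of `G` only increases its value, and the sum over
subsets of `P` then factors out. This removes primes from a sum at the cost of an explicit Euler
product. -/
theorem sum_powerset_union_le_of_antitone {P Q : Finset ι} (hPQ : Disjoint P Q) {f u : ι → ℝ}
    (hf : ∀ p ∈ P ∪ Q, 0 ≤ f p) (hu : ∀ p ∈ P, 0 ≤ u p) {G : ℝ → ℝ} (hG : Antitone G) :
    ∑ U ∈ (P ∪ Q).powerset, (∏ p ∈ U, f p) * G (∑ p ∈ U, u p) ≤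
      (∏ p ∈ P, (1 + f p)) * ∑ T ∈ Q.powerset, (∏ p ∈ T, f p) * G (∑ p ∈ T, u p) := by
  rw [sum_powerset_union_of_disjoint hPQ, Finset.prod_one_add, Finset.sum_mul]
  refine Finset.sum_le_sum fun S hS => ?_
  rw [Finset.mul_sum]
  refine Finset.sum_le_sum fun T hT => ?_
  rw [Finset.mem_powerset] at hS hT
  have hST : Disjoint S T := Finset.disjoint_of_subset_left hS
    (Finset.disjoint_of_subset_right hT hPQ)
  rw [Finset.prod_union hST, Finset.sum_union hST, mul_assoc]
  have h1 : 0 ≤ ∏ p ∈ S, f p := Finset.prod_nonneg fun p hp =>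
    hf p (Finset.mem_union_left _ (hS hp))
  have h2 : 0 ≤ ∏ p ∈ T, f p := Finset.prod_nonneg fun p hp =>
    hf p (Finset.mem_union_right _ (hT hp))
  have h3 : 0 ≤ ∑ p ∈ S, u p := Finset.sum_nonneg fun p hp => hu p (hS hp)
  gcongr
  exact hG (by linarith)

end SubsetSumInequalities

theorem sum_inv_pow_le {p : ℕ} (hp : 2 ≤ p) (X : ℕ) :
    ∑ j ∈ Finset.Icc 1 X, ((p : ℝ) ^ j)⁻¹ ≤ 1 / ((p : ℝ) - 1) := by
  have hp' : (2 : ℝ) ≤ p := by exact_mod_cast hp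
  have h : ∀ X : ℕ, ∑ j ∈ Finset.Icc 1 X, ((p : ℝ) ^ j)⁻¹ =
      (1 - ((p : ℝ) ^ X)⁻¹) / ((p : ℝ) - 1) := by
    intro X
    induction X with
    | zero => simp
    | succ X ih =>
      rw [Finset.sum_Icc_succ_top (by omega), ih]
      have : (p : ℝ) - 1 ≠ 0 := by linarith
      field_simp
      ring
  rw [h]
  have : 0 ≤ ((p : ℝ) ^ X)⁻¹ := by positivity
  have : 0 < (p : ℝ) - 1 := by linarith
  gcongr
  linarith

/-- An integer with prime support `T` is determined by its exponents, all positive, so its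
reciprocal is one term in the expanded product of geometric series. -/
theorem sum_inv_primeFactors_eq_le (X : ℕ) {T : Finset ℕ} (hT : ∀ p ∈ T, p.Prime) :
    ∑ n ∈ Finset.Icc 1 X with n.primeFactors = T, (1 : ℝ) / n ≤ ∏ p ∈ T, 1 / ((p : ℝ) - 1) := by
  classical
  have h1 : ∏ p ∈ T, ∑ j ∈ Finset.Icc 1 X, ((p : ℝ) ^ j)⁻¹ ≤ ∏ p ∈ T, 1 / ((p : ℝ) - 1) :=
    Finset.prod_le_prod (fun p _ => Finset.sum_nonneg fun j _ => by positivity)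
      fun p hp => sum_inv_pow_le (hT p hp).two_le X
  refine le_trans ?_ h1
  rw [Finset.prod_sum]
  have hinj : Set.InjOn (fun (n : ℕ) => (fun (p : ℕ) (_ : p ∈ T) => n.factorization p))
      ((Finset.Icc 1 X).filter (fun n => n.primeFactors = T) : Finset ℕ) := by
    intro a ha b hb hab
    simp only [Finset.coe_filter, Finset.mem_Icc, Set.mem_ofPred_eq] at ha hb
    refine Nat.eq_of_factorization_eq (by omega) (by omega) fun p => ?_
    by_cases hp : p ∈ T
    · exact congrFun (congrFun hab p) hp
    · rw [Finsupp.notMem_support_iff.1, Finsupp.notMem_support_iff.1]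
      · rw [Nat.support_factorization, hb.2]; exact hp
      · rw [Nat.support_factorization, ha.2]; exact hp
  have h2 : ∀ n ∈ (Finset.Icc 1 X).filter (fun n => n.primeFactors = T), (1 : ℝ) / n =
      ∏ x ∈ T.attach, (((x.1 : ℕ) : ℝ) ^ (n.factorization x.1))⁻¹ := by
    intro n hn
    simp only [Finset.mem_filter, Finset.mem_Icc] at hn
    rw [Finset.prod_attach T (fun x => ((x : ℝ) ^ (n.factorization x))⁻¹), Finset.prod_inv_distrib,
      one_div]
    congr 1
    have := Nat.prod_factorization_pow_eq_self (n := n) (by omega)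
    rw [Finsupp.prod, Nat.support_factorization, hn.2] at this
    conv_lhs => rw [← this]
    push_cast
    rfl
  rw [Finset.sum_congr rfl h2]
  rw [← Finset.sum_image (s := (Finset.Icc 1 X).filter (fun n => n.primeFactors = T))
    (g := fun (n : ℕ) => (fun (p : ℕ) (_ : p ∈ T) => n.factorization p))
    (f := fun φ : (∀ p ∈ T, ℕ) => ∏ x ∈ T.attach, (((x.1 : ℕ) : ℝ) ^ (φ x.1 x.2))⁻¹) hinj]
  refine Finset.sum_le_sum_of_subset_of_nonneg ?_ fun φ _ _ => by positivity
  intro φ hφ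
  obtain ⟨n, hn, rfl⟩ := Finset.mem_image.1 hφ
  simp only [Finset.mem_filter, Finset.mem_Icc] at hn
  refine Finset.mem_pi.2 fun p hp => Finset.mem_Icc.2 ⟨?_, ?_⟩
  · exact (hT p hp).factorization_pos_of_dvd (by omega)
      (Nat.dvd_of_mem_primeFactors (hn.2 ▸ hp))
  · exact ((Nat.factorization_lt p (by omega)).le).trans hn.1.2

/-- Integers are grouped by their radical. Since `log n` is at least the logarithm of the radical
and `G` is antitone, passing to the radical loses nothing in this direction. -/
theorem sum_antitone_log_div_le {X : ℕ} {G : ℝ → ℝ} (hG : Antitone G) (hG0 : ∀ x, 0 ≤ G x) :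
    ∑ n ∈ Finset.Icc 1 X, G (Real.log n) / n ≤
      ∑ T ∈ ((Finset.Icc 1 X).filter Nat.Prime).powerset,
        (∏ p ∈ T, 1 / ((p : ℝ) - 1)) * G (∑ p ∈ T, Real.log p) := by
  classical
  rw [← Finset.sum_fiberwise_of_maps_to (g := Nat.primeFactors)
    (t := ((Finset.Icc 1 X).filter Nat.Prime).powerset)]
  · refine Finset.sum_le_sum fun T hT => ?_
    rw [Finset.mem_powerset] at hT
    have hTp : ∀ p ∈ T, p.Prime := fun p hp => (Finset.mem_filter.1 (hT hp)).2
    refine le_trans ?_ (mul_le_mul_of_nonneg_right (sum_inv_primeFactors_eq_le X hTp) (hG0 _))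
    rw [Finset.sum_mul]
    refine Finset.sum_le_sum fun n hn => ?_
    simp only [Finset.mem_filter, Finset.mem_Icc] at hn
    rw [div_eq_inv_mul, one_div]
    refine mul_le_mul_of_nonneg_left (hG ?_) (by positivity)
    rw [← Real.log_prod (fun p hp => by exact_mod_cast (hTp p hp).ne_zero)]
    refine Real.log_le_log (Finset.prod_pos fun p hp => by exact_mod_cast (hTp p hp).pos) ?_
    rw [← hn.2]
    rw [← Nat.cast_prod]
    exact Nat.cast_le.2 (Nat.le_of_dvd (by omega) (Nat.prod_primeFactors_dvd n))
  · intro n hn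
    rw [Finset.mem_Icc] at hn
    rw [Finset.mem_powerset]
    intro p hp
    have := Nat.le_of_mem_primeFactors hp
    have h2 := Nat.prime_of_mem_primeFactors hp
    simp only [Finset.mem_filter, Finset.mem_Icc]
    exact ⟨⟨h2.one_le, by omega⟩, h2⟩

theorem pow_succ_sub_pow_succ_le {a b : ℝ} (hb : 0 ≤ b) (hab : b ≤ a) (m : ℕ) :
    a ^ (m + 1) - b ^ (m + 1) ≤ (m + 1) * (a - b) * a ^ m := by
  induction m with
  | zero => simp
  | succ m ih =>
    have ha : 0 ≤ a := hb.trans hab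
    have h1 : a * (a ^ (m + 1) - b ^ (m + 1)) ≤ a * ((m + 1) * (a - b) * a ^ m) :=
      mul_le_mul_of_nonneg_left ih ha
    have h2 : b ^ (m + 1) ≤ a ^ (m + 1) := pow_le_pow_left₀ hb hab _
    have h3 : (a - b) * b ^ (m + 1) ≤ (a - b) * a ^ (m + 1) :=
      mul_le_mul_of_nonneg_left h2 (by linarith)
    push_cast
    calc a ^ (m + 1 + 1) - b ^ (m + 1 + 1) =
        a * (a ^ (m + 1) - b ^ (m + 1)) + (a - b) * b ^ (m + 1) := by ring
      _ ≤ a * ((m + 1) * (a - b) * a ^ m) + (a - b) * a ^ (m + 1) := add_le_add h1 h3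
      _ = _ := by ring

/-- A telescoping form of comparison with `∫ (A - log t)₊ ^ m dt/t`. The condition on `A` makes the
boundary term at `X + 1` vanish. -/
theorem pow_succ_div_le_sum_posPart_pow {X : ℕ} {A : ℝ} (hA : A ≤ Real.log (X + 1)) (m : ℕ) :
    (max A 0) ^ (m + 1) / (m + 1) ≤
      ∑ n ∈ Finset.Icc 1 X, (max (A - Real.log n) 0) ^ m / n := by
  have key : ∀ Y : ℕ, ((max A 0) ^ (m + 1) - (max (A - Real.log (Y + 1)) 0) ^ (m + 1)) / (m + 1) ≤
      ∑ n ∈ Finset.Icc 1 Y, (max (A - Real.log n) 0) ^ m / n := by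
    intro Y
    induction Y with
    | zero => simp
    | succ Y ih =>
      rw [Finset.sum_Icc_succ_top (by omega)]
      have hY : (0 : ℝ) < (Y : ℝ) + 1 := by positivity
      set a := max (A - Real.log (Y + 1)) 0 with ha
      set b := max (A - Real.log ((Y + 1 : ℕ) + 1)) 0 with hb
      have hlog : Real.log ((Y + 1 : ℕ) + 1) - Real.log (Y + 1) ≤ 1 / ((Y : ℝ) + 1) := by
        rw [← Real.log_div (by positivity) (by positivity)]
        have := Real.log_le_sub_one_of_pos (x := (((Y + 1 : ℕ) : ℝ) + 1) / (Y + 1)) (by positivity)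
        refine this.trans (le_of_eq ?_)
        push_cast
        field_simp
        ring
      have hmono : Real.log (Y + 1) ≤ Real.log ((Y + 1 : ℕ) + 1) :=
        Real.log_le_log hY (by push_cast; linarith)
      have hb0 : 0 ≤ b := le_max_right _ _
      have hba : b ≤ a := max_le_max (by linarith) le_rfl
      have hab : a - b ≤ 1 / ((Y : ℝ) + 1) := by
        rw [sub_le_iff_le_add]
        refine max_le ?_ (by positivity)
        have := le_max_left (A - Real.log ((Y + 1 : ℕ) + 1)) 0
        rw [← hb] at this
        linarith
      have h1 := pow_succ_sub_pow_succ_le hb0 hba m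
      have ha0 : 0 ≤ a := le_max_right _ _
      have h2 : (m + 1) * (a - b) * a ^ m ≤ (m + 1) * (1 / ((Y : ℝ) + 1)) * a ^ m := by gcongr
      have h3 : (a ^ (m + 1) - b ^ (m + 1)) / (m + 1) ≤ a ^ m / ((Y + 1 : ℕ) : ℝ) := by
        rw [div_le_iff₀ (by positivity)]
        refine (h1.trans h2).trans (le_of_eq ?_)
        push_cast
        ring
      have e : (((Y + 1 : ℕ) : ℝ)) = (Y : ℝ) + 1 := by push_cast; ring
      calc ((max A 0) ^ (m + 1) - b ^ (m + 1)) / (m + 1) =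
          ((max A 0) ^ (m + 1) - a ^ (m + 1)) / (m + 1) + (a ^ (m + 1) - b ^ (m + 1)) / (m + 1) := by
            ring
        _ ≤ _ := by
          have h4 := add_le_add ih h3
          rw [e] at h4 ⊢
          exact h4
  have h := key X
  rw [max_eq_right (sub_nonpos.2 hA)] at h
  simpa using h

/-- Lower bound for the inner sum in the quadratic form over primes. Compared with a sum over all
integers up to `X`, the primes of `P₀` and `U` are missing, and each costs a factor `p/(p-1)`. The
factors from `P₀` are moved to the left as `∏ (1 - 1/p)`. -/
theorem le_prod_mul_sum_posPart_pow {X : ℕ} {P₀ P U : Finset ℕ} (hdisj : Disjoint P₀ P)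
    (hP : P₀ ∪ P = (Finset.Icc 1 X).filter Nat.Prime) (hU : U ⊆ P) {A : ℝ}
    (hA : A ≤ Real.log (X + 1)) (m : ℕ) :
    (∏ p ∈ P₀, (1 - 1 / (p : ℝ))) * ((max (A - ∑ p ∈ U, Real.log p) 0) ^ (m + 1) / (m + 1)) ≤
      (∏ p ∈ U, (p : ℝ) / (p - 1)) * ∑ T ∈ (P \ U).powerset,
        (max (A - ∑ p ∈ U ∪ T, Real.log p) 0) ^ m * ∏ p ∈ T, 1 / ((p : ℝ) - 1) := by
  classical
  have hprime : ∀ p ∈ P₀ ∪ P, p.Prime := fun p hp => by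
    rw [hP] at hp; exact (Finset.mem_filter.1 hp).2
  have hgt : ∀ p ∈ P₀ ∪ P, (2 : ℝ) ≤ p := fun p hp => by exact_mod_cast (hprime p hp).two_le
  set A' := A - ∑ p ∈ U, Real.log p with hA'
  have hlogU : 0 ≤ ∑ p ∈ U, Real.log p := Finset.sum_nonneg fun p hp =>
    Real.log_nonneg (by linarith [hgt p (Finset.mem_union_right _ (hU hp))])
  have h1 := pow_succ_div_le_sum_posPart_pow (X := X) (A := A') (by linarith) m
  have hG : Antitone (fun x : ℝ => (max (A' - x) 0) ^ m) := fun x y hxy =>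
    pow_le_pow_left₀ (le_max_right _ _) (max_le_max (by linarith) le_rfl) m
  have h2 := sum_antitone_log_div_le (X := X) hG (fun x => pow_nonneg (le_max_right _ _) m)
  have hsplit : (Finset.Icc 1 X).filter Nat.Prime = (P₀ ∪ U) ∪ (P \ U) := by
    rw [← hP, Finset.union_assoc, Finset.union_sdiff_of_subset hU]
  have hd2 : Disjoint (P₀ ∪ U) (P \ U) := by
    rw [Finset.disjoint_union_left]
    exact ⟨Finset.disjoint_of_subset_right Finset.sdiff_subset hdisj, Finset.disjoint_sdiff⟩
  have hsub : (P₀ ∪ U) ∪ (P \ U) = P₀ ∪ P := by rw [← hsplit, hP]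
  have h3 := sum_powerset_union_le_of_antitone hd2 (f := fun p : ℕ => 1 / ((p : ℝ) - 1))
    (u := fun p : ℕ => Real.log p) (G := fun x : ℝ => (max (A' - x) 0) ^ m)
    (fun p hp => by
      rw [hsub] at hp
      have := hgt p hp
      exact div_nonneg zero_le_one (by linarith))
    (fun p hp => by
      have := hgt p (hsub ▸ Finset.mem_union_left _ hp)
      exact Real.log_nonneg (by linarith)) hG
  rw [← hsplit] at h3
  have h4 := h1.trans (h2.trans h3)
  have hP₀U : Disjoint P₀ U := Finset.disjoint_of_subset_right hU hdisj
  rw [Finset.prod_union hP₀U] at h4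
  have hc : 0 ≤ ∏ p ∈ P₀, (1 - 1 / (p : ℝ)) := Finset.prod_nonneg fun p hp => by
    have := hgt p (Finset.mem_union_left _ hp)
    rw [sub_nonneg, div_le_one (by linarith)]
    linarith
  have hc1 : (∏ p ∈ P₀, (1 - 1 / (p : ℝ))) * ∏ p ∈ P₀, (1 + 1 / ((p : ℝ) - 1)) = 1 := by
    rw [← Finset.prod_mul_distrib]
    refine Finset.prod_eq_one fun p hp => ?_
    have := hgt p (Finset.mem_union_left _ hp)
    have h5 : (p : ℝ) - 1 ≠ 0 := by linarith
    have h6 : (p : ℝ) ≠ 0 := by linarith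
    field_simp
    ring
  have hc2 : ∏ p ∈ U, (1 + 1 / ((p : ℝ) - 1)) = ∏ p ∈ U, (p : ℝ) / (p - 1) := by
    refine Finset.prod_congr rfl fun p hp => ?_
    have := hgt p (Finset.mem_union_right _ (hU hp))
    have h5 : (p : ℝ) - 1 ≠ 0 := by linarith
    field_simp
    ring
  have h7 := mul_le_mul_of_nonneg_left h4 hc
  refine h7.trans (le_of_eq ?_)
  rw [hc2, mul_assoc, ← mul_assoc _ (∏ p ∈ P₀, (1 + 1 / ((p : ℝ) - 1))), hc1, one_mul]
  congr 1
  refine Finset.sum_congr rfl fun T hT => ?_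
  have hUT : Disjoint U T := Finset.disjoint_of_subset_right (Finset.mem_powerset.1 hT)
    Finset.disjoint_sdiff
  rw [Finset.sum_union hUT, hA', sub_sub, mul_comm]

/-! ### Partial summation and recursive inequalities for moments -/

section PartialSummation

theorem integral_succ_mul_sub_pow (L u : ℝ) (m : ℕ) :
    ∫ v in u..L, ((m : ℝ) + 1) * (L - v) ^ m = (L - u) ^ (m + 1) := by
  rw [intervalIntegral.integral_const_mul,
    intervalIntegral.integral_comp_sub_left (fun x => x ^ m) L, integral_pow]
  field_simp
  simp

/-- Partial summation: a linear bound for the counting function of the weights `a` gives a bound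
for the moments `∑ a i * (L - u i)₊ ^ (m + 1)`. -/
theorem sum_mul_posPart_pow_le {α : Type*} {s : Finset α} {a u : α → ℝ} (ha : ∀ i ∈ s, 0 ≤ a i)
    (hu : ∀ i ∈ s, 0 ≤ u i) {c C L : ℝ} (hL : 0 ≤ L)
    (hA : ∀ v, 0 ≤ v → ∑ i ∈ s with u i ≤ v, a i ≤ c * v + C) (m : ℕ) :
    ∑ i ∈ s, a i * (max (L - u i) 0) ^ (m + 1) ≤
      c * (L ^ (m + 2) / (m + 2)) + C * L ^ (m + 1) := by
  classical
  set f : ℝ → ℝ := fun v => ((m : ℝ) + 1) * (L - v) ^ m with hf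
  have hfc : Continuous f := by fun_prop
  have hfi : ∀ t : Set ℝ, MeasurableSet t →
      MeasureTheory.IntegrableOn (t.indicator f) (Set.Ioc 0 L) := fun t ht =>
    ((hfc.intervalIntegrable 0 L).1).indicator ht
  -- Each power is the integral of `f` from `u i` to `L`, so the sum becomes an integral against the
  -- counting function of the weights.
  have h1 : ∀ i ∈ s, (max (L - u i) 0) ^ (m + 1) =
      ∫ v in Set.Ioc 0 L, (Set.Ioi (u i)).indicator f v := by
    intro i hi
    rw [MeasureTheory.setIntegral_indicator measurableSet_Ioi]
    have : Set.Ioc 0 L ∩ Set.Ioi (u i) = Set.Ioc (u i) L := by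
      ext x
      simp only [Set.mem_inter_iff, Set.mem_Ioc, Set.mem_Ioi]
      have := hu i hi
      constructor
      · rintro ⟨⟨_, h2⟩, h3⟩; exact ⟨h3, h2⟩
      · rintro ⟨h2, h3⟩; exact ⟨⟨by linarith, h3⟩, h2⟩
    rw [this]
    by_cases hle : u i ≤ L
    · rw [← intervalIntegral.integral_of_le hle, hf, integral_succ_mul_sub_pow,
        max_eq_left (by linarith)]
    · push Not at hle
      rw [Set.Ioc_eq_empty (by linarith), max_eq_right (by linarith)]
      simp
  have h2 : ∑ i ∈ s, a i * (max (L - u i) 0) ^ (m + 1) =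
      ∫ v in Set.Ioc 0 L, ∑ i ∈ s, a i * (Set.Ioi (u i)).indicator f v := by
    rw [MeasureTheory.integral_finsetSum]
    · refine Finset.sum_congr rfl fun i hi => ?_
      rw [MeasureTheory.integral_const_mul, h1 i hi]
    · intro i _
      exact (hfi _ measurableSet_Ioi).const_mul _
  have h3 : ∫ v in Set.Ioc 0 L, ∑ i ∈ s, a i * (Set.Ioi (u i)).indicator f v ≤
      ∫ v in Set.Ioc 0 L, f v * (c * v + C) := by
    refine MeasureTheory.setIntegral_mono_on ?_ ?_ measurableSet_Ioc ?_
    · exact MeasureTheory.integrable_finsetSum _ fun i _ =>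
        (hfi _ measurableSet_Ioi).const_mul _
    · have hc2 : Continuous fun v => f v * (c * v + C) := by fun_prop
      exact (hc2.intervalIntegrable 0 L).1
    · intro v hv
      have hfv : 0 ≤ f v := by
        have : 0 ≤ L - v := by linarith [hv.2]
        simp only [hf]; positivity
      refine le_trans ?_ (mul_le_mul_of_nonneg_left (hA v hv.1.le) hfv)
      rw [Finset.mul_sum, Finset.sum_filter]
      refine Finset.sum_le_sum fun i hi => ?_
      by_cases hlt : u i < v
      · rw [Set.indicator_of_mem (by exact hlt), if_pos hlt.le, mul_comm]
      · rw [Set.indicator_of_notMem (by exact hlt), mul_zero]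
        split_ifs
        · exact mul_nonneg hfv (ha i hi)
        · exact le_rfl
  rw [h2]
  refine h3.trans (le_of_eq ?_)
  rw [← intervalIntegral.integral_of_le hL]
  -- Here `c * v + C = (c * L + C) - c * (L - v)`, which leaves only pure powers of `L - v` to
  -- integrate.
  have h4 : ∀ v, f v * (c * v + C) = (c * L + C) * (((m : ℝ) + 1) * (L - v) ^ m) -
      (c * (m + 1) / (m + 2)) * ((((m + 1 : ℕ) : ℝ) + 1) * (L - v) ^ (m + 1)) := by
    intro v
    simp only [hf]
    push_cast
    field_simp
    ring
  simp_rw [h4]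
  rw [intervalIntegral.integral_sub, intervalIntegral.integral_const_mul (c * L + C),
    intervalIntegral.integral_const_mul (c * (m + 1) / (m + 2)), integral_succ_mul_sub_pow, integral_succ_mul_sub_pow]
  · field_simp
    ring
  · exact Continuous.intervalIntegrable (by fun_prop) _ _
  · exact Continuous.intervalIntegrable (by fun_prop) _ _

end PartialSummation

section Moments

variable {ι : Type*} [DecidableEq ι]

/-- The moment `∑ g(U) (L - u(U))₊ ^ j` over the subsets `U` of `P`, where `g` is extended
multiplicatively and `u` additively. -/
noncomputable def subsetMoment (P : Finset ι) (g u : ι → ℝ) (L : ℝ) (j : ℕ) : ℝ :=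
  ∑ U ∈ P.powerset, (∏ p ∈ U, g p) * (max (L - ∑ p ∈ U, u p) 0) ^ j

theorem max_sub_add_eq {L x y : ℝ} (hy : 0 ≤ y) :
    max (L - (x + y)) 0 = max (max (L - x) 0 - y) 0 := by
  rcases le_total (L - x) 0 with h | h
  · rw [max_eq_right h, max_eq_right (by linarith), max_eq_right (by linarith)]
  · rw [max_eq_left h]; congr 1; ring

theorem posPart_pow_add_two (x : ℝ) (j : ℕ) :
    (max x 0) ^ (j + 2) = x * (max x 0) ^ (j + 1) := by
  rcases le_total x 0 with h | h
  · simp [max_eq_right h]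
  · rw [max_eq_left h]; ring

/-- The recursive lower bound for consecutive moments of a `κ`-dimensional function `g`. -/
theorem sub_mul_subsetMoment_le {P : Finset ι} {g u : ι → ℝ} (hg : ∀ p ∈ P, 0 ≤ g p)
    (hu : ∀ p ∈ P, 0 ≤ u p) {κ C : ℝ}
    (h : ∀ v, 0 ≤ v → ∑ p ∈ P with u p ≤ v, g p * u p ≤ κ * v + C) (L : ℝ) (j : ℕ) :
    (L - C) * subsetMoment P g u L (j + 1) ≤
      (1 + κ / (j + 2)) * subsetMoment P g u L (j + 2) := by
  have hgU : ∀ U ∈ P.powerset, 0 ≤ ∏ p ∈ U, g p := fun U hU =>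
    Finset.prod_nonneg fun p hp => hg p (Finset.mem_powerset.1 hU hp)
  -- One factor `L - u(U)` is split off the power of exponent `j + 2`, and `u(U)` is spread over the
  -- elements of `U`.
  have h1 : L * subsetMoment P g u L (j + 1) - subsetMoment P g u L (j + 2) =
      ∑ U ∈ P.powerset, ∑ p ∈ U, u p * ((∏ p ∈ U, g p) *
        (max (L - ∑ p ∈ U, u p) 0) ^ (j + 1)) := by
    simp only [subsetMoment, Finset.mul_sum, ← Finset.sum_sub_distrib]
    refine Finset.sum_congr rfl fun U _ => ?_
    rw [posPart_pow_add_two, ← Finset.sum_mul]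
    ring
  -- Write `U = {p} ∪ V`. The condition `p ∉ V` may be dropped because all terms are nonnegative.
  have h2 : ∑ U ∈ P.powerset, ∑ p ∈ U, u p * ((∏ p ∈ U, g p) *
        (max (L - ∑ p ∈ U, u p) 0) ^ (j + 1)) ≤
      ∑ V ∈ P.powerset, (∏ p ∈ V, g p) *
        ∑ p ∈ P, (g p * u p) * (max (max (L - ∑ p ∈ V, u p) 0 - u p) 0) ^ (j + 1) := by
    rw [Finset.sum_comm' (s' := fun p => P.powerset.filter ({p} ⊆ ·)) (t' := P)]
    · simp_rw [Finset.mul_sum]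
      rw [Finset.sum_comm (s := P.powerset)]
      refine Finset.sum_le_sum fun p hp => ?_
      rw [sum_powerset_filter_superset (Finset.singleton_subset_iff.2 hp)]
      refine le_trans (le_of_eq ?_) (Finset.sum_le_sum_of_subset_of_nonneg
        (Finset.powerset_mono.2 (Finset.sdiff_subset (s := P) (t := {p}))) ?_)
      · refine Finset.sum_congr rfl fun T hT => ?_
        have hd : Disjoint {p} T := Finset.disjoint_of_subset_right (Finset.mem_powerset.1 hT)
          Finset.disjoint_sdiff
        rw [Finset.prod_union hd, Finset.sum_union hd, Finset.prod_singleton,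
          Finset.sum_singleton, add_comm (u p), max_sub_add_eq (hu p hp)]
        ring
      · intro V hV _
        exact mul_nonneg (hgU V hV) (mul_nonneg (mul_nonneg (hg p hp) (hu p hp))
          (pow_nonneg (le_max_right _ _) _))
    · intro U p
      simp only [Finset.mem_powerset, Finset.mem_filter, Finset.singleton_subset_iff]
      exact ⟨fun h => ⟨h, h.1 h.2⟩, fun h => h.1⟩
  have h3 : ∑ V ∈ P.powerset, (∏ p ∈ V, g p) *
        ∑ p ∈ P, (g p * u p) * (max (max (L - ∑ p ∈ V, u p) 0 - u p) 0) ^ (j + 1) ≤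
      κ / (j + 2) * subsetMoment P g u L (j + 2) + C * subsetMoment P g u L (j + 1) := by
    simp only [subsetMoment, Finset.mul_sum, ← Finset.sum_add_distrib]
    refine Finset.sum_le_sum fun V hV => ?_
    have := sum_mul_posPart_pow_le (s := P) (a := fun p => g p * u p) (u := u)
      (L := max (L - ∑ p ∈ V, u p) 0)
      (fun p hp => mul_nonneg (hg p hp) (hu p hp)) hu (le_max_right _ _) h j
    rw [← Finset.mul_sum]
    refine (mul_le_mul_of_nonneg_left this (hgU V hV)).trans (le_of_eq ?_)
    ring
  linarith

/-- Expanding `∏ (g + f)` splits each set into a part `V` carrying `g` and a part `T` carrying `f`.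
Once their disjointness is forgotten, partial summation over `T` trades the one-dimensional factor
`f` for one more power of the cutoff. It is applied to `k/(p-k) = (k-1)/(p-k) + 1/(p-k)`. -/
theorem sum_prod_add_posPart_pow_le {P : Finset ι} {g f u : ι → ℝ} (hg : ∀ p ∈ P, 0 ≤ g p)
    (hf : ∀ p ∈ P, 0 ≤ f p) (hu : ∀ p ∈ P, 0 ≤ u p) {c C : ℝ}
    (h : ∀ v, 0 ≤ v → ∑ T ∈ P.powerset with ∑ p ∈ T, u p ≤ v, ∏ p ∈ T, f p ≤ c * v + C)
    (L : ℝ) (m : ℕ) :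
    subsetMoment P (fun p => g p + f p) u L (m + 1) ≤
      c / (m + 2) * subsetMoment P g u L (m + 2) + C * subsetMoment P g u L (m + 1) := by
  have hgU : ∀ U ∈ P.powerset, 0 ≤ ∏ p ∈ U, g p := fun U hU =>
    Finset.prod_nonneg fun p hp => hg p (Finset.mem_powerset.1 hU hp)
  have hfU : ∀ U ∈ P.powerset, 0 ≤ ∏ p ∈ U, f p := fun U hU =>
    Finset.prod_nonneg fun p hp => hf p (Finset.mem_powerset.1 hU hp)
  have huU : ∀ U ∈ P.powerset, 0 ≤ ∑ p ∈ U, u p := fun U hU =>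
    Finset.sum_nonneg fun p hp => hu p (Finset.mem_powerset.1 hU hp)
  have h1 : subsetMoment P (fun p => g p + f p) u L (m + 1) ≤
      ∑ V ∈ P.powerset, (∏ p ∈ V, g p) * ∑ T ∈ P.powerset,
        (∏ p ∈ T, f p) * (max (max (L - ∑ p ∈ V, u p) 0 - ∑ p ∈ T, u p) 0) ^ (m + 1) := by
    simp only [subsetMoment, Finset.prod_add, Finset.sum_mul]
    rw [sum_powerset_powerset]
    refine Finset.sum_le_sum fun V hV => ?_
    rw [Finset.mul_sum]
    refine le_trans (le_of_eq ?_) (Finset.sum_le_sum_of_subset_of_nonneg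
        (Finset.powerset_mono.2 (Finset.sdiff_subset (s := P) (t := V))) ?_)
    · refine Finset.sum_congr rfl fun T hT => ?_
      have hd : Disjoint V T := Finset.disjoint_of_subset_right (Finset.mem_powerset.1 hT)
          Finset.disjoint_sdiff
      have hT' : T ∈ P.powerset := Finset.mem_powerset.2
        ((Finset.mem_powerset.1 hT).trans Finset.sdiff_subset)
      rw [Finset.sum_union hd, max_sub_add_eq (huU T hT'), Finset.union_sdiff_left,
        Finset.sdiff_eq_self_of_disjoint hd.symm]
      ring
    · intro T hT _
      exact mul_nonneg (hgU V hV) (mul_nonneg (hfU T hT) (pow_nonneg (le_max_right _ _) _))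
  refine h1.trans ?_
  simp only [subsetMoment, Finset.mul_sum, ← Finset.sum_add_distrib]
  refine Finset.sum_le_sum fun V hV => ?_
  have := sum_mul_posPart_pow_le (s := P.powerset) (a := fun T => ∏ p ∈ T, f p)
    (u := fun T => ∑ p ∈ T, u p) (L := max (L - ∑ p ∈ V, u p) 0) hfU huU (le_max_right _ _) h m
  rw [← Finset.mul_sum]
  refine (mul_le_mul_of_nonneg_left this (hgU V hV)).trans (le_of_eq ?_)
  ring

end Moments

theorem pow_le_subsetMoment {ι : Type*} {P : Finset ι} {g u : ι → ℝ} (hg : ∀ p ∈ P, 0 ≤ g p)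
    {L : ℝ} (hL : 0 ≤ L) (j : ℕ) : L ^ j ≤ subsetMoment P g u L j := by
  have := Finset.single_le_sum (f := fun U => (∏ p ∈ U, g p) * (max (L - ∑ p ∈ U, u p) 0) ^ j)
    (s := P.powerset) (fun U hU => mul_nonneg (Finset.prod_nonneg fun p hp =>
      hg p (Finset.mem_powerset.1 hU hp)) (pow_nonneg (le_max_right _ _) _))
    (Finset.empty_mem_powerset P)
  simpa [subsetMoment, max_eq_left hL] using this

/-! ### Mertens-type bounds and sums over smooth or coprime integers -/

/-- Upper half of Mertens' theorem: `∑ ⌊n/p⌋ log p` is the sum of the logarithms of the radicals of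
the integers up to `n`, hence at most `n log n`. Chebyshev's bound pays for removing the floors. -/
theorem sum_log_prime_div_le {n : ℕ} (hn : 1 ≤ n) :
    ∑ p ∈ Finset.Icc 1 n with p.Prime, Real.log p / p ≤ Real.log n + Real.log 4 := by
  have hn' : (0 : ℝ) < n := by exact_mod_cast hn
  have hlogp : ∀ p : ℕ, p.Prime → 0 ≤ Real.log p := fun p hp =>
    Real.log_nonneg (by exact_mod_cast hp.one_le)
  have h1 : ∑ m ∈ Finset.Icc 1 n, ∑ p ∈ m.primeFactors, Real.log p ≤ n * Real.log n := by
    have : ∀ m ∈ Finset.Icc 1 n, ∑ p ∈ m.primeFactors, Real.log p ≤ Real.log n := by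
      intro m hm
      rw [Finset.mem_Icc] at hm
      rw [← Real.log_prod (fun p hp => by
        exact_mod_cast (Nat.prime_of_mem_primeFactors hp).ne_zero), ← Nat.cast_prod]
      refine Real.log_le_log ?_ ?_
      · exact_mod_cast Finset.prod_pos fun p hp => (Nat.prime_of_mem_primeFactors hp).pos
      · exact Nat.cast_le.2 ((Nat.le_of_dvd (by omega) (Nat.prod_primeFactors_dvd m)).trans hm.2)
    refine (Finset.sum_le_sum this).trans (le_of_eq ?_)
    simp
  have h2 : ∑ m ∈ Finset.Icc 1 n, ∑ p ∈ m.primeFactors, Real.log p =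
      ∑ p ∈ Finset.Icc 1 n with p.Prime, ((n / p : ℕ) : ℝ) * Real.log p := by
    rw [Finset.sum_comm' (s' := fun p => (Finset.Icc 1 n).filter (p ∣ ·))
      (t' := (Finset.Icc 1 n).filter Nat.Prime)]
    · refine Finset.sum_congr rfl fun p _ => ?_
      rw [Finset.sum_const, nsmul_eq_mul]
      congr 2
      exact Nat.Ioc_filter_dvd_card_eq_div n p
    · intro m p
      simp only [Finset.mem_Icc, Nat.mem_primeFactors, Finset.mem_filter]
      constructor
      · rintro ⟨⟨h1, h2⟩, h3, h4, h5⟩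
        exact ⟨⟨⟨h1, h2⟩, h4⟩, ⟨h3.one_le, (Nat.le_of_dvd (by omega) h4).trans h2⟩, h3⟩
      · rintro ⟨⟨⟨h1, h2⟩, h4⟩, _, h3⟩
        exact ⟨⟨h1, h2⟩, h3, h4, by omega⟩
  have h3 : ∑ p ∈ Finset.Icc 1 n with p.Prime, Real.log p ≤ Real.log 4 * n := by
    have := Chebyshev.theta_le_log4_mul_x (x := n) hn'.le
    rw [Chebyshev.theta, Nat.floor_natCast] at this
    exact this
  have h4 : ∑ p ∈ Finset.Icc 1 n with p.Prime, (n * (Real.log p / p) - Real.log p) ≤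
      ∑ p ∈ Finset.Icc 1 n with p.Prime, ((n / p : ℕ) : ℝ) * Real.log p := by
    refine Finset.sum_le_sum fun p hp => ?_
    have hp := (Finset.mem_filter.1 hp).2
    have h5 : (n : ℝ) / p - 1 ≤ ((n / p : ℕ) : ℝ) := by
      have := Nat.lt_floor_add_one ((n : ℝ) / p)
      rw [Nat.floor_div_natCast, Nat.floor_natCast] at this
      linarith
    calc n * (Real.log p / p) - Real.log p = ((n : ℝ) / p - 1) * Real.log p := by ring
      _ ≤ _ := mul_le_mul_of_nonneg_right h5 (hlogp p hp)
  rw [Finset.sum_sub_distrib, ← Finset.mul_sum] at h4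
  have h5 : (n : ℝ) * ∑ p ∈ Finset.Icc 1 n with p.Prime, Real.log p / p ≤
      n * (Real.log n + Real.log 4) := by linarith
  exact le_of_mul_le_mul_left h5 hn'

/-- This is the dimension hypothesis of `sub_mul_subsetMoment_le` with `κ = k - 1`, uniform in `P`.
Replacing `p - k` by `p` costs a convergent series, because `log p ≤ 2 √p` and `p ≥ 2k`. -/
theorem exists_sum_log_div_sub_le (k : ℕ) (hk : 1 ≤ k) : ∃ C : ℝ, 0 ≤ C ∧ ∀ P : Finset ℕ,
    (∀ p ∈ P, p.Prime ∧ 2 * k ≤ p) → ∀ v : ℝ, 0 ≤ v →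
    ∑ p ∈ P with Real.log (p : ℕ) ≤ v, ((k : ℝ) - 1) / ((p : ℝ) - k) * Real.log p ≤
      ((k : ℝ) - 1) * v + C := by
  have hsum : Summable fun n : ℕ => 1 / (n : ℝ) ^ (3 / 2 : ℝ) :=
    Real.summable_one_div_nat_rpow.2 (by norm_num)
  set Z := ∑' n : ℕ, 1 / (n : ℝ) ^ (3 / 2 : ℝ) with hZ
  have hZ0 : 0 ≤ Z := tsum_nonneg fun n => by positivity
  have hk1 : (0 : ℝ) ≤ (k : ℝ) - 1 := by
    have : (1 : ℝ) ≤ k := by exact_mod_cast hk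
    linarith
  refine ⟨((k : ℝ) - 1) * Real.log 4 + ((k : ℝ) - 1) * (4 * k * Z), ?_, ?_⟩
  · have : 0 ≤ Real.log 4 := Real.log_nonneg (by norm_num)
    positivity
  intro P hP v hv
  have h1 : ∀ p ∈ P.filter (fun p : ℕ => Real.log p ≤ v),
      ((k : ℝ) - 1) / ((p : ℝ) - k) * Real.log p ≤
        ((k : ℝ) - 1) * (Real.log p / p) + ((k : ℝ) - 1) * (4 * k * (1 / (p : ℝ) ^ (3 / 2 : ℝ))) := by
    intro p hp
    obtain ⟨hpp, hkp⟩ := hP p (Finset.mem_filter.1 hp).1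
    have hp0 : (0 : ℝ) < p := by exact_mod_cast hpp.pos
    have hkp' : 2 * (k : ℝ) ≤ p := by exact_mod_cast hkp
    have hk0 : (1 : ℝ) ≤ k := by exact_mod_cast hk
    have hpk : 0 < (p : ℝ) - k := by linarith
    have e1 : ((k : ℝ) - 1) / ((p : ℝ) - k) * Real.log p = ((k : ℝ) - 1) * (Real.log p / p) +
        ((k : ℝ) - 1) * (k * Real.log p / (p * (p - k))) := by
      field_simp
      ring
    rw [e1]
    refine add_le_add le_rfl (mul_le_mul_of_nonneg_left ?_ hk1)
    have e2 : (p : ℝ) ^ (3 / 2 : ℝ) = p * (p : ℝ) ^ (1 / 2 : ℝ) := by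
      rw [show (3 / 2 : ℝ) = 1 + 1 / 2 by norm_num, Real.rpow_add hp0, Real.rpow_one]
    have e3 : (p : ℝ) = (p : ℝ) ^ (1 / 2 : ℝ) * (p : ℝ) ^ (1 / 2 : ℝ) := by
      rw [← Real.rpow_add hp0]; norm_num
    have hs0 : 0 < (p : ℝ) ^ (1 / 2 : ℝ) := by positivity
    have e4 : Real.log p ≤ 2 * (p : ℝ) ^ (1 / 2 : ℝ) := by
      have := Real.log_le_rpow_div hp0.le (ε := 1 / 2) (by norm_num)
      linarith
    set t := (p : ℝ) ^ (1 / 2 : ℝ)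
    rw [e2, mul_one_div, div_le_div_iff₀ (by positivity) (by positivity)]
    have e5 : Real.log p * t ≤ 2 * p := by
      calc Real.log p * t ≤ 2 * t * t := by gcongr
        _ = 2 * p := by rw [mul_assoc, ← e3]
    calc k * Real.log p * (p * t) = k * p * (Real.log p * t) := by ring
      _ ≤ k * p * (2 * p) := by gcongr
      _ ≤ k * p * (4 * (p - k)) := mul_le_mul_of_nonneg_left (by linarith) (by positivity)
      _ = _ := by ring
  refine (Finset.sum_le_sum h1).trans ?_
  rw [Finset.sum_add_distrib, ← Finset.mul_sum, ← Finset.mul_sum, ← Finset.mul_sum]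
  have h2 : ∑ p ∈ P.filter (fun p : ℕ => Real.log p ≤ v), 1 / (p : ℝ) ^ (3 / 2 : ℝ) ≤ Z :=
    hsum.sum_le_tsum _ fun n _ => by positivity
  have hY : 1 ≤ ⌊Real.exp v⌋₊ := Nat.le_floor (by simpa using hv)
  have h3 : ∑ p ∈ P.filter (fun p : ℕ => Real.log p ≤ v), Real.log p / p ≤ v + Real.log 4 := by
    have h4 := sum_log_prime_div_le hY
    have h5 : Real.log (⌊Real.exp v⌋₊ : ℝ) ≤ v := by
      rw [Real.log_le_iff_le_exp (by exact_mod_cast hY)]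
      exact Nat.floor_le (Real.exp_nonneg v)
    refine le_trans (Finset.sum_le_sum_of_subset_of_nonneg ?_ ?_) (h4.trans (by linarith))
    · intro p hp
      simp only [Finset.mem_filter, Finset.mem_Icc] at hp ⊢
      have hpp := (hP p hp.1).1
      refine ⟨⟨hpp.one_le, Nat.le_floor ?_⟩, hpp⟩
      exact (Real.log_le_iff_le_exp (by exact_mod_cast hpp.pos)).1 hp.2
    · intro p hp _
      exact div_nonneg (Real.log_nonneg
        (by exact_mod_cast (Finset.mem_filter.1 hp).2.one_le)) (by positivity)
  have h6 : 4 * (k : ℝ) * ∑ p ∈ P.filter (fun p : ℕ => Real.log p ≤ v),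
      1 / (p : ℝ) ^ (3 / 2 : ℝ) ≤ 4 * k * Z := by gcongr
  have h7 := mul_le_mul_of_nonneg_left h3 hk1
  have h8 := mul_le_mul_of_nonneg_left h6 hk1
  linarith

/-- Every block of `W` consecutive integers has `φ(W)` members coprime to `W`, so the blocks after
the first contribute `φ(W)/W` times a harmonic sum. The first block is bounded trivially by `W`. -/
theorem sum_inv_coprime_le {W Y : ℕ} (hW : 1 ≤ W) (hY : 1 ≤ Y) :
    ∑ n ∈ Finset.Icc 1 Y with W.Coprime n, (1 : ℝ) / n ≤
      (W.totient : ℝ) / W * Real.log Y + (W + 1) := by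
  have hW0 : (0 : ℝ) < W := by exact_mod_cast hW
  have hφ : (W.totient : ℝ) / W ≤ 1 := by
    rw [div_le_one hW0]; exact_mod_cast Nat.totient_le W
  have hφ0 : 0 ≤ (W.totient : ℝ) / W := by positivity
  have key : ∀ J : ℕ, ∑ n ∈ Finset.Ico 1 (W * (J + 1)) with W.Coprime n, (1 : ℝ) / n ≤
      W + (W.totient : ℝ) / W * (harmonic J : ℝ) := by
    intro J
    induction J with
    | zero =>
      simp only [zero_add, mul_one, harmonic_zero, Rat.cast_zero, mul_zero, add_zero]
      refine (Finset.sum_le_card_nsmul _ _ 1 ?_).trans ?_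
      · intro n hn
        have : 1 ≤ n := (Finset.mem_Ico.1 (Finset.mem_filter.1 hn).1).1
        exact (div_le_one (by positivity)).2 (by exact_mod_cast this)
      · rw [nsmul_eq_mul, mul_one]
        have := Finset.card_filter_le (Finset.Ico 1 W) (fun n => W.Coprime n)
        rw [Nat.card_Ico] at this
        exact_mod_cast this.trans (by omega)
    | succ J ih =>
      have hle : 1 ≤ W * (J + 1) := Nat.one_le_iff_ne_zero.2 (by positivity)
      rw [show W * (J + 1 + 1) = W * (J + 1) + W by ring]
      rw [← Finset.Ico_union_Ico_eq_Ico hle (Nat.le_add_right _ W), Finset.filter_union,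
        Finset.sum_union (Finset.disjoint_filter_filter
          (Finset.Ico_disjoint_Ico_consecutive _ _ _))]
      have h1 : ∑ n ∈ Finset.Ico (W * (J + 1)) (W * (J + 1) + W) with W.Coprime n, (1 : ℝ) / n ≤
          W.totient * (1 / (W * (J + 1) : ℝ)) := by
        refine (Finset.sum_le_card_nsmul _ _ (1 / (W * (J + 1) : ℝ)) ?_).trans ?_
        · intro n hn
          have := (Finset.mem_Ico.1 (Finset.mem_filter.1 hn).1).1
          refine one_div_le_one_div_of_le (by positivity) ?_
          exact_mod_cast this
        · rw [Nat.filter_coprime_Ico_eq_totient, nsmul_eq_mul]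
      rw [harmonic_succ]
      push_cast
      have h2 : (W.totient : ℝ) * (1 / (W * (J + 1) : ℝ)) = W.totient / W * ((J : ℝ) + 1)⁻¹ := by
        field_simp
      rw [h2] at h1
      linarith
  have hsub : ∑ n ∈ Finset.Icc 1 Y with W.Coprime n, (1 : ℝ) / n ≤
      ∑ n ∈ Finset.Ico 1 (W * (Y / W + 1)) with W.Coprime n, (1 : ℝ) / n := by
    refine Finset.sum_le_sum_of_subset_of_nonneg ?_ fun n _ _ => by positivity
    refine Finset.filter_subset_filter _ fun n hn => ?_
    rw [Finset.mem_Icc] at hn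
    have := Nat.lt_mul_div_succ Y hW
    exact Finset.mem_Ico.2 ⟨hn.1, by omega⟩
  have hlogY : 0 ≤ Real.log Y := Real.log_nonneg (by exact_mod_cast hY)
  have hh : (harmonic (Y / W) : ℝ) ≤ 1 + Real.log Y := by
    rcases Nat.eq_zero_or_pos (Y / W) with h0 | h0
    · rw [h0]; simp; linarith
    · refine (harmonic_le_one_add_log _).trans ?_
      have : Real.log ((Y / W : ℕ) : ℝ) ≤ Real.log Y :=
        Real.log_le_log (by exact_mod_cast h0) (by exact_mod_cast Nat.div_le_self Y W)
      linarith
  have := key (Y / W)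
  have h3 := mul_le_mul_of_nonneg_left hh hφ0
  nlinarith

theorem prod_injOn_primes {P : Finset ℕ} (hP : ∀ p ∈ P, p.Prime) :
    Set.InjOn (fun T : Finset ℕ => ∏ p ∈ T, p) (P.powerset : Set (Finset ℕ)) := by
  intro S hS T hT h
  have hS' : ∀ p ∈ S, p.Prime := fun p hp => hP p (Finset.mem_powerset.1 hS hp)
  have hT' : ∀ p ∈ T, p.Prime := fun p hp => hP p (Finset.mem_powerset.1 hT hp)
  rw [← Nat.primeFactors_prod hS', ← Nat.primeFactors_prod hT']
  exact congrArg _ h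

theorem sum_prod_inv_le_sum_coprime {P : Finset ℕ} {W : ℕ} (hP : ∀ p ∈ P, p.Prime ∧ ¬ p ∣ W)
    (v : ℝ) :
    ∑ T ∈ P.powerset with ∑ p ∈ T, Real.log (p : ℕ) ≤ v, ∏ p ∈ T, (1 : ℝ) / p ≤
      ∑ n ∈ Finset.Icc 1 ⌊Real.exp v⌋₊ with W.Coprime n, (1 : ℝ) / n := by
  have hpos : ∀ T ⊆ P, 0 < ∏ p ∈ T, p := fun T hT => Finset.prod_pos fun p hp =>
    (hP p (hT hp)).1.pos
  have h1 : ∀ T ∈ P.powerset.filter (fun T => ∑ p ∈ T, Real.log (p : ℕ) ≤ v), ∏ p ∈ T, (1 : ℝ) / p =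
      (fun n : ℕ => (1 : ℝ) / n) (∏ p ∈ T, p) := by
    intro T _
    simp
  rw [Finset.sum_congr rfl h1, ← Finset.sum_image (g := fun T : Finset ℕ => ∏ p ∈ T, p)
    (f := fun n : ℕ => (1 : ℝ) / n)
    ((prod_injOn_primes fun p hp => (hP p hp).1).mono fun T hT => (Finset.mem_filter.1 hT).1)]
  refine Finset.sum_le_sum_of_subset_of_nonneg ?_ fun n _ _ => by positivity
  intro n hn
  obtain ⟨T, hT, rfl⟩ := Finset.mem_image.1 hn
  simp only [Finset.mem_filter, Finset.mem_powerset, Finset.mem_Icc] at hT ⊢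
  have h0 := hpos T hT.1
  refine ⟨⟨h0, Nat.le_floor ?_⟩, Nat.Coprime.prod_right fun p hp => ?_⟩
  · rw [← Real.log_le_iff_le_exp (by exact_mod_cast h0)]
    push_cast
    rw [Real.log_prod (fun p hp => by exact_mod_cast (hP p (hT.1 hp)).1.ne_zero)]
    exact hT.2
  · exact ((hP p (hT.1 hp)).1.coprime_iff_not_dvd.2 (hP p (hT.1 hp)).2).symm

/-- If `u(V ∪ T) ≤ v` for disjoint `V`, `T`, then both parts satisfy the bound separately. -/
theorem sum_filter_prod_add_le {ι : Type*} [DecidableEq ι] {P : Finset ι} {f e u : ι → ℝ}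
    (hf : ∀ p ∈ P, 0 ≤ f p) (he : ∀ p ∈ P, 0 ≤ e p) (hu : ∀ p ∈ P, 0 ≤ u p) (v : ℝ) :
    ∑ U ∈ P.powerset with ∑ p ∈ U, u p ≤ v, ∏ p ∈ U, (e p + f p) ≤
      (∑ V ∈ P.powerset with ∑ p ∈ V, u p ≤ v, ∏ p ∈ V, e p) *
        ∑ T ∈ P.powerset with ∑ p ∈ T, u p ≤ v, ∏ p ∈ T, f p := by
  simp only [Finset.sum_filter, Finset.sum_mul_sum]
  have h1 : ∀ U ∈ P.powerset, (if ∑ p ∈ U, u p ≤ v then ∏ p ∈ U, (e p + f p) else 0) =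
      ∑ V ∈ U.powerset, (if ∑ p ∈ U, u p ≤ v then (∏ p ∈ V, e p) * ∏ p ∈ U \ V, f p else 0) := by
    intro U _
    split_ifs
    · rw [Finset.prod_add]
    · simp
  have hfU : ∀ U ∈ P.powerset, 0 ≤ ∏ p ∈ U, f p := fun U hU =>
    Finset.prod_nonneg fun p hp => hf p (Finset.mem_powerset.1 hU hp)
  have heU : ∀ U ∈ P.powerset, 0 ≤ ∏ p ∈ U, e p := fun U hU =>
    Finset.prod_nonneg fun p hp => he p (Finset.mem_powerset.1 hU hp)
  have huU : ∀ U ∈ P.powerset, 0 ≤ ∑ p ∈ U, u p := fun U hU =>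
    Finset.sum_nonneg fun p hp => hu p (Finset.mem_powerset.1 hU hp)
  rw [Finset.sum_congr rfl h1, sum_powerset_powerset]
  refine Finset.sum_le_sum fun V hV => ?_
  refine le_trans (Finset.sum_le_sum fun T hT => ?_) (Finset.sum_le_sum_of_subset_of_nonneg
    (Finset.powerset_mono.2 (Finset.sdiff_subset (s := P) (t := V))) ?_)
  · have hd : Disjoint V T := Finset.disjoint_of_subset_right (Finset.mem_powerset.1 hT)
      Finset.disjoint_sdiff
    have hT' : T ∈ P.powerset := Finset.mem_powerset.2
      ((Finset.mem_powerset.1 hT).trans Finset.sdiff_subset)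
    rw [Finset.sum_union hd, Finset.union_sdiff_left, Finset.sdiff_eq_self_of_disjoint hd.symm]
    have hVu := huU V hV
    have hTu := huU T hT'
    split_ifs with h2 h3 h4
    · exact le_rfl
    · linarith
    · linarith
    · linarith
    · exact mul_nonneg (heU V hV) (hfU T hT')
    · simp
    · simp
    · simp
  · intro T hT _
    refine mul_nonneg ?_ ?_ <;> split_ifs
    · exact heU V hV
    · exact le_rfl
    · exact hfU T hT
    · exact le_rfl

/-- Induction on `K`: each unit of `K` splits off one harmonic sum up to `e^v`, which is at most `1
+ v`. -/
theorem sum_filter_prod_div_le {P : Finset ℕ} (hP : ∀ p ∈ P, p.Prime) (K : ℕ) {v : ℝ}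
    (hv : 0 ≤ v) :
    ∑ T ∈ P.powerset with ∑ p ∈ T, Real.log (p : ℕ) ≤ v, ∏ p ∈ T, (K : ℝ) / p ≤ (1 + v) ^ K := by
  have hY : 1 ≤ ⌊Real.exp v⌋₊ := Nat.le_floor (by simpa using hv)
  have hlog : ∀ p ∈ P, 0 ≤ Real.log p := fun p hp =>
    Real.log_nonneg (by exact_mod_cast (hP p hp).one_le)
  have h1 : ∑ T ∈ P.powerset with ∑ p ∈ T, Real.log (p : ℕ) ≤ v, ∏ p ∈ T, (1 : ℝ) / p ≤ 1 + v := by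
    refine (sum_prod_inv_le_sum_coprime (W := 1)
      (fun p hp => ⟨hP p hp, (hP p hp).not_dvd_one⟩) v).trans ?_
    have h2 := harmonic_le_one_add_log ⌊Real.exp v⌋₊
    have h3 : Real.log (⌊Real.exp v⌋₊ : ℝ) ≤ v := by
      rw [Real.log_le_iff_le_exp (by exact_mod_cast hY)]
      exact Nat.floor_le (Real.exp_nonneg v)
    rw [harmonic_eq_sum_Icc] at h2
    push_cast at h2
    simp only [Nat.coprime_one_left_eq_true, Finset.filter_true, one_div]
    linarith
  induction K with
  | zero =>
    rw [Finset.sum_filter, Finset.sum_eq_single ∅]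
    · simp [hv]
    · intro T _ hT
      obtain ⟨p, hp⟩ := Finset.nonempty_iff_ne_empty.2 hT
      rw [Finset.prod_eq_zero hp (by simp), ite_self]
    · simp
  | succ K ih =>
    have h4 := sum_filter_prod_add_le (P := P) (e := fun p : ℕ => (K : ℝ) / p)
      (f := fun p : ℕ => (1 : ℝ) / p) (u := fun p : ℕ => Real.log p)
      (fun p _ => by positivity) (fun p _ => by positivity) hlog v
    have h5 : ∀ p : ℕ, ((K + 1 : ℕ) : ℝ) / p = (K : ℝ) / p + 1 / p := fun p => by
      push_cast; ring
    simp_rw [h5]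
    refine h4.trans ?_
    rw [pow_succ]
    refine mul_le_mul ih h1 (Finset.sum_nonneg fun T _ => Finset.prod_nonneg fun p _ => by
      positivity) (by positivity)

theorem prod_one_add_div_le {k D₀ : ℕ} (hD₀ : 1 ≤ D₀) {P : Finset ℕ}
    (hP : ∀ p ∈ P, D₀ < p ∧ 2 * k ≤ p) :
    ∏ p ∈ P, (1 + (k : ℝ) / (p * (p - k))) ≤ Real.exp (2 * k / D₀) := by
  have h1 : ∀ p ∈ P, (1 : ℝ) + (k : ℝ) / (p * (p - k)) ≤ Real.exp (2 * k * ((p : ℝ) ^ 2)⁻¹) := by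
    intro p hp
    have hp0 : (0 : ℝ) < p := by have := (hP p hp).1; exact_mod_cast (by omega : 0 < p)
    have hkp : 2 * (k : ℝ) ≤ p := by exact_mod_cast (hP p hp).2
    have h2 : (k : ℝ) / (p * (p - k)) ≤ 2 * k * ((p : ℝ) ^ 2)⁻¹ := by
      rw [← div_eq_mul_inv, div_le_div_iff₀ (mul_pos hp0 (by linarith)) (by positivity)]
      have : (0 : ℝ) ≤ k * p * (p - 2 * k) := mul_nonneg (by positivity) (by linarith)
      linarith
    have := Real.add_one_le_exp (2 * (k : ℝ) * ((p : ℝ) ^ 2)⁻¹)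
    linarith
  refine (Finset.prod_le_prod (fun p hp => ?_) h1).trans ?_
  · have hp0 : (0 : ℝ) < p := by have := (hP p hp).1; exact_mod_cast (by omega : 0 < p)
    have hkp : 2 * (k : ℝ) ≤ p := by exact_mod_cast (hP p hp).2
    have : 0 ≤ (p : ℝ) - k := by have : (0 : ℝ) ≤ k := by positivity
                                 linarith
    positivity
  · rw [← Real.exp_sum, ← Finset.mul_sum]
    refine Real.exp_le_exp.2 ?_
    rw [div_eq_mul_inv]
    refine mul_le_mul_of_nonneg_left ?_ (by positivity)
    have hsub : P ⊆ Finset.Ioc D₀ (max D₀ (P.sup id)) := fun p hp => Finset.mem_Ioc.2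
      ⟨(hP p hp).1, le_max_of_le_right (Finset.le_sup (f := id) hp)⟩
    refine (Finset.sum_le_sum_of_subset_of_nonneg hsub fun n _ _ => by positivity).trans ?_
    refine (sum_Ioc_inv_sq_le_sub (by omega) (le_max_left _ _)).trans ?_
    have : (0 : ℝ) ≤ ((max D₀ (P.sup id) : ℕ) : ℝ)⁻¹ := by positivity
    linarith

/-- Split `1/(p-k) = 1/p + k/(p(p-k))`. The first part leads to integers coprime to `W`, giving the
density `φ(W)/W`. The second contributes a product over primes beyond `D₀`, close to 1 when `D₀` is
large. -/
theorem sum_filter_prod_inv_sub_le {k D₀ W : ℕ} (hD₀ : 1 ≤ D₀) (hW : 1 ≤ W) {P : Finset ℕ}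
    (hP : ∀ p ∈ P, p.Prime ∧ ¬ p ∣ W ∧ D₀ < p ∧ 2 * k ≤ p) {v : ℝ} (hv : 0 ≤ v) :
    ∑ T ∈ P.powerset with ∑ p ∈ T, Real.log (p : ℕ) ≤ v, ∏ p ∈ T, 1 / ((p : ℝ) - k) ≤
      Real.exp (2 * k / D₀) * ((W.totient : ℝ) / W) * v + Real.exp (2 * k / D₀) * (W + 1) := by
  have hY : 1 ≤ ⌊Real.exp v⌋₊ := Nat.le_floor (by simpa using hv)
  have hpk : ∀ p ∈ P, (0 : ℝ) < p ∧ (0 : ℝ) < (p : ℝ) - k := fun p hp => by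
    have hp0 : (0 : ℝ) < p := by exact_mod_cast (hP p hp).1.pos
    have hkp : 2 * (k : ℝ) ≤ p := by exact_mod_cast (hP p hp).2.2.2
    have : (0 : ℝ) ≤ k := by positivity
    exact ⟨hp0, by linarith⟩
  have he : ∀ p ∈ P, (0 : ℝ) ≤ (k : ℝ) / (p * (p - k)) := fun p hp => by
    have := hpk p hp
    exact div_nonneg (by positivity) (mul_pos this.1 this.2).le
  have h1 := sum_filter_prod_add_le (P := P) (e := fun p : ℕ => (k : ℝ) / (p * (p - k)))
    (f := fun p : ℕ => (1 : ℝ) / p) (u := fun p : ℕ => Real.log p)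
    (fun p _ => by positivity) he
    (fun p hp => Real.log_nonneg (by exact_mod_cast (hP p hp).1.one_le)) v
  have h2 : ∀ T ∈ P.powerset.filter (fun T => ∑ p ∈ T, Real.log (p : ℕ) ≤ v),
      ∏ p ∈ T, 1 / ((p : ℝ) - k) = ∏ p ∈ T, ((k : ℝ) / (p * (p - k)) + 1 / p) := by
    intro T hT
    refine Finset.prod_congr rfl fun p hp => ?_
    have := hpk p (Finset.mem_powerset.1 (Finset.mem_filter.1 hT).1 hp)
    have h3 := this.1.ne'
    have h4 := this.2.ne'
    field_simp
    ring
  rw [Finset.sum_congr rfl h2]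
  refine h1.trans ?_
  have h3 : ∑ V ∈ P.powerset with ∑ p ∈ V, Real.log (p : ℕ) ≤ v,
      ∏ p ∈ V, (k : ℝ) / (p * (p - k)) ≤ Real.exp (2 * k / D₀) := by
    refine le_trans ?_ (prod_one_add_div_le hD₀ (P := P) fun p hp => (hP p hp).2.2)
    rw [Finset.prod_one_add]
    exact Finset.sum_le_sum_of_subset_of_nonneg (Finset.filter_subset _ _) fun V hV _ =>
      Finset.prod_nonneg fun p hp => he p (Finset.mem_powerset.1 hV hp)
  have h4 : ∑ T ∈ P.powerset with ∑ p ∈ T, Real.log (p : ℕ) ≤ v, ∏ p ∈ T, (1 : ℝ) / p ≤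
      (W.totient : ℝ) / W * v + (W + 1) := by
    refine (sum_prod_inv_le_sum_coprime (W := W) (fun p hp => ⟨(hP p hp).1, (hP p hp).2.1⟩)
      v).trans ((sum_inv_coprime_le hW hY).trans ?_)
    have h5 : Real.log (⌊Real.exp v⌋₊ : ℝ) ≤ v := by
      rw [Real.log_le_iff_le_exp (by exact_mod_cast hY)]
      exact Nat.floor_le (Real.exp_nonneg v)
    gcongr
  have h6 := mul_le_mul h3 h4 (Finset.sum_nonneg fun T _ => Finset.prod_nonneg fun p _ => by
      positivity) (Real.exp_nonneg _)
  linarith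

/-! ### Expansion of the sieve square and its error term -/

section SieveExpansion

variable {ι : Type*} [DecidableEq ι]

theorem sum_mul_sq_sum_powerset {α : Type*} {N : Finset α} (a : α → ℝ) {P : Finset ι}
    {A : α → Finset ι} (hA : ∀ n ∈ N, A n ⊆ P) (l : Finset ι → ℝ) :
    ∑ n ∈ N, a n * (∑ S ∈ (A n).powerset, l S) ^ 2 =
      ∑ S ∈ P.powerset, ∑ T ∈ P.powerset, l S * l T * ∑ n ∈ N with S ∪ T ⊆ A n, a n := by
  have h1 : ∀ n ∈ N, a n * (∑ S ∈ (A n).powerset, l S) ^ 2 =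
      ∑ S ∈ P.powerset, ∑ T ∈ P.powerset, if S ∪ T ⊆ A n then l S * l T * a n else 0 := by
    intro n hn
    have h2 : ∑ S ∈ (A n).powerset, l S = ∑ S ∈ P.powerset, if S ⊆ A n then l S else 0 := by
      rw [← Finset.sum_filter]
      refine Finset.sum_congr ?_ fun _ _ => rfl
      ext S
      simp only [Finset.mem_powerset, Finset.mem_filter]
      exact ⟨fun h => ⟨h.trans (hA n hn), h⟩, fun h => h.2⟩
    rw [h2, sq, Finset.sum_mul_sum, Finset.mul_sum]
    refine Finset.sum_congr rfl fun S _ => ?_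
    rw [Finset.mul_sum]
    refine Finset.sum_congr rfl fun T _ => ?_
    by_cases hS : S ⊆ A n <;> by_cases hT : T ⊆ A n <;>
      simp [hS, hT, Finset.union_subset_iff, mul_comm]
  rw [Finset.sum_congr rfl h1, Finset.sum_comm]
  refine Finset.sum_congr rfl fun S _ => ?_
  rw [Finset.sum_comm]
  refine Finset.sum_congr rfl fun T _ => ?_
  rw [Finset.mul_sum, Finset.sum_filter]

theorem abs_sum_mul_sq_sub_le {α : Type*} {N : Finset α} {a : α → ℝ} {P : Finset ι}
    {A : α → Finset ι} (hA : ∀ n ∈ N, A n ⊆ P) (l : Finset ι → ℝ) {X : ℝ} {w : ι → ℝ}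
    {E : Finset ι → ℝ}
    (hE : ∀ S ⊆ P, ∀ T ⊆ P, l S ≠ 0 → l T ≠ 0 →
      |∑ n ∈ N with S ∪ T ⊆ A n, a n - X * ∏ p ∈ S ∪ T, w p| ≤ E (S ∪ T)) :
    |∑ n ∈ N, a n * (∑ S ∈ (A n).powerset, l S) ^ 2 -
        X * ∑ S ∈ P.powerset, ∑ T ∈ P.powerset, l S * l T * ∏ p ∈ S ∪ T, w p| ≤
      ∑ S ∈ P.powerset, ∑ T ∈ P.powerset, |l S| * |l T| * E (S ∪ T) := by
  rw [sum_mul_sq_sum_powerset a hA, Finset.mul_sum, ← Finset.sum_sub_distrib]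
  refine (Finset.abs_sum_le_sum_abs _ _).trans (Finset.sum_le_sum fun S hS => ?_)
  rw [Finset.mul_sum, ← Finset.sum_sub_distrib]
  refine (Finset.abs_sum_le_sum_abs _ _).trans (Finset.sum_le_sum fun T hT => ?_)
  rw [Finset.mem_powerset] at hS hT
  rw [mul_left_comm X (l S * l T), ← mul_sub, abs_mul, abs_mul]
  by_cases h1 : l S = 0
  · simp [h1]
  by_cases h2 : l T = 0
  · simp [h2]
  exact mul_le_mul_of_nonneg_left (hE S hS T hT h1 h2) (by positivity)

/-- Pairs of subsets are grouped according to their union. -/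
theorem sum_sum_abs_mul_abs_mul_union_le {P : Finset ι} {u : ι → ℝ} (hu : ∀ p ∈ P, 0 ≤ u p)
    {l : Finset ι → ℝ} {B L : ℝ} (hB : 0 ≤ B)
    (hl : ∀ S ⊆ P, |l S| ≤ B * 2 ^ S.card) (hl0 : ∀ S ⊆ P, l S ≠ 0 → ∑ p ∈ S, u p ≤ L)
    {E : Finset ι → ℝ} (hE : ∀ U ⊆ P, 0 ≤ E U) :
    ∑ S ∈ P.powerset, ∑ T ∈ P.powerset, |l S| * |l T| * E (S ∪ T) ≤
      B ^ 2 * ∑ U ∈ P.powerset with ∑ p ∈ U, u p ≤ 2 * L, 16 ^ U.card * E U := by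
  have huU : ∀ U ⊆ P, 0 ≤ ∑ p ∈ U, u p := fun U hU => Finset.sum_nonneg fun p hp => hu p (hU hp)
  have hsmall : ∀ S ⊆ P, ∀ T ⊆ P, l S ≠ 0 → l T ≠ 0 → ∑ p ∈ S ∪ T, u p ≤ 2 * L := by
    intro S hS T hT h1 h2
    have h3 := Finset.sum_union_inter (s₁ := S) (s₂ := T) (f := u)
    have h4 := huU (S ∩ T) (Finset.inter_subset_left.trans hS)
    have h5 := hl0 S hS h1
    have h6 := hl0 T hT h2
    linarith
  set F : Finset ι → ℝ := fun U => if ∑ p ∈ U, u p ≤ 2 * L then E U else 0 with hF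
  have hF0 : ∀ U ⊆ P, 0 ≤ F U := fun U hU => by
    simp only [hF]; split_ifs
    · exact hE U hU
    · exact le_rfl
  have h1 : ∀ S ∈ P.powerset, ∀ T ∈ P.powerset, |l S| * |l T| * E (S ∪ T) ≤
      B ^ 2 * (4 ^ (S ∪ T).card * F (S ∪ T)) := by
    intro S hS T hT
    rw [Finset.mem_powerset] at hS hT
    have hUP := Finset.union_subset hS hT
    by_cases h1 : l S = 0
    · have := hF0 _ hUP
      simp only [h1, abs_zero, zero_mul]
      positivity
    by_cases h2 : l T = 0
    · have := hF0 _ hUP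
      simp only [h2, abs_zero, zero_mul, mul_zero]
      positivity
    have h3 : F (S ∪ T) = E (S ∪ T) := if_pos (hsmall S hS T hT h1 h2)
    rw [h3, ← mul_assoc]
    refine mul_le_mul_of_nonneg_right ?_ (hE _ hUP)
    have h4 : |l S| ≤ B * 2 ^ (S ∪ T).card := (hl S hS).trans (mul_le_mul_of_nonneg_left
      (pow_le_pow_right₀ (by norm_num) (Finset.card_le_card Finset.subset_union_left)) hB)
    have h5 : |l T| ≤ B * 2 ^ (S ∪ T).card := (hl T hT).trans (mul_le_mul_of_nonneg_left
      (pow_le_pow_right₀ (by norm_num) (Finset.card_le_card Finset.subset_union_right)) hB)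
    refine (mul_le_mul h4 h5 (abs_nonneg _) (by positivity)).trans (le_of_eq ?_)
    rw [show (4 : ℝ) = 2 * 2 by norm_num, mul_pow]
    ring
  refine (Finset.sum_le_sum fun S hS => Finset.sum_le_sum fun T hT => h1 S hS T hT).trans ?_
  simp_rw [← Finset.mul_sum]
  refine mul_le_mul_of_nonneg_left ?_ (by positivity)
  rw [← Finset.sum_product', ← Finset.sum_fiberwise_of_maps_to (g := fun x => x.1 ∪ x.2)
    (t := P.powerset), Finset.sum_filter]
  · refine Finset.sum_le_sum fun U hU => ?_
    have hFU := hF0 U (Finset.mem_powerset.1 hU)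
    -- A union `U` arises from at most `2 ^ |U|` choices of each of `S` and `T`. Together with the
    -- `4 ^ |U|` from the weights this gives `16 ^ |U|`.
    have h2 : ∑ x ∈ P.powerset ×ˢ P.powerset with x.1 ∪ x.2 = U,
        4 ^ (x.1 ∪ x.2).card * F (x.1 ∪ x.2) ≤
        ∑ x ∈ U.powerset ×ˢ U.powerset, 4 ^ U.card * F U := by
      rw [Finset.sum_congr rfl (g := fun _ => 4 ^ U.card * F U) fun x hx => by
        rw [(Finset.mem_filter.1 hx).2]]
      refine Finset.sum_le_sum_of_subset_of_nonneg ?_ fun _ _ _ => by positivity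
      intro x hx
      have hx := (Finset.mem_filter.1 hx).2
      rw [Finset.mem_product, Finset.mem_powerset, Finset.mem_powerset, ← hx]
      exact ⟨Finset.subset_union_left, Finset.subset_union_right⟩
    refine h2.trans (le_of_eq ?_)
    rw [Finset.sum_const, Finset.card_product, Finset.card_powerset, nsmul_eq_mul]
    simp only [hF]
    rw [show (16 : ℝ) = 2 * 2 * 4 by norm_num, mul_pow, mul_pow]
    push_cast
    split_ifs <;> ring
  · rintro ⟨S, T⟩ hx
    rw [Finset.mem_product, Finset.mem_powerset, Finset.mem_powerset] at hx
    exact Finset.mem_powerset.2 (Finset.union_subset hx.1 hx.2)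

end SieveExpansion

/-! ### The tuple weights and their main terms -/

/-- The diagonal variables `y(U) = (L - log ∏ U)₊ ^ l`. -/
noncomputable def logCutoff (L : ℝ) (l : ℕ) (U : Finset ℕ) : ℝ :=
  (max (L - ∑ p ∈ U, Real.log p) 0) ^ l

/-- The sieve weights for `k` residue classes modulo every prime of `P`. -/
noncomputable def tupleWeight (P : Finset ℕ) (k : ℕ) (L : ℝ) (l : ℕ) (S : Finset ℕ) : ℝ :=
  selbergLambda P (fun p => (k : ℝ) / p) (logCutoff L l) S

section TupleWeight

variable {P : Finset ℕ} {k l : ℕ} {L : ℝ}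

theorem sum_log_nonneg (hP : ∀ p ∈ P, p.Prime ∧ 2 * k < p) {U : Finset ℕ} (hU : U ⊆ P) :
    0 ≤ ∑ p ∈ U, Real.log p :=
  Finset.sum_nonneg fun p hp => Real.log_nonneg (by exact_mod_cast (hP p (hU hp)).1.one_le)

theorem logCutoff_eq_zero (hl : 1 ≤ l) {U : Finset ℕ} (hU : L ≤ ∑ p ∈ U, Real.log p) :
    logCutoff L l U = 0 := by
  rw [logCutoff, max_eq_right (by linarith), zero_pow (by omega)]

theorem tupleWeight_eq_zero (hP : ∀ p ∈ P, p.Prime ∧ 2 * k < p) (hl : 1 ≤ l) {S : Finset ℕ}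
    (hS : L ≤ ∑ p ∈ S, Real.log p) : tupleWeight P k L l S = 0 := by
  rw [tupleWeight, selbergLambda, Finset.sum_eq_zero, mul_zero]
  intro T hT
  have hT' := Finset.mem_powerset.1 hT
  have hd : Disjoint S T := Finset.disjoint_of_subset_right hT' Finset.disjoint_sdiff
  rw [logCutoff_eq_zero hl, zero_mul]
  rw [Finset.sum_union hd]
  have := sum_log_nonneg hP (hT'.trans Finset.sdiff_subset)
  linarith

theorem div_div_one_sub_div {k p : ℝ} (hp : p ≠ 0) : k / p / (1 - k / p) = k / (p - k) := by
  rw [one_sub_div hp, div_div_div_cancel_right₀ hp]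

/-- Up to sign the weight is `∏ p/(p-k)` over `S` times a nonnegative sum. As `p > 2k`, each factor
is at most 2, and `k/(p-k) ≤ 2k/p` makes the sum polylogarithmic. The error terms have enough saving
for so crude a bound. -/
theorem abs_tupleWeight_le (hk : 1 ≤ k) (hP : ∀ p ∈ P, p.Prime ∧ 2 * k < p) (hl : 1 ≤ l)
    (hL : 0 ≤ L) {S : Finset ℕ} (hS : S ⊆ P) :
    |tupleWeight P k L l S| ≤ (1 + L) ^ (l + 2 * k) * 2 ^ S.card := by
  have hk0 : (0 : ℝ) < k := by exact_mod_cast hk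
  have hpk : ∀ p ∈ P, (0 : ℝ) < p ∧ 2 * (k : ℝ) ≤ p := fun p hp =>
    ⟨by exact_mod_cast (hP p hp).1.pos, by exact_mod_cast (hP p hp).2.le⟩
  have hgle : ∀ p ∈ P, 0 ≤ (k : ℝ) / (p - k) ∧ (k : ℝ) / (p - k) ≤ ((2 * k : ℕ) : ℝ) / p := by
    intro p hp
    obtain ⟨h1, h2⟩ := hpk p hp
    have h3 : 0 < (p : ℝ) - k := by linarith
    refine ⟨by positivity, ?_⟩
    rw [div_le_div_iff₀ h3 h1]
    push_cast
    nlinarith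
  have hbound : ∑ T ∈ (P \ S).powerset, logCutoff L l (S ∪ T) * ∏ p ∈ T, (k : ℝ) / (p - k) ≤
      (1 + L) ^ (l + 2 * k) := by
    have h1 : ∀ T ∈ (P \ S).powerset, logCutoff L l (S ∪ T) * ∏ p ∈ T, (k : ℝ) / (p - k) ≤
        if ∑ p ∈ T, Real.log p ≤ L then (1 + L) ^ l * ∏ p ∈ T, ((2 * k : ℕ) : ℝ) / p else 0 := by
      intro T hT
      have hT' := (Finset.mem_powerset.1 hT)
      have hTP := hT'.trans Finset.sdiff_subset
      have hd : Disjoint S T := Finset.disjoint_of_subset_right hT' Finset.disjoint_sdiff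
      have hS0 := sum_log_nonneg hP hS
      have hT0 := sum_log_nonneg hP hTP
      split_ifs with h2
      · refine mul_le_mul ?_ (Finset.prod_le_prod (fun p hp => (hgle p (hTP hp)).1)
          fun p hp => (hgle p (hTP hp)).2) (Finset.prod_nonneg fun p hp => (hgle p (hTP hp)).1)
          (by positivity)
        rw [logCutoff, Finset.sum_union hd]
        exact pow_le_pow_left₀ (le_max_right _ _) (max_le (by linarith) (by linarith)) _
      · rw [logCutoff_eq_zero hl, zero_mul]
        rw [Finset.sum_union hd]
        linarith
    refine (Finset.sum_le_sum h1).trans ?_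
    rw [← Finset.sum_filter, ← Finset.mul_sum, pow_add]
    refine mul_le_mul_of_nonneg_left ?_ (by positivity)
    exact sum_filter_prod_div_le (fun p hp => (hP p (Finset.sdiff_subset hp)).1) (2 * k) hL
  have hnonneg : 0 ≤ ∑ T ∈ (P \ S).powerset,
      logCutoff L l (S ∪ T) * ∏ p ∈ T, (k : ℝ) / (p - k) := by
    refine Finset.sum_nonneg fun T hT => mul_nonneg (pow_nonneg (le_max_right _ _) _) ?_
    exact Finset.prod_nonneg fun p hp =>
      (hgle p (Finset.sdiff_subset (Finset.mem_powerset.1 hT hp))).1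
  have heq : |tupleWeight P k L l S| = (∏ p ∈ S, (p : ℝ) / (p - k)) *
      ∑ T ∈ (P \ S).powerset, logCutoff L l (S ∪ T) * ∏ p ∈ T, (k : ℝ) / (p - k) := by
    have h2 : 0 ≤ ∏ p ∈ S, (p : ℝ) / (p - k) := Finset.prod_nonneg fun p hp => by
      obtain ⟨h1, h2⟩ := hpk p (hS hp)
      exact div_nonneg h1.le (by linarith)
    rw [← abs_of_nonneg (mul_nonneg h2 hnonneg), tupleWeight, selbergLambda, mul_assoc, abs_mul,
      abs_pow, abs_neg, abs_one, one_pow, one_mul]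
    congr 1
    rw [Finset.mul_sum, Finset.mul_sum]
    refine Finset.sum_congr rfl fun T hT => ?_
    have hT' := (Finset.mem_powerset.1 hT)
    have hd : Disjoint S T := Finset.disjoint_of_subset_right hT' Finset.disjoint_sdiff
    rw [Finset.prod_union hd]
    have h3 : (∏ p ∈ S, ((k : ℝ) / p)⁻¹) * ∏ p ∈ S, (k : ℝ) / p / (1 - k / p) =
        ∏ p ∈ S, (p : ℝ) / (p - k) := by
      rw [← Finset.prod_mul_distrib]
      refine Finset.prod_congr rfl fun p hp => ?_
      obtain ⟨h1, h2⟩ := hpk p (hS hp)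
      have h4 : (p : ℝ) - k ≠ 0 := by linarith
      rw [div_div_one_sub_div h1.ne']
      field_simp
    have h4 : ∏ p ∈ T, (k : ℝ) / p / (1 - k / p) = ∏ p ∈ T, (k : ℝ) / (p - k) :=
      Finset.prod_congr rfl fun p hp => div_div_one_sub_div
        (hpk p (Finset.sdiff_subset (hT' hp))).1.ne'
    rw [h4, ← h3]
    ring
  rw [heq, mul_comm]
  refine mul_le_mul hbound ?_ (Finset.prod_nonneg fun p hp => ?_) (by positivity)
  · rw [← Finset.prod_const]
    refine Finset.prod_le_prod (fun p hp => ?_) fun p hp => ?_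
    · obtain ⟨h1, h2⟩ := hpk p (hS hp)
      exact div_nonneg h1.le (by linarith)
    · obtain ⟨h1, h2⟩ := hpk p (hS hp)
      rw [div_le_iff₀ (by linarith)]
      linarith
  · obtain ⟨h1, h2⟩ := hpk p (hS hp)
    exact div_nonneg h1.le (by linarith)

end TupleWeight

section MainTerms

variable {P : Finset ℕ} {k l : ℕ} {L : ℝ}

theorem tupleWeight_quadratic_eq (hk : 1 ≤ k) (hP : ∀ p ∈ P, p.Prime ∧ 2 * k < p) :
    ∑ S ∈ P.powerset, ∑ T ∈ P.powerset,
        tupleWeight P k L l S * tupleWeight P k L l T * ∏ p ∈ S ∪ T, (k : ℝ) / p =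
      subsetMoment P (fun p => ((k : ℝ) - 1) / (p - k) + 1 / (p - k)) (fun p => Real.log p) L
        (2 * l) := by
  have hk0 : (0 : ℝ) < k := by exact_mod_cast hk
  have hpk : ∀ p ∈ P, (0 : ℝ) < p ∧ 2 * (k : ℝ) ≤ p := fun p hp =>
    ⟨by exact_mod_cast (hP p hp).1.pos, by exact_mod_cast (hP p hp).2.le⟩
  simp only [tupleWeight]
  rw [sum_selbergLambda_quadratic_self (w := fun p : ℕ => (k : ℝ) / p)]
  · refine Finset.sum_congr rfl fun U hU => ?_
    rw [logCutoff, ← pow_mul, mul_comm l]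
    congr 1
    refine Finset.prod_congr rfl fun p hp => ?_
    obtain ⟨h1, h2⟩ := hpk p (Finset.mem_powerset.1 hU hp)
    rw [div_div_one_sub_div h1.ne']
    ring
  · intro p hp
    have := hpk p hp
    exact div_ne_zero hk0.ne' this.1.ne'
  · intro p hp h
    have := hpk p hp
    rw [div_eq_one_iff_eq this.1.ne'] at h
    linarith

/-- For `w = k/p` and `v = (k-1)/(p-1)`, the inner factor `(1 - v/w) · w/(1-w)` equals `1/(p-1)`, so
`le_prod_mul_sum_posPart_pow` applies. The outer factors are `(k-1)/(p-k) · (p/(p-1))²`, whose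
square part is the one in that bound. -/
theorem le_tupleWeight_quadratic {X : ℕ} {P₀ : Finset ℕ} (hdisj : Disjoint P₀ P)
    (hX : P₀ ∪ P = (Finset.Icc 1 X).filter Nat.Prime) (hLX : L ≤ Real.log (X + 1))
    (hk : 2 ≤ k) (hP : ∀ p ∈ P, p.Prime ∧ 2 * k < p) :
    ((∏ p ∈ P₀, (1 - 1 / (p : ℝ))) / (l + 1)) ^ 2 *
        subsetMoment P (fun p => ((k : ℝ) - 1) / (p - k)) (fun p => Real.log p) L (2 * l + 2) ≤
      ∑ S ∈ P.powerset, ∑ T ∈ P.powerset,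
        tupleWeight P k L l S * tupleWeight P k L l T *
          ∏ p ∈ S ∪ T, ((k : ℝ) - 1) / (p - 1) := by
  have hk0 : (2 : ℝ) ≤ k := by exact_mod_cast hk
  have hpk : ∀ p ∈ P, (1 : ℝ) < p ∧ 2 * (k : ℝ) ≤ p := fun p hp =>
    ⟨by exact_mod_cast (hP p hp).1.one_lt, by exact_mod_cast (hP p hp).2.le⟩
  simp only [tupleWeight]
  rw [sum_selbergLambda_quadratic (v := fun p : ℕ => ((k : ℝ) - 1) / (p - 1)), subsetMoment,
    Finset.mul_sum]
  · refine Finset.sum_le_sum fun U hU => ?_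
    rw [Finset.mem_powerset] at hU
    have h1 := le_prod_mul_sum_posPart_pow hdisj hX hU hLX l
    set c := ∏ p ∈ P₀, (1 - 1 / (p : ℝ)) with hc
    have hc0 : 0 ≤ c := Finset.prod_nonneg fun p hp => by
      have h2 : p ∈ (Finset.Icc 1 X).filter Nat.Prime := hX ▸ Finset.mem_union_left _ hp
      have h3 : (1 : ℝ) ≤ p := by exact_mod_cast (Finset.mem_filter.1 h2).2.one_le
      rw [sub_nonneg, div_le_one (by linarith)]
      exact h3
    have hpow := pow_le_pow_left₀ (mul_nonneg hc0 (div_nonneg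
      (pow_nonneg (le_max_right _ _) _) (by positivity))) h1 2
    have hg0 : 0 ≤ ∏ p ∈ U, ((k : ℝ) - 1) / (p - k) := Finset.prod_nonneg fun p hp => by
      have := hpk p (hU hp)
      exact div_nonneg (by linarith) (by linarith)
    have h2 := mul_le_mul_of_nonneg_left hpow hg0
    refine le_trans (le_of_eq ?_) (h2.trans (le_of_eq ?_))
    · rw [show 2 * l + 2 = (l + 1) * 2 by ring, pow_mul]
      ring
    · have e1 : ∑ T ∈ (P \ U).powerset, (max (L - ∑ p ∈ U ∪ T, Real.log p) 0) ^ l *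
            ∏ p ∈ T, 1 / ((p : ℝ) - 1) =
          ∑ T ∈ (P \ U).powerset, logCutoff L l (U ∪ T) *
            ∏ p ∈ T, (1 - ((k : ℝ) - 1) / (p - 1) / (k / p)) * (k / p / (1 - k / p)) := by
        refine Finset.sum_congr rfl fun T hT => ?_
        rw [logCutoff]
        congr 1
        refine Finset.prod_congr rfl fun p hp => ?_
        obtain ⟨h3, h4⟩ := hpk p (Finset.sdiff_subset (Finset.mem_powerset.1 hT hp))
        have h5 : (p : ℝ) - k ≠ 0 := by linarith
        have h6 : (p : ℝ) - 1 ≠ 0 := by linarith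
        have h7 : (p : ℝ) ≠ 0 := by linarith
        have h8 : (k : ℝ) ≠ 0 := by linarith
        rw [div_div_one_sub_div h7]
        field_simp
        ring
      rw [e1, mul_pow, mul_pow, ← mul_assoc, ← mul_assoc]
      congr 1
      rw [← Finset.prod_pow, ← Finset.prod_pow, ← Finset.prod_mul_distrib,
        ← Finset.prod_mul_distrib]
      refine Finset.prod_congr rfl fun p hp => ?_
      obtain ⟨h3, h4⟩ := hpk p (hU hp)
      have h5 : (p : ℝ) - k ≠ 0 := by linarith
      have h6 : (p : ℝ) - 1 ≠ 0 := by linarith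
      have h7 : (p : ℝ) ≠ 0 := by linarith
      have h8 : (k : ℝ) ≠ 0 := by linarith
      have h9 : (k : ℝ) - 1 ≠ 0 := by linarith
      rw [div_div_one_sub_div h7]
      field_simp
      ring
  · intro p hp
    have := hpk p hp
    exact div_ne_zero (by linarith) (by linarith)

end MainTerms

/-! ### Counting in residue classes -/

section Counting

/-- Each prime of `U` in `A n` divides `n + h` for exactly one `h ∈ I`, so the condition splits over
choice functions `c`. Only `n` with `a n ≠ 0` matter, which lets `I` omit a shift when `a` is
supported on primes. -/
theorem sum_filter_subset_eq_sum_pi {N : Finset ℕ} {a : ℕ → ℝ} {A : ℕ → Finset ℕ}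
    {I U : Finset ℕ} (hA : ∀ n ∈ N, a n ≠ 0 → ∀ p ∈ U, (p ∈ A n ↔ ∃ h ∈ I, p ∣ n + h))
    (hI : ∀ p ∈ U, ∀ h ∈ I, ∀ h' ∈ I, ∀ n, p ∣ n + h → p ∣ n + h' → h = h') :
    ∑ n ∈ N with U ⊆ A n, a n =
      ∑ c ∈ U.pi (fun _ => I), ∑ n ∈ N with ∀ x ∈ U.attach, x.1 ∣ n + c x.1 x.2, a n := by
  classical
  simp_rw [Finset.sum_filter]
  rw [Finset.sum_comm]
  refine Finset.sum_congr rfl fun n hn => ?_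
  by_cases ha : a n = 0
  · simp [ha]
  have h1 : ∀ p ∈ U, (∑ h ∈ I, if p ∣ n + h then (1 : ℝ) else 0) = if p ∈ A n then 1 else 0 := by
    intro p hp
    split_ifs with hpA
    · obtain ⟨h, hh, hd⟩ := (hA n hn ha p hp).1 hpA
      rw [Finset.sum_eq_single h]
      · rw [if_pos hd]
      · intro h' hh' hne
        rw [if_neg]
        exact fun hd' => hne (hI p hp h' hh' h hh n hd' hd)
      · exact fun h2 => absurd hh h2
    · refine Finset.sum_eq_zero fun h hh => if_neg fun hd => hpA ((hA n hn ha p hp).2 ⟨h, hh, hd⟩)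
  have h2 := Finset.prod_congr (rfl : U = U) h1
  rw [Finset.prod_sum, Finset.prod_ite_zero, Finset.prod_const_one] at h2
  have h3 : (if U ⊆ A n then a n else 0) = (if ∀ p ∈ U, p ∈ A n then (1 : ℝ) else 0) * a n := by
    by_cases h4 : U ⊆ A n
    · rw [if_pos h4, if_pos fun p hp => h4 hp, one_mul]
    · rw [if_neg h4, if_neg fun h5 => h4 fun p hp => h5 p hp, zero_mul]
  rw [h3, ← h2, Finset.sum_mul]
  refine Finset.sum_congr rfl fun c _ => ?_
  rw [Finset.prod_ite_zero, Finset.prod_const_one, ite_mul, one_mul, zero_mul]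
  congr

theorem modEq_prod_iff {Q : Finset ℕ} (hQ : ∀ p ∈ Q, p.Prime) {a b : ℕ} :
    a ≡ b [MOD ∏ p ∈ Q, p] ↔ ∀ p ∈ Q, a ≡ b [MOD p] := by
  constructor
  · exact fun h p hp => h.of_dvd (Finset.dvd_prod_of_mem (fun p => p) hp)
  · intro h
    rw [Nat.modEq_iff_dvd]
    push_cast
    refine Finset.prod_dvd_of_coprime ?_ fun p hp => (Nat.modEq_iff_dvd.1 (h p hp))
    intro p hp q hq hpq
    exact Nat.isCoprime_iff_coprime.2 ((Nat.coprime_primes (hQ p hp) (hQ q hq)).2 hpq)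

theorem exists_forall_modEq {Q : Finset ℕ} (hQ : ∀ p ∈ Q, p.Prime) (s : ℕ → ℕ) :
    ∃ b : ℕ, ∀ p ∈ Q, b ≡ s p [MOD p] := by
  have h := Nat.chineseRemainderOfFinset s (fun p => p) Q (fun p hp => (hQ p hp).ne_zero)
    (fun p hp q hq hpq => (Nat.coprime_primes (hQ p hp) (hQ q hq)).2 hpq)
  exact ⟨h.1, h.2⟩

theorem dvd_add_iff_modEq {p n h : ℕ} (hp : 0 < p) : p ∣ n + h ↔ n ≡ (p - 1) * h [MOD p] := by
  have h1 : (p - 1) * h + h = p * h := by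
    obtain ⟨m, rfl⟩ : ∃ m, p = m + 1 := ⟨p - 1, by omega⟩
    rw [Nat.add_sub_cancel]; ring
  rw [← Nat.modEq_zero_iff_dvd]
  constructor
  · intro h2
    refine Nat.ModEq.add_right_cancel' h ?_
    rw [h1]
    exact h2.trans (Nat.modEq_zero_iff_dvd.2 (dvd_mul_right _ _)).symm
  · intro h2
    have h3 := h2.add_right h
    rw [h1] at h3
    exact h3.trans (Nat.modEq_zero_iff_dvd.2 (dvd_mul_right _ _))

/-- The weighted number of `n` for which all primes of `U` divide some `n + h` is obtained from
the distribution of the weights in residue classes modulo `∏ (P₀ ∪ U)`. -/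
theorem abs_sum_filter_subset_sub_le {M : Finset ℕ} {P₀ U I : Finset ℕ} {r : ℕ → ℕ} {a : ℕ → ℝ}
    {A : ℕ → Finset ℕ} (hP₀ : ∀ p ∈ P₀, p.Prime) (hU : ∀ p ∈ U, p.Prime) (hd : Disjoint P₀ U)
    (hA : ∀ n ∈ M, a n ≠ 0 → ∀ p ∈ U, (p ∈ A n ↔ ∃ h ∈ I, p ∣ n + h))
    (hI : ∀ p ∈ U, ∀ h ∈ I, ∀ h' ∈ I, ∀ n, p ∣ n + h → p ∣ n + h' → h = h') {Y E : ℝ}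
    (hE : ∀ b : ℕ, (∀ p ∈ P₀, b ≡ r p [MOD p]) → (∀ p ∈ U, ∃ h ∈ I, p ∣ b + h) →
      |∑ n ∈ M with n ≡ b [MOD ∏ p ∈ P₀ ∪ U, p], a n - Y| ≤ E) :
    |∑ n ∈ (M.filter (fun n => ∀ p ∈ P₀, n ≡ r p [MOD p])) with U ⊆ A n, a n -
        (I.card : ℝ) ^ U.card * Y| ≤ (I.card : ℝ) ^ U.card * E := by
  classical
  rw [sum_filter_subset_eq_sum_pi
    (fun n hn => hA n (Finset.mem_filter.1 hn).1) hI]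
  have hcard : (I.card : ℝ) ^ U.card = ((U.pi (fun _ => I)).card : ℝ) := by
    rw [Finset.card_pi, Finset.prod_const]; push_cast; rfl
  rw [hcard, ← nsmul_eq_mul, ← nsmul_eq_mul, ← Finset.sum_const, ← Finset.sum_const,
    ← Finset.sum_sub_distrib]
  refine (Finset.abs_sum_le_sum_abs _ _).trans (Finset.sum_le_sum fun c hc => ?_)
  rw [Finset.mem_pi] at hc
  have hQ : ∀ p ∈ P₀ ∪ U, p.Prime := fun p hp => by
    rcases Finset.mem_union.1 hp with h | h
    · exact hP₀ p h
    · exact hU p h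
  -- The prescribed classes on `P₀` and the classes `-c p` on `U` merge into one class `b`.
  obtain ⟨b, hb⟩ := exists_forall_modEq hQ
    (fun p => if hp : p ∈ U then (p - 1) * c p hp else r p)
  have hbP : ∀ p ∈ P₀, b ≡ r p [MOD p] := fun p hp => by
    have h1 := hb p (Finset.mem_union_left _ hp)
    rwa [dif_neg (Finset.disjoint_left.1 hd hp)] at h1
  have hbU : ∀ p (hp : p ∈ U), b ≡ (p - 1) * c p hp [MOD p] := fun p hp => by
    have h1 := hb p (Finset.mem_union_right _ hp)
    rwa [dif_pos hp] at h1
  have h2 := hE b hbP fun p hp =>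
    ⟨c p hp, hc p hp, (dvd_add_iff_modEq (hU p hp).pos).2 (hbU p hp)⟩
  refine le_trans (le_of_eq ?_) h2
  congr 2
  rw [Finset.filter_filter]
  refine Finset.sum_congr (Finset.filter_congr fun n _ => ?_) fun _ _ => rfl
  rw [modEq_prod_iff hQ]
  constructor
  · rintro ⟨h3, h4⟩ p hp
    rcases Finset.mem_union.1 hp with h | h
    · exact (h3 p h).trans (hbP p h).symm
    · exact ((dvd_add_iff_modEq (hU p h).pos).1 (h4 ⟨p, h⟩ (Finset.mem_attach _ _))).trans
        (hbU p h).symm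
  · intro h3
    refine ⟨fun p hp => (h3 p (Finset.mem_union_left _ hp)).trans (hbP p hp), ?_⟩
    rintro ⟨p, hp⟩ _
    exact (dvd_add_iff_modEq (hU p hp).pos).2
      ((h3 p (Finset.mem_union_right _ hp)).trans (hbU p hp))

theorem abs_card_filter_modEq_sub_le {q : ℕ} (hq : 0 < q) (a c b : ℕ) (hac : a ≤ c) :
    |(((Finset.Ioc a c).filter (fun n => n ≡ b [MOD q])).card : ℝ) - ((c : ℝ) - a) / q| ≤ 1 := by
  have hq' : (0 : ℚ) < q := by exact_mod_cast hq
  have h1 := Nat.Ioc_filter_modEq_card a c hq b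
  have hle : ((a : ℚ) - b) / q ≤ ((c : ℚ) - b) / q := by
    have : (a : ℚ) ≤ c := by exact_mod_cast hac
    gcongr
  rw [max_eq_left (sub_nonneg.2 (Int.floor_mono hle))] at h1
  have h2 : ((((Finset.Ioc a c).filter (fun n => n ≡ b [MOD q])).card : ℤ) : ℚ) =
      (⌊((c : ℚ) - b) / q⌋ : ℚ) - ⌊((a : ℚ) - b) / q⌋ := by rw [h1]; push_cast; rfl
  have h3 : |(((Finset.Ioc a c).filter (fun n => n ≡ b [MOD q])).card : ℚ) -
      ((c : ℚ) - a) / q| ≤ 1 := by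
    have e1 := Int.floor_le (((c : ℚ) - b) / q)
    have e2 := Int.lt_floor_add_one (((c : ℚ) - b) / q)
    have e3 := Int.floor_le (((a : ℚ) - b) / q)
    have e4 := Int.lt_floor_add_one (((a : ℚ) - b) / q)
    have e5 : ((c : ℚ) - a) / q = ((c : ℚ) - b) / q - ((a : ℚ) - b) / q := by ring
    push_cast at h2
    rw [h2, e5, abs_le]
    constructor <;> linarith
  have h4 := (Rat.cast_le (K := ℝ)).2 h3
  push_cast at h4
  exact h4

end Counting

/-! ### Errors for primes in arithmetic progressions -/

theorem maxThetaError_nonneg (x : ℝ) (q : ℕ) : 0 ≤ maxThetaError x q :=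
  Real.iSup_nonneg fun _ => abs_nonneg _

theorem abs_primeTheta_sub_le {q : ℕ} (hq : 0 < q) (x : ℝ) {b : ℕ} (hb : b.Coprime q) :
    |primeTheta x q (b : ZMod q) - x / (Nat.totient q : ℝ)| ≤ maxThetaError x q := by
  have : NeZero q := ⟨hq.ne'⟩
  have h := le_ciSup (f := fun a : (ZMod q)ˣ =>
    |primeTheta x q (a : ZMod q) - x / (Nat.totient q : ℝ)|) (Set.finite_range _).bddAbove
    (ZMod.unitOfCoprime b hb)
  simpa [maxThetaError, ZMod.coe_unitOfCoprime] using h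

theorem sum_filter_modEq_prime_eq_primeTheta (N h q b : ℕ) :
    ∑ n ∈ Finset.Ioc N (2 * N) with n ≡ b [MOD q],
        (if (n + h).Prime then Real.log ((n + h : ℕ) : ℝ) else 0) =
      primeTheta ((2 * N + h : ℕ) : ℝ) q ((b + h : ℕ) : ZMod q) -
        primeTheta ((N + h : ℕ) : ℝ) q ((b + h : ℕ) : ZMod q) := by
  rw [primeTheta, primeTheta, Nat.floor_natCast, Nat.floor_natCast, eq_sub_iff_add_eq]
  have hsplit : Finset.Icc 1 (2 * N + h) = Finset.Ioc (N + h) (2 * N + h) ∪ Finset.Icc 1 (N + h) := by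
    ext m
    simp only [Finset.mem_Icc, Finset.mem_union, Finset.mem_Ioc]
    omega
  have hd : Disjoint (Finset.Ioc (N + h) (2 * N + h)) (Finset.Icc 1 (N + h)) := by
    rw [Finset.disjoint_left]
    intro m
    simp only [Finset.mem_Icc, Finset.mem_Ioc]
    omega
  rw [hsplit, Finset.filter_union, Finset.sum_union (Finset.disjoint_filter_filter hd)]
  congr 1
  rw [← Finset.sum_filter, Finset.filter_filter]
  refine Finset.sum_nbij' (fun n => n + h) (fun m => m - h) ?_ ?_ ?_ ?_ ?_
  · intro n hn
    simp only [Finset.mem_filter, Finset.mem_Ioc] at hn ⊢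
    refine ⟨by omega, hn.2.2, ?_⟩
    exact (ZMod.natCast_eq_natCast_iff _ _ _).2 (hn.2.1.add_right h)
  · intro m hm
    simp only [Finset.mem_filter, Finset.mem_Ioc] at hm ⊢
    have e : m - h + h = m := by omega
    refine ⟨by omega, ?_, by rw [e]; exact hm.2.1⟩
    refine Nat.ModEq.add_right_cancel' h ?_
    rw [e]
    exact (ZMod.natCast_eq_natCast_iff _ _ _).1 hm.2.2
  · intro n _; simp
  · intro m hm
    simp only [Finset.mem_filter, Finset.mem_Ioc] at hm
    omega
  · intro n _; rfl

theorem abs_sum_filter_modEq_prime_sub_le {N h q b : ℕ} (hq : 0 < q) (hb : (b + h).Coprime q) :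
    |∑ n ∈ Finset.Ioc N (2 * N) with n ≡ b [MOD q],
        (if (n + h).Prime then Real.log ((n + h : ℕ) : ℝ) else 0) - N / (q.totient : ℝ)| ≤
      maxThetaError ((2 * N + h : ℕ) : ℝ) q + maxThetaError ((N + h : ℕ) : ℝ) q := by
  rw [sum_filter_modEq_prime_eq_primeTheta]
  have h1 := abs_primeTheta_sub_le hq ((2 * N + h : ℕ) : ℝ) hb
  have h2 := abs_primeTheta_sub_le hq ((N + h : ℕ) : ℝ) hb
  have e : (N : ℝ) / (q.totient : ℝ) = ((2 * N + h : ℕ) : ℝ) / (q.totient : ℝ) -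
      ((N + h : ℕ) : ℝ) / (q.totient : ℝ) := by
    push_cast; ring
  rw [e, sub_sub_sub_comm]
  exact (abs_sub _ _).trans (add_le_add h1 h2)

/-- Trivial bound: at most `x/q + 1 ≤ 2x/q` integers lie in the class, each with logarithm at most
`log x`. It is the second ingredient of a Cauchy–Schwarz argument. -/
theorem maxThetaError_le {x : ℝ} {q : ℕ} (hq : 0 < q) (hx : 1 ≤ x) (hqx : (q : ℝ) ≤ x) :
    maxThetaError x q ≤ x / (q.totient : ℝ) * (1 + 2 * Real.log x) := by
  have : NeZero q := ⟨hq.ne'⟩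
  have hφ : (0 : ℝ) < q.totient := by exact_mod_cast Nat.totient_pos.2 hq
  have hq0 : (0 : ℝ) < q := by exact_mod_cast hq
  have hlog : 0 ≤ Real.log x := Real.log_nonneg hx
  refine ciSup_le fun a => ?_
  have h0 : 0 ≤ primeTheta x q (a : ZMod q) := Finset.sum_nonneg fun p hp =>
    Real.log_nonneg (by exact_mod_cast (Finset.mem_filter.1 hp).2.1.one_le)
  have h1 : primeTheta x q (a : ZMod q) ≤ 2 * Real.log x * (x / q) := by
    have hcount : primeTheta x q (a : ZMod q) ≤
        (((Finset.Ioc 0 ⌊x⌋₊).filter (fun n => n ≡ (a : ZMod q).val [MOD q])).card : ℝ) *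
          Real.log x := by
      rw [← nsmul_eq_mul, ← Finset.sum_const, primeTheta]
      refine le_trans (Finset.sum_le_sum (g := fun _ => Real.log x) fun p hp => ?_)
        (Finset.sum_le_sum_of_subset_of_nonneg ?_ fun _ _ _ => hlog)
      · simp only [Finset.mem_filter, Finset.mem_Icc] at hp
        exact Real.log_le_log (by exact_mod_cast hp.2.1.pos)
          ((Nat.le_floor_iff (by linarith)).1 hp.1.2)
      · intro p hp
        simp only [Finset.mem_filter, Finset.mem_Icc, Finset.mem_Ioc] at hp ⊢
        refine ⟨⟨by omega, hp.1.2⟩, ?_⟩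
        rw [← ZMod.natCast_eq_natCast_iff, hp.2.2, ZMod.natCast_zmod_val]
    have hc := (abs_le.1 (abs_card_filter_modEq_sub_le hq 0 ⌊x⌋₊ (a : ZMod q).val
      (Nat.zero_le _))).2
    have hfl : (⌊x⌋₊ : ℝ) ≤ x := Nat.floor_le (by linarith)
    have h2 : ((⌊x⌋₊ : ℝ) - ((0 : ℕ) : ℝ)) / q ≤ x / q := by
      push_cast; gcongr; linarith
    have h3 : 1 ≤ x / q := (one_le_div hq0).2 hqx
    refine hcount.trans ?_
    calc _ ≤ (2 * (x / q)) * Real.log x := mul_le_mul_of_nonneg_right (by linarith) hlog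
      _ = _ := by ring
  have h4 : x / q ≤ x / (q.totient : ℝ) := by
    gcongr
    exact_mod_cast Nat.totient_le q
  have h5 : 2 * Real.log x * (x / q) ≤ 2 * Real.log x * (x / (q.totient : ℝ)) := by gcongr
  have h6 : 0 ≤ x / (q.totient : ℝ) := by positivity
  have h7 : 0 ≤ 2 * Real.log x * (x / (q.totient : ℝ)) := by positivity
  rw [abs_le]
  constructor <;> linarith

theorem totient_prod_primes {Q : Finset ℕ} (hQ : ∀ p ∈ Q, p.Prime) :
    ((∏ p ∈ Q, p).totient : ℝ) = ∏ p ∈ Q, ((p : ℝ) - 1) := by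
  induction Q using Finset.induction_on with
  | empty => simp
  | insert p Q hp ih =>
    have hpp := hQ p (Finset.mem_insert_self _ _)
    have hQ' : ∀ q ∈ Q, q.Prime := fun q hq => hQ q (Finset.mem_insert_of_mem hq)
    rw [Finset.prod_insert hp, Finset.prod_insert hp, Nat.totient_mul, Nat.totient_prime hpp,
      Nat.cast_mul, ih hQ', Nat.cast_sub hpp.one_le, Nat.cast_one]
    exact Nat.Coprime.prod_right fun q hq =>
      (Nat.coprime_primes hpp (hQ' q hq)).2 fun e => hp (e ▸ hq)

theorem prod_le_exp_of_sum_log_le {U : Finset ℕ} (hU : ∀ p ∈ U, p.Prime) {v : ℝ}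
    (h : ∑ p ∈ U, Real.log p ≤ v) : ((∏ p ∈ U, p : ℕ) : ℝ) ≤ Real.exp v := by
  have hpos : 0 < ∏ p ∈ U, p := Finset.prod_pos fun p hp => (hU p hp).pos
  rw [← Real.log_le_iff_le_exp (by exact_mod_cast hpos)]
  push_cast
  rwa [Real.log_prod (fun p hp => by exact_mod_cast (hU p hp).ne_zero)]

/-- Cauchy–Schwarz separates `K ^ |U|` from the error. One factor takes the trivial bound and is `x`
times a polylogarithm. The other is part of the sum in the level-of-distribution hypothesis, since
distinct `U` give distinct moduli. -/
theorem sum_pow_card_mul_maxThetaError_le {P₀ P : Finset ℕ} (hP₀ : ∀ p ∈ P₀, p.Prime)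
    (hP : ∀ p ∈ P, p.Prime) (hd : Disjoint P₀ P) (K : ℕ) {x y L : ℝ} (hx : 1 ≤ x) (hL : 0 ≤ L)
    (hx1 : ((∏ p ∈ P₀, p : ℕ) : ℝ) * Real.exp (2 * L) ≤ x)
    (hy : ((∏ p ∈ P₀, p : ℕ) : ℝ) * Real.exp (2 * L) ≤ y) :
    (∑ U ∈ P.powerset with ∑ p ∈ U, Real.log (p : ℕ) ≤ 2 * L,
        (K : ℝ) ^ U.card * maxThetaError x (∏ p ∈ P₀ ∪ U, p)) ^ 2 ≤
      (x * (1 + 2 * Real.log x) * (1 + 2 * L) ^ (2 * K ^ 2)) *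
        ∑ q ∈ Finset.Icc 1 ⌊y⌋₊, maxThetaError x q := by
  set 𝒰 := P.powerset.filter (fun U => ∑ p ∈ U, Real.log (p : ℕ) ≤ 2 * L) with h𝒰
  set W := ∏ p ∈ P₀, p with hW
  have hW0 : 0 < W := Finset.prod_pos fun p hp => (hP₀ p hp).pos
  have hlog : 0 ≤ Real.log x := Real.log_nonneg hx
  have hUP : ∀ U ∈ 𝒰, U ⊆ P := fun U hU => Finset.mem_powerset.1 (Finset.mem_filter.1 hU).1
  have hdU : ∀ U ∈ 𝒰, Disjoint P₀ U := fun U hU => Finset.disjoint_of_subset_right (hUP U hU) hd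
  have hq : ∀ U ∈ 𝒰, ∏ p ∈ P₀ ∪ U, p = W * ∏ p ∈ U, p := fun U hU =>
    Finset.prod_union (hdU U hU)
  have hqpos : ∀ U ∈ 𝒰, 0 < ∏ p ∈ P₀ ∪ U, p := fun U hU => by
    rw [hq U hU]
    exact Nat.mul_pos hW0 (Finset.prod_pos fun p hp => (hP p (hUP U hU hp)).pos)
  have hqle : ∀ U ∈ 𝒰, ((∏ p ∈ P₀ ∪ U, p : ℕ) : ℝ) ≤ (W : ℝ) * Real.exp (2 * L) := fun U hU => by
    rw [hq U hU, Nat.cast_mul]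
    exact mul_le_mul_of_nonneg_left (prod_le_exp_of_sum_log_le
      (fun p hp => hP p (hUP U hU hp)) (Finset.mem_filter.1 hU).2) (by positivity)
  have h1 : ∑ U ∈ 𝒰, maxThetaError x (∏ p ∈ P₀ ∪ U, p) ≤
      ∑ q ∈ Finset.Icc 1 ⌊y⌋₊, maxThetaError x q := by
    rw [← Finset.sum_image (s := 𝒰) (g := fun U : Finset ℕ => ∏ p ∈ P₀ ∪ U, p)
      (f := fun q => maxThetaError x q)]
    · refine Finset.sum_le_sum_of_subset_of_nonneg ?_ fun q _ _ => maxThetaError_nonneg x q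
      intro q hq'
      obtain ⟨U, hU, rfl⟩ := Finset.mem_image.1 hq'
      exact Finset.mem_Icc.2 ⟨hqpos U hU, Nat.le_floor ((hqle U hU).trans hy)⟩
    · intro U hU V hV hUV
      have hUV : ∏ p ∈ P₀ ∪ U, p = ∏ p ∈ P₀ ∪ V, p := hUV
      rw [hq U hU, hq V hV] at hUV
      exact prod_injOn_primes hP (Finset.mem_coe.2 (Finset.mem_powerset.2 (hUP U hU)))
        (Finset.mem_coe.2 (Finset.mem_powerset.2 (hUP V hV))) (Nat.eq_of_mul_eq_mul_left hW0 hUV)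
  have h2 : ∑ U ∈ 𝒰, ((K : ℝ) ^ U.card) ^ 2 * maxThetaError x (∏ p ∈ P₀ ∪ U, p) ≤
      x * (1 + 2 * Real.log x) * (1 + 2 * L) ^ (2 * K ^ 2) := by
    have h3 : ∀ U ∈ 𝒰, ((K : ℝ) ^ U.card) ^ 2 * maxThetaError x (∏ p ∈ P₀ ∪ U, p) ≤
        x * (1 + 2 * Real.log x) * ∏ p ∈ U, ((2 * K ^ 2 : ℕ) : ℝ) / p := by
      intro U hU
      have hpr : ∀ p ∈ P₀ ∪ U, p.Prime := fun p hp => by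
        rcases Finset.mem_union.1 hp with h | h
        · exact hP₀ p h
        · exact hP p (hUP U hU h)
      have h4 := maxThetaError_le (hqpos U hU) hx ((hqle U hU).trans hx1)
      -- From `p - 1 ≥ p/2`; this is the source of the 2 in `2 * K ^ 2`.
      have h5 : (1 : ℝ) / ((∏ p ∈ P₀ ∪ U, p).totient : ℝ) ≤ ∏ p ∈ U, (2 : ℝ) / p := by
        rw [totient_prod_primes hpr, Finset.prod_union (hdU U hU)]
        have h6 : (1 : ℝ) ≤ ∏ p ∈ P₀, ((p : ℝ) - 1) := by
          rw [← totient_prod_primes hP₀]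
          exact_mod_cast Nat.totient_pos.2 hW0
        have h7 : ∏ p ∈ U, ((p : ℝ) / 2) ≤ ∏ p ∈ U, ((p : ℝ) - 1) := by
          refine Finset.prod_le_prod (fun p _ => by positivity) fun p hp => ?_
          have : (2 : ℝ) ≤ p := by exact_mod_cast (hP p (hUP U hU hp)).two_le
          linarith
        have h8 : 0 < ∏ p ∈ U, ((p : ℝ) / 2) := Finset.prod_pos fun p hp => by
          have : (0 : ℝ) < p := by exact_mod_cast (hP p (hUP U hU hp)).pos
          positivity
        have h9 : ∏ p ∈ U, (2 : ℝ) / p = 1 / ∏ p ∈ U, ((p : ℝ) / 2) := by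
          rw [one_div, ← Finset.prod_inv_distrib]
          exact Finset.prod_congr rfl fun p _ => (inv_div _ _).symm
        rw [h9]
        refine one_div_le_one_div_of_le h8 (h7.trans ?_)
        exact le_mul_of_one_le_left (h8.le.trans h7) h6
      have h6 : ∏ p ∈ U, ((2 * K ^ 2 : ℕ) : ℝ) / p = ((K : ℝ) ^ U.card) ^ 2 * ∏ p ∈ U, (2 : ℝ) / p := by
        rw [← Finset.prod_const, ← Finset.prod_pow, ← Finset.prod_mul_distrib]
        refine Finset.prod_congr rfl fun p _ => ?_
        push_cast; ring
      rw [h6]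
      have h7 : maxThetaError x (∏ p ∈ P₀ ∪ U, p) ≤
          x * (1 + 2 * Real.log x) * ∏ p ∈ U, (2 : ℝ) / p := by
        refine h4.trans ?_
        calc x / ((∏ p ∈ P₀ ∪ U, p).totient : ℝ) * (1 + 2 * Real.log x) =
            x * (1 + 2 * Real.log x) * (1 / ((∏ p ∈ P₀ ∪ U, p).totient : ℝ)) := by ring
          _ ≤ _ := mul_le_mul_of_nonneg_left h5 (by positivity)
      calc _ ≤ ((K : ℝ) ^ U.card) ^ 2 * (x * (1 + 2 * Real.log x) * ∏ p ∈ U, (2 : ℝ) / p) :=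
            mul_le_mul_of_nonneg_left h7 (by positivity)
        _ = _ := by ring
    refine (Finset.sum_le_sum h3).trans ?_
    rw [← Finset.mul_sum]
    exact mul_le_mul_of_nonneg_left (sum_filter_prod_div_le hP (2 * K ^ 2) (by linarith))
      (by positivity)
  have hcs := Finset.sum_sq_le_sum_mul_sum_of_sq_le_mul 𝒰
    (r := fun U => (K : ℝ) ^ U.card * maxThetaError x (∏ p ∈ P₀ ∪ U, p))
    (f := fun U => ((K : ℝ) ^ U.card) ^ 2 * maxThetaError x (∏ p ∈ P₀ ∪ U, p))
    (g := fun U => maxThetaError x (∏ p ∈ P₀ ∪ U, p))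
    (fun U _ => mul_nonneg (by positivity) (maxThetaError_nonneg _ _))
    (fun U _ => maxThetaError_nonneg _ _) (fun U _ => le_of_eq (by ring))
  refine hcs.trans (mul_le_mul h2 h1 (Finset.sum_nonneg fun U _ => maxThetaError_nonneg _ _) ?_)
  positivity

theorem exists_sum_pow_card_mul_maxThetaError_le {ϑ : ℝ} (hlevel : PrimesHaveLevel ϑ) {ε : ℝ}
    (hε : 0 < ε) (K D : ℕ) :
    ∃ C : ℝ, 0 ≤ C ∧ ∀ᶠ x : ℝ in Filter.atTop, ∀ (P₀ P : Finset ℕ) (L : ℝ),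
      (∀ p ∈ P₀, p.Prime) → (∀ p ∈ P, p.Prime) → Disjoint P₀ P → 0 ≤ L → L ≤ Real.log x →
      ((∏ p ∈ P₀, p : ℕ) : ℝ) * Real.exp (2 * L) ≤ x →
      ((∏ p ∈ P₀, p : ℕ) : ℝ) * Real.exp (2 * L) ≤ x ^ (ϑ - ε) →
      ∑ U ∈ P.powerset with ∑ p ∈ U, Real.log (p : ℕ) ≤ 2 * L,
        (K : ℝ) ^ U.card * maxThetaError x (∏ p ∈ P₀ ∪ U, p) ≤ C * (x / Real.log x ^ D) := by
  -- The exponent pays for the `1 + 2K²` logarithms of the trivial bound, and `2D` becomes `D` after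
  -- the square root.
  have hA : (0 : ℝ) < ((1 + 2 * K ^ 2 + 2 * D : ℕ) : ℝ) := by positivity
  obtain ⟨c, hc, hbound⟩ := (hlevel ε hε _ hA).exists_pos
  refine ⟨Real.sqrt (c * 3 ^ (1 + 2 * K ^ 2)), Real.sqrt_nonneg _, ?_⟩
  filter_upwards [hbound.bound, Filter.eventually_ge_atTop (Real.exp 1)] with x hx hxe
    P₀ P L hP₀ hP hd hL hLx hx1 hx2
  have hx0 : 0 < x := (Real.exp_pos 1).trans_le hxe
  have hlog : 1 ≤ Real.log x := (Real.le_log_iff_exp_le hx0).2 hxe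
  have hx1' : 1 ≤ x := (Real.one_le_exp zero_le_one).trans hxe
  rw [Real.rpow_natCast, Real.norm_of_nonneg (Finset.sum_nonneg fun q _ => maxThetaError_nonneg x q),
    Real.norm_of_nonneg (by positivity)] at hx
  have h1 := sum_pow_card_mul_maxThetaError_le hP₀ hP hd K hx1' hL hx1 hx2
  refine le_of_sq_le_sq ?_ (by positivity)
  refine h1.trans ?_
  rw [mul_pow, Real.sq_sqrt (by positivity)]
  have h2 : x * (1 + 2 * Real.log x) * (1 + 2 * L) ^ (2 * K ^ 2) ≤
      x * (3 * Real.log x) ^ (1 + 2 * K ^ 2) := by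
    rw [pow_add, pow_one, mul_assoc]
    have h3 : (1 + 2 * L) ^ (2 * K ^ 2) ≤ (3 * Real.log x) ^ (2 * K ^ 2) :=
      pow_le_pow_left₀ (by linarith) (by linarith) _
    refine mul_le_mul_of_nonneg_left (mul_le_mul (by linarith) h3 (by positivity) (by positivity))
      hx0.le
  refine (mul_le_mul h2 hx (Finset.sum_nonneg fun q _ => maxThetaError_nonneg x q)
    (by positivity)).trans (le_of_eq ?_)
  rw [mul_pow, pow_add (Real.log x) _ (2 * D), div_pow, ← pow_mul, mul_comm D 2]
  have : Real.log x ≠ 0 := by linarith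
  field_simp

/-! ### Evaluation of the two sieve sums -/

/-- The primes of `P` that divide one of the numbers `n + h` with `h ∈ H`. -/
def tupleDivisors (P H : Finset ℕ) (n : ℕ) : Finset ℕ :=
  P.filter (fun p => ∃ h ∈ H, p ∣ n + h)

/-- The nonnegative sieve weight of `n`. -/
noncomputable def tupleSieve (P H : Finset ℕ) (L : ℝ) (l n : ℕ) : ℝ :=
  (∑ S ∈ (tupleDivisors P H n).powerset, tupleWeight P H.card L l S) ^ 2

/-- The integers in `(N, 2N]` in the residue classes `r p` modulo the primes `p ∈ P₀`. -/
def sieveRange (N : ℕ) (P₀ : Finset ℕ) (r : ℕ → ℕ) : Finset ℕ :=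
  (Finset.Ioc N (2 * N)).filter (fun n => ∀ p ∈ P₀, n ≡ r p [MOD p])

theorem eq_of_dvd_add_of_dvd_add {H : Finset ℕ} {p : ℕ} (hp : ∀ h ∈ H, h < p) {h h' n : ℕ}
    (hh : h ∈ H) (hh' : h' ∈ H) (h1 : p ∣ n + h) (h2 : p ∣ n + h') : h = h' := by
  have h3 : n + h ≡ n + h' [MOD p] :=
    (Nat.modEq_zero_iff_dvd.2 h1).trans (Nat.modEq_zero_iff_dvd.2 h2).symm
  exact (Nat.ModEq.add_left_cancel' n h3).eq_of_lt_of_lt (hp h hh) (hp h' hh')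

section Evaluation

variable {P₀ P H : Finset ℕ} {L : ℝ} {l N : ℕ} {r : ℕ → ℕ}

theorem sum_tupleSieve_le (hP₀ : ∀ p ∈ P₀, p.Prime) (hd : Disjoint P₀ P) (hk : 1 ≤ H.card)
    (hP : ∀ p ∈ P, p.Prime ∧ 2 * H.card < p) (hPH : ∀ p ∈ P, ∀ h ∈ H, h < p) (hl : 1 ≤ l)
    (hL : 0 ≤ L) :
    ∑ n ∈ sieveRange N P₀ r, tupleSieve P H L l n ≤
      N / ((∏ p ∈ P₀, p : ℕ) : ℝ) *
        subsetMoment P (fun p => ((H.card : ℝ) - 1) / (p - H.card) + 1 / (p - H.card))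
          (fun p => Real.log p) L (2 * l) +
      ((1 + L) ^ (l + 2 * H.card)) ^ 2 *
        (Real.exp (2 * L) * (1 + 2 * L) ^ (16 * H.card)) := by
  set k := H.card with hkdef
  set W := ∏ p ∈ P₀, p with hW
  have hW0 : 0 < W := Finset.prod_pos fun p hp => (hP₀ p hp).pos
  have hE : ∀ S ⊆ P, ∀ T ⊆ P, tupleWeight P k L l S ≠ 0 → tupleWeight P k L l T ≠ 0 →
      |∑ n ∈ sieveRange N P₀ r with S ∪ T ⊆ tupleDivisors P H n, (1 : ℝ) -
        (N / (W : ℝ)) * ∏ p ∈ S ∪ T, (k : ℝ) / p| ≤ (k : ℝ) ^ (S ∪ T).card := by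
    intro S hS T hT _ _
    set U := S ∪ T with hU
    have hUP : U ⊆ P := Finset.union_subset hS hT
    have hUp : ∀ p ∈ U, p.Prime := fun p hp => (hP p (hUP hp)).1
    have hdU : Disjoint P₀ U := Finset.disjoint_of_subset_right hUP hd
    have h1 := abs_sum_filter_subset_sub_le (M := Finset.Ioc N (2 * N)) (P₀ := P₀) (U := U)
      (I := H) (r := r) (a := fun _ => (1 : ℝ)) (A := tupleDivisors P H)
      (Y := N / ((∏ p ∈ P₀ ∪ U, p : ℕ) : ℝ)) (E := 1) hP₀ hUp hdU
      (fun n _ _ p hp => by simp [tupleDivisors, hUP hp])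
      (fun p hp h hh h' hh' n => eq_of_dvd_add_of_dvd_add (hPH p (hUP hp)) hh hh')
      (fun b _ _ => by
        have hq : 0 < ∏ p ∈ P₀ ∪ U, p := by
          rw [Finset.prod_union hdU]
          exact Nat.mul_pos hW0 (Finset.prod_pos fun p hp => (hUp p hp).pos)
        have h2 := abs_card_filter_modEq_sub_le hq N (2 * N) b (by omega)
        rw [Finset.sum_const, nsmul_eq_mul, mul_one]
        convert h2 using 4
        push_cast; ring)
    rw [mul_one] at h1
    have e1 : (k : ℝ) ^ U.card * (N / ((∏ p ∈ P₀ ∪ U, p : ℕ) : ℝ)) =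
        (N / (W : ℝ)) * ∏ p ∈ U, (k : ℝ) / p := by
      rw [Finset.prod_union hdU, Finset.prod_div_distrib, Finset.prod_const, Nat.cast_mul,
        div_mul_div_comm, mul_div_assoc', mul_comm (N : ℝ), Nat.cast_prod (fun p => p) U]
    rw [e1] at h1
    exact h1
  have h1 := abs_sum_mul_sq_sub_le (N := sieveRange N P₀ r) (a := fun _ => (1 : ℝ)) (P := P)
    (A := tupleDivisors P H) (fun n _ => Finset.filter_subset _ _) (tupleWeight P k L l)
    (X := N / (W : ℝ)) (w := fun p : ℕ => (k : ℝ) / p) (E := fun U => (k : ℝ) ^ U.card) hE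
  have h2 := sum_sum_abs_mul_abs_mul_union_le (P := P) (u := fun p : ℕ => Real.log p)
    (fun p hp => Real.log_nonneg (by exact_mod_cast (hP p hp).1.one_le))
    (l := tupleWeight P k L l) (B := (1 + L) ^ (l + 2 * k)) (L := L) (by positivity)
    (fun S hS => abs_tupleWeight_le hk hP hl hL hS)
    (fun S _ h0 => by
      by_contra! hlt
      exact h0 (tupleWeight_eq_zero hP hl hlt.le))
    (E := fun U => (k : ℝ) ^ U.card) (fun U _ => by positivity)
  -- Rankin's trick: each term is multiplied by `e^(2L) / ∏ U ≥ 1`.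
  have h3 : ∑ U ∈ P.powerset with ∑ p ∈ U, Real.log (p : ℕ) ≤ 2 * L,
      (16 : ℝ) ^ U.card * (k : ℝ) ^ U.card ≤ Real.exp (2 * L) * (1 + 2 * L) ^ (16 * k) := by
    refine le_trans ?_ (mul_le_mul_of_nonneg_left (sum_filter_prod_div_le
      (fun p hp => (hP p hp).1) (16 * k) (v := 2 * L) (by linarith)) (Real.exp_nonneg _))
    rw [Finset.mul_sum]
    refine Finset.sum_le_sum fun U hU => ?_
    rw [Finset.mem_filter, Finset.mem_powerset] at hU
    have hUp : ∀ p ∈ U, p.Prime := fun p hp => (hP p (hU.1 hp)).1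
    have h4 := prod_le_exp_of_sum_log_le hUp hU.2
    have h5 : (0 : ℝ) < ((∏ p ∈ U, p : ℕ) : ℝ) := by
      exact_mod_cast Finset.prod_pos fun p hp => (hUp p hp).pos
    rw [Finset.prod_div_distrib, Finset.prod_const, ← mul_pow, ← Nat.cast_prod, mul_div_assoc',
      le_div_iff₀ h5]
    push_cast at h4 ⊢
    rw [mul_comm]
    exact mul_le_mul_of_nonneg_right h4 (by positivity)
  have h4 := (abs_le.1 (h1.trans h2)).2
  rw [tupleWeight_quadratic_eq hk hP] at h4
  have h5 := mul_le_mul_of_nonneg_left h3 (sq_nonneg ((1 + L) ^ (l + 2 * k)))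
  have h6 : ∑ n ∈ sieveRange N P₀ r, tupleSieve P H L l n = ∑ n ∈ sieveRange N P₀ r,
      (1 : ℝ) * (∑ S ∈ (tupleDivisors P H n).powerset, tupleWeight P k L l S) ^ 2 :=
    Finset.sum_congr rfl fun n _ => by rw [one_mul, tupleSieve]
  rw [h6]
  linarith

/-- When `n + m` is prime it exceeds every prime of `P`, so only the other `k - 1` shifts can be
divisible by them; hence the density `(k-1)/(p-1)`. The class of `n + m` is reduced by `hr` on `P₀`,
and on `U` because a prime cannot divide two distinct shifted values. -/
theorem le_sum_prime_mul_tupleSieve {X m : ℕ} (hd : Disjoint P₀ P)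
    (hX : P₀ ∪ P = (Finset.Icc 1 X).filter Nat.Prime) (hXN : X ≤ N)
    (hLX : L ≤ Real.log (X + 1)) (hk : 2 ≤ H.card)
    (hP : ∀ p ∈ P, p.Prime ∧ 2 * H.card < p) (hPH : ∀ p ∈ P, ∀ h ∈ H, h < p) (hl : 1 ≤ l)
    (hL : 0 ≤ L) (hm : m ∈ H) (hr : ∀ p ∈ P₀, ¬ p ∣ r p + m) :
    N / ((∏ p ∈ P₀, p).totient : ℝ) * (((∏ p ∈ P₀, (1 - 1 / (p : ℝ))) / (l + 1)) ^ 2 *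
        subsetMoment P (fun p => ((H.card : ℝ) - 1) / (p - H.card)) (fun p => Real.log p) L
          (2 * l + 2)) -
      ((1 + L) ^ (l + 2 * H.card)) ^ 2 *
        ∑ U ∈ P.powerset with ∑ p ∈ U, Real.log (p : ℕ) ≤ 2 * L,
          ((16 * H.card : ℕ) : ℝ) ^ U.card *
            (maxThetaError ((2 * N + m : ℕ) : ℝ) (∏ p ∈ P₀ ∪ U, p) +
              maxThetaError ((N + m : ℕ) : ℝ) (∏ p ∈ P₀ ∪ U, p)) ≤
      ∑ n ∈ sieveRange N P₀ r,
        (if (n + m).Prime then Real.log ((n + m : ℕ) : ℝ) else 0) * tupleSieve P H L l n := by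
  set k := H.card with hkdef
  set W := ∏ p ∈ P₀, p with hW
  have hP₀ : ∀ p ∈ P₀, p.Prime := fun p hp =>
    (Finset.mem_filter.1 (hX ▸ Finset.mem_union_left P hp)).2
  have hPX : ∀ p ∈ P, p ≤ X := fun p hp => (Finset.mem_Icc.1
    (Finset.mem_filter.1 (hX ▸ Finset.mem_union_right P₀ hp)).1).2
  have hW0 : 0 < W := Finset.prod_pos fun p hp => (hP₀ p hp).pos
  set a : ℕ → ℝ := fun n => if (n + m).Prime then Real.log ((n + m : ℕ) : ℝ) else 0 with ha
  set E : Finset ℕ → ℝ := fun U => (k : ℝ) ^ U.card *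
    (maxThetaError ((2 * N + m : ℕ) : ℝ) (∏ p ∈ P₀ ∪ U, p) +
      maxThetaError ((N + m : ℕ) : ℝ) (∏ p ∈ P₀ ∪ U, p)) with hEdef
  have hcard : ((H.erase m).card : ℝ) = (k : ℝ) - 1 := by
    rw [Finset.card_erase_of_mem hm, Nat.cast_sub (by omega), Nat.cast_one]
  have hk1 : (0 : ℝ) ≤ (k : ℝ) - 1 := by rw [← hcard]; positivity
  have hE : ∀ S ⊆ P, ∀ T ⊆ P, tupleWeight P k L l S ≠ 0 → tupleWeight P k L l T ≠ 0 →
      |∑ n ∈ sieveRange N P₀ r with S ∪ T ⊆ tupleDivisors P H n, a n -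
        (N / (W.totient : ℝ)) * ∏ p ∈ S ∪ T, ((k : ℝ) - 1) / (p - 1)| ≤ E (S ∪ T) := by
    intro S hS T hT _ _
    set U := S ∪ T with hU
    have hUP : U ⊆ P := Finset.union_subset hS hT
    have hUp : ∀ p ∈ U, p.Prime := fun p hp => (hP p (hUP hp)).1
    have hdU : Disjoint P₀ U := Finset.disjoint_of_subset_right hUP hd
    have hQ : ∀ p ∈ P₀ ∪ U, p.Prime := fun p hp => by
      rcases Finset.mem_union.1 hp with h | h
      · exact hP₀ p h
      · exact hUp p h
    have h1 := abs_sum_filter_subset_sub_le (M := Finset.Ioc N (2 * N)) (P₀ := P₀) (U := U)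
      (I := H.erase m) (r := r) (a := a) (A := tupleDivisors P H)
      (Y := N / ((∏ p ∈ P₀ ∪ U, p).totient : ℝ))
      (E := maxThetaError ((2 * N + m : ℕ) : ℝ) (∏ p ∈ P₀ ∪ U, p) +
        maxThetaError ((N + m : ℕ) : ℝ) (∏ p ∈ P₀ ∪ U, p)) hP₀ hUp hdU
      (fun n hn hne p hp => by
        have hprime : (n + m).Prime := by
          by_contra hcon
          exact hne (if_neg hcon)
        have hnd : ¬ p ∣ n + m := fun hdvd => by
          have h2 := (Nat.prime_dvd_prime_iff_eq (hUp p hp) hprime).1 hdvd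
          have h3 := hPX p (hUP hp)
          have h4 := (Finset.mem_Ioc.1 hn).1
          omega
        simp only [tupleDivisors, Finset.mem_filter, hUP hp, true_and, Finset.mem_erase]
        constructor
        · rintro ⟨h, hh, hdvd⟩
          exact ⟨h, ⟨fun e => hnd (e ▸ hdvd), hh⟩, hdvd⟩
        · rintro ⟨h, ⟨_, hh⟩, hdvd⟩
          exact ⟨h, hh, hdvd⟩)
      (fun p hp h hh h' hh' n => eq_of_dvd_add_of_dvd_add (hPH p (hUP hp))
        (Finset.mem_of_mem_erase hh) (Finset.mem_of_mem_erase hh'))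
      (fun b hb hbU => by
        have hq : 0 < ∏ p ∈ P₀ ∪ U, p := Finset.prod_pos fun p hp => (hQ p hp).pos
        refine abs_sum_filter_modEq_prime_sub_le hq (Nat.Coprime.prod_right fun p hp => ?_)
        refine ((hQ p hp).coprime_iff_not_dvd.2 fun hdvd => ?_).symm
        rcases Finset.mem_union.1 hp with h | h
        · refine hr p h ?_
          exact (((hb p h).add_right m).dvd_iff dvd_rfl).1 hdvd
        · obtain ⟨h', hh', hdvd'⟩ := hbU p h
          have := eq_of_dvd_add_of_dvd_add (hPH p (hUP h)) (Finset.mem_of_mem_erase hh') hm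
            hdvd' hdvd
          exact (Finset.mem_erase.1 hh').1 this)
    rw [hcard] at h1
    have e1 : ((k : ℝ) - 1) ^ U.card * (N / ((∏ p ∈ P₀ ∪ U, p).totient : ℝ)) =
        (N / (W.totient : ℝ)) * ∏ p ∈ U, ((k : ℝ) - 1) / (p - 1) := by
      rw [totient_prod_primes hQ, Finset.prod_union hdU, hW, totient_prod_primes hP₀,
        Finset.prod_div_distrib, Finset.prod_const, div_mul_div_comm, mul_div_assoc',
        mul_comm (N : ℝ)]
    rw [e1] at h1
    refine h1.trans (mul_le_mul_of_nonneg_right (pow_le_pow_left₀ hk1 (by linarith) _)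
      (add_nonneg (maxThetaError_nonneg _ _) (maxThetaError_nonneg _ _)))
  have h1 := abs_sum_mul_sq_sub_le (N := sieveRange N P₀ r) (a := a) (P := P)
    (A := tupleDivisors P H) (fun n _ => Finset.filter_subset _ _) (tupleWeight P k L l) hE
  have h2 := sum_sum_abs_mul_abs_mul_union_le (P := P) (u := fun p : ℕ => Real.log p)
    (fun p hp => Real.log_nonneg (by exact_mod_cast (hP p hp).1.one_le))
    (l := tupleWeight P k L l) (B := (1 + L) ^ (l + 2 * k)) (L := L) (by positivity)
    (fun S hS => abs_tupleWeight_le (by omega) hP hl hL hS)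
    (fun S _ h0 => by
      by_contra! hlt
      exact h0 (tupleWeight_eq_zero hP hl hlt.le))
    (E := E) (fun U _ => mul_nonneg (by positivity)
      (add_nonneg (maxThetaError_nonneg _ _) (maxThetaError_nonneg _ _)))
  have h3 : ∑ U ∈ P.powerset with ∑ p ∈ U, Real.log (p : ℕ) ≤ 2 * L, (16 : ℝ) ^ U.card * E U =
      ∑ U ∈ P.powerset with ∑ p ∈ U, Real.log (p : ℕ) ≤ 2 * L, ((16 * k : ℕ) : ℝ) ^ U.card *
            (maxThetaError ((2 * N + m : ℕ) : ℝ) (∏ p ∈ P₀ ∪ U, p) +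
              maxThetaError ((N + m : ℕ) : ℝ) (∏ p ∈ P₀ ∪ U, p)) := by
    refine Finset.sum_congr rfl fun U _ => ?_
    simp only [hEdef]
    rw [← mul_assoc, ← mul_pow]
    push_cast
    rfl
  rw [← h3]
  have h4 := (abs_le.1 (h1.trans h2)).1
  have h5 := mul_le_mul_of_nonneg_left
    (le_tupleWeight_quadratic (l := l) hd hX hLX hk hP) (by positivity : (0 : ℝ) ≤ N / (W.totient : ℝ))
  simp only [tupleSieve]
  linarith

end Evaluation

/-! ### Choice of parameters and comparison of the sums -/

open Filter in
-- Here `T` stands for `log N` and `η * T` for `L`. Both sides are linear in `T` up to bounded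
-- terms, with leading coefficients `β < α * η`.
theorem eventually_margin {α β η C C₂ : ℝ} (hη : 0 < η)
    (hβα : β < α * η) (hC : 0 ≤ C) (hC₂ : 0 ≤ C₂) :
    ∀ᶠ T : ℝ in atTop, C < η * T ∧
      (T + Real.log 3) * (β + C₂ / (η * T - C)) + 1 ≤ α * (η * T - C) := by
  have hlog3 : 0 ≤ Real.log 3 := Real.log_nonneg (by norm_num)
  filter_upwards [eventually_ge_atTop ((2 * C + 1) / η), eventually_ge_atTop (Real.log 3),
    eventually_ge_atTop ((β * Real.log 3 + 4 * C₂ / η + 1 + α * C) / (α * η - β)),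
    eventually_gt_atTop 0] with T h1 h2 h3 h4
  rw [div_le_iff₀ hη] at h1
  rw [div_le_iff₀ (by linarith)] at h3
  have h5 : 0 < η * T - C := by linarith
  have h6 : (T + Real.log 3) * (C₂ / (η * T - C)) ≤ 4 * C₂ / η := by
    rw [mul_div_assoc', div_le_div_iff₀ h5 hη]
    have h7 : (T + Real.log 3) * η ≤ 4 * (η * T - C) := by nlinarith
    calc (T + Real.log 3) * C₂ * η = C₂ * ((T + Real.log 3) * η) := by ring
      _ ≤ C₂ * (4 * (η * T - C)) := mul_le_mul_of_nonneg_left h7 hC₂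
      _ = _ := by ring
  refine ⟨by linarith, ?_⟩
  nlinarith

open Filter in
-- The error in the unweighted sum is `N^(2η)` times a polylogarithm, negligible against `N` since
-- `2η < 1`.
theorem eventually_polylog_mul_exp_le {η δ : ℝ} (hη : 0 < η) (hη2 : η < 1 / 2) (hδ : 0 < δ)
    (a b : ℕ) :
    ∀ᶠ T : ℝ in atTop, (T + Real.log 3) *
      (((1 + η * T) ^ a) ^ 2 * (Real.exp (2 * (η * T)) * (1 + 2 * (η * T)) ^ b)) ≤
        δ * Real.exp T := by
  have hlog3 : 0 ≤ Real.log 3 := Real.log_nonneg (by norm_num)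
  have ho := (isLittleO_pow_exp_pos_mul_atTop (k := 1 + 2 * a + b)
    (show 0 < 1 - 2 * η by linarith)).bound (show 0 < δ / 3 ^ (1 + 2 * a + b) by positivity)
  filter_upwards [ho, eventually_ge_atTop (1 + Real.log 3)] with T h1 h2
  have hT : 1 ≤ T := by linarith
  have hηT : η * T ≤ T := by nlinarith
  have hηT0 : 0 ≤ η * T := by positivity
  rw [Real.norm_of_nonneg (by positivity), Real.norm_of_nonneg (Real.exp_nonneg _)] at h1
  have h3 : (T + Real.log 3) * (((1 + η * T) ^ a) ^ 2 *
      (Real.exp (2 * (η * T)) * (1 + 2 * (η * T)) ^ b)) ≤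
      (3 * T) * (((3 * T) ^ a) ^ 2 * (Real.exp (2 * (η * T)) * (3 * T) ^ b)) := by
    gcongr <;> linarith
  refine h3.trans ?_
  calc (3 * T) * (((3 * T) ^ a) ^ 2 * (Real.exp (2 * (η * T)) * (3 * T) ^ b)) =
      3 ^ (1 + 2 * a + b) * T ^ (1 + 2 * a + b) * Real.exp (2 * (η * T)) := by
        rw [← pow_mul, mul_pow, mul_pow, pow_add, pow_add, pow_add, pow_add]
        ring
    _ ≤ 3 ^ (1 + 2 * a + b) * (δ / 3 ^ (1 + 2 * a + b) * Real.exp ((1 - 2 * η) * T)) *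
        Real.exp (2 * (η * T)) := by gcongr
    _ = δ * (Real.exp ((1 - 2 * η) * T) * Real.exp (2 * (η * T))) := by
        field_simp
    _ = δ * Real.exp T := by
        rw [← Real.exp_add]; congr 2; ring

open Filter in
theorem eventually_polylog_saving {η δ C : ℝ} (hη : 0 < η) (hη2 : η < 1 / 2) (hδ : 0 < δ)
    (hC : 0 ≤ C) (a : ℕ) :
    ∀ᶠ T : ℝ in atTop, ((1 + η * T) ^ a) ^ 2 * (C / T ^ (2 * a + 1)) ≤ δ := by
  filter_upwards [eventually_ge_atTop 1, eventually_ge_atTop ((2 ^ a) ^ 2 * C / δ)] with T h1 h2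
  rw [div_le_iff₀ hδ] at h2
  have hηT : η * T ≤ T := by nlinarith
  have hηT0 : 0 ≤ η * T := by positivity
  have h3 : ((1 + η * T) ^ a) ^ 2 * (C / T ^ (2 * a + 1)) ≤
      ((2 * T) ^ a) ^ 2 * (C / T ^ (2 * a + 1)) := by
    gcongr; linarith
  refine h3.trans ?_
  have h4 : ((2 * T) ^ a) ^ 2 * (C / T ^ (2 * a + 1)) = (2 ^ a) ^ 2 * C / T := by
    rw [mul_pow, mul_pow, pow_succ T (2 * a), ← pow_mul T, mul_comm a 2]
    field_simp
  rw [h4, div_le_iff₀ (by linarith)]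
  linarith

theorem sum_log_primes_le_of_subsingleton {H : Finset ℕ} {n : ℕ} {Z : ℝ} (hZ : 0 ≤ Z)
    (hle : ∀ m ∈ H, Real.log ((n + m : ℕ) : ℝ) ≤ Z)
    (h : ∀ m ∈ H, ∀ m' ∈ H, m < m' → (n + m).Prime → ¬ (n + m').Prime) :
    ∑ m ∈ H, (if (n + m).Prime then Real.log ((n + m : ℕ) : ℝ) else 0) ≤ Z := by
  by_cases hex : ∃ m ∈ H, (n + m).Prime
  · obtain ⟨m, hm, hmp⟩ := hex
    rw [Finset.sum_eq_single m]
    · rw [if_pos hmp]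
      exact hle m hm
    · intro m' hm' hne
      rw [if_neg]
      intro hmp'
      rcases lt_or_gt_of_ne hne with hlt | hlt
      · exact h m' hm' m hm hlt hmp' hmp
      · exact h m hm m' hm' hlt hmp hmp'
    · exact fun h0 => absurd hm h0
  · push Not at hex
    rw [Finset.sum_eq_zero fun m hm => if_neg (hex m hm)]
    exact hZ

/-- The moments of the two sieve sums satisfy the inequality that yields two primes. -/
theorem mul_moment_add_le {P : Finset ℕ} {l k D₀ W : ℕ} (hl : 1 ≤ l) (hk : k = (2 * l + 1) ^ 2)
    (hD₀ : 1 ≤ D₀) (hW : 1 ≤ W) (hP : ∀ p ∈ P, p.Prime ∧ ¬ p ∣ W ∧ D₀ < p ∧ 2 * k ≤ p) {C : ℝ}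
    (hC : ∀ v : ℝ, 0 ≤ v → ∑ p ∈ P with Real.log (p : ℕ) ≤ v,
      ((k : ℝ) - 1) / ((p : ℝ) - k) * Real.log p ≤ ((k : ℝ) - 1) * v + C)
    {L Z : ℝ} (hL : C < L) (hL1 : 1 ≤ L) (hZ : 0 ≤ Z)
    (hmargin : Z * (Real.exp (2 * k / D₀) * ((W.totient : ℝ) / W) / (2 * l + 1) +
      k * (Real.exp (2 * k / D₀) * (W + 1)) / (L - C)) + 1 ≤
        (2 * l + 1) * ((W.totient : ℝ) / W) / (l + 1) ^ 2 * (L - C)) :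
    Z * subsetMoment P (fun p => ((k : ℝ) - 1) / (p - k) + 1 / (p - k)) (fun p => Real.log p) L
        (2 * l) + 1 ≤
      k * ((W.totient : ℝ) / W / (l + 1) ^ 2 *
        subsetMoment P (fun p => ((k : ℝ) - 1) / (p - k)) (fun p => Real.log p) L (2 * l + 2)) := by
  obtain ⟨j, rfl⟩ : ∃ j, l = j + 1 := ⟨l - 1, by omega⟩
  have hk1 : (1 : ℝ) ≤ k := by
    rw [hk]; exact_mod_cast Nat.one_le_pow _ _ (by omega)
  have hpk : ∀ p ∈ P, (0 : ℝ) < (p : ℝ) - k := fun p hp => by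
    have h1 : 2 * (k : ℝ) ≤ p := by exact_mod_cast (hP p hp).2.2.2
    linarith
  have hg : ∀ p ∈ P, 0 ≤ ((k : ℝ) - 1) / ((p : ℝ) - k) := fun p hp =>
    div_nonneg (by linarith) (hpk p hp).le
  have hf : ∀ p ∈ P, 0 ≤ 1 / ((p : ℝ) - k) := fun p hp => div_nonneg zero_le_one (hpk p hp).le
  have hu : ∀ p ∈ P, 0 ≤ Real.log p := fun p hp =>
    Real.log_nonneg (by exact_mod_cast (hP p hp).1.one_le)
  set M := subsetMoment P (fun p : ℕ => ((k : ℝ) - 1) / ((p : ℝ) - k)) (fun p => Real.log p) L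
    with hM
  set c := (W.totient : ℝ) / W with hc
  have hc0 : 0 ≤ c := by positivity
  set e := Real.exp (2 * k / D₀) with he
  have he0 : 0 < e := Real.exp_pos _
  have h1 := sub_mul_subsetMoment_le hg hu hC L (2 * j + 1)
  have h2 := sub_mul_subsetMoment_le hg hu hC L (2 * j + 2)
  have h3 := sum_prod_add_posPart_pow_le hg hf hu (c := e * c) (C := e * (W + 1))
    (fun v hv => sum_filter_prod_inv_sub_le hD₀ hW hP hv) L (2 * j + 1)
  -- This absorbs the additive 1 of the conclusion, the slack that later outweighs the error terms.
  have hM1 : 1 ≤ M (2 * j + 3) := (one_le_pow₀ hL1).trans (pow_le_subsetMoment hg (by linarith) _)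
  have hkR : (k : ℝ) = (2 * (j + 1) + 1) ^ 2 := by rw [hk]; push_cast; ring
  -- The reason for `k = (2l+1)²`: in terms of `l`, `(k-1)/(2l+2) = 2l`, so the recursion constant
  -- is exactly `2l + 1`.
  have hκ2 : 1 + ((k : ℝ) - 1) / (((2 * j + 2 : ℕ) : ℝ) + 2) = 2 * (j + 1) + 1 := by
    rw [hkR]; push_cast; field_simp; ring
  have hκ1 : 1 + ((k : ℝ) - 1) / (((2 * j + 1 : ℕ) : ℝ) + 2) ≤ k := by
    have : ((k : ℝ) - 1) / (((2 * j + 1 : ℕ) : ℝ) + 2) ≤ (k : ℝ) - 1 :=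
      div_le_self (by linarith) (by push_cast; linarith [(Nat.cast_nonneg j : (0 : ℝ) ≤ j)])
    linarith
  rw [hκ2] at h2
  rw [← hM] at h1 h2 h3
  have hΔ : 0 < L - C := by linarith
  -- The lower moment is smaller by a factor of order `L`, so a crude constant suffices.
  have h4 : M (2 * j + 2) ≤ k * M (2 * j + 3) / (L - C) := by
    rw [le_div_iff₀ hΔ, mul_comm]
    exact h1.trans (mul_le_mul_of_nonneg_right hκ1 (by linarith))
  have e1 : (((2 * j + 1 : ℕ) : ℝ) + 2) = 2 * ((j : ℝ) + 1) + 1 := by push_cast; ring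
  rw [e1] at h3
  have h5 : subsetMoment P (fun p => ((k : ℝ) - 1) / ((p : ℝ) - k) + 1 / ((p : ℝ) - k))
      (fun p => Real.log p) L (2 * (j + 1)) ≤
      M (2 * j + 3) * (e * c / (2 * ((j : ℝ) + 1) + 1) + k * (e * (W + 1)) / (L - C)) := by
    have h6 := mul_le_mul_of_nonneg_left h4 (by positivity : (0 : ℝ) ≤ e * (W + 1))
    calc _ ≤ _ := h3
      _ ≤ e * c / (2 * ((j : ℝ) + 1) + 1) * M (2 * j + 3) +
          e * (W + 1) * (k * M (2 * j + 3) / (L - C)) := by gcongr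
      _ = _ := by ring
  have h6 : (L - C) * M (2 * j + 3) ≤ (2 * ((j : ℝ) + 1) + 1) * M (2 * (j + 1) + 2) := h2
  push_cast at hmargin ⊢
  calc _ ≤ Z * (M (2 * j + 3) *
        (e * c / (2 * ((j : ℝ) + 1) + 1) + k * (e * (W + 1)) / (L - C))) + M (2 * j + 3) := by
        gcongr
    _ = M (2 * j + 3) * (Z * (e * c / (2 * ((j : ℝ) + 1) + 1) +
          k * (e * (W + 1)) / (L - C)) + 1) := by ring
    _ ≤ M (2 * j + 3) * ((2 * ((j : ℝ) + 1) + 1) * c / ((j : ℝ) + 1 + 1) ^ 2 * (L - C)) := by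
        gcongr
    _ = (2 * ((j : ℝ) + 1) + 1) * c / ((j : ℝ) + 1 + 1) ^ 2 * ((L - C) * M (2 * j + 3)) := by ring
    _ ≤ (2 * ((j : ℝ) + 1) + 1) * c / ((j : ℝ) + 1 + 1) ^ 2 *
          ((2 * ((j : ℝ) + 1) + 1) * M (2 * (j + 1) + 2)) := by gcongr
    _ = _ := by rw [hkR]; ring

theorem prod_one_sub_inv_eq_totient_div {Q : Finset ℕ} (hQ : ∀ p ∈ Q, p.Prime) :
    ∏ p ∈ Q, (1 - 1 / (p : ℝ)) = ((∏ p ∈ Q, p).totient : ℝ) / ((∏ p ∈ Q, p : ℕ) : ℝ) := by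
  rw [totient_prod_primes hQ, Nat.cast_prod, ← Finset.prod_div_distrib]
  refine Finset.prod_congr rfl fun p hp => ?_
  have : (p : ℝ) ≠ 0 := by exact_mod_cast (hQ p hp).ne_zero
  field_simp

theorem union_filter_prime {D₀ X : ℕ} (h : D₀ ≤ X) :
    (Finset.Icc 1 D₀).filter Nat.Prime ∪ (Finset.Ioc D₀ X).filter Nat.Prime =
      (Finset.Icc 1 X).filter Nat.Prime := by
  rw [← Finset.filter_union]
  congr 1
  ext p
  simp only [Finset.mem_union, Finset.mem_Icc, Finset.mem_Ioc]
  omega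

theorem disjoint_filter_prime (D₀ X : ℕ) :
    Disjoint ((Finset.Icc 1 D₀).filter Nat.Prime) ((Finset.Ioc D₀ X).filter Nat.Prime) := by
  refine Finset.disjoint_filter_filter (Finset.disjoint_left.2 fun p => ?_)
  simp only [Finset.mem_Icc, Finset.mem_Ioc]
  omega

theorem div_log_pow_le {N x : ℝ} (hN : Real.exp 1 ≤ N) (h1 : N ≤ x) (h2 : x ≤ 3 * N) (D : ℕ) :
    x / Real.log x ^ D ≤ 3 * N / Real.log N ^ D := by
  have hN0 : 0 < N := (Real.exp_pos 1).trans_le hN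
  have hlog : 1 ≤ Real.log N := (Real.le_log_iff_exp_le hN0).2 hN
  have hlog2 : Real.log N ≤ Real.log x := Real.log_le_log hN0 h1
  gcongr

theorem sum_mul_tupleSieve_le {N : ℕ} {P₀ P H : Finset ℕ} {r : ℕ → ℕ} {L : ℝ} {l : ℕ}
    (hN : 1 ≤ N) (hHN : ∀ h ∈ H, h ≤ N)
    (hno : ∀ n ∈ sieveRange N P₀ r, ∀ m ∈ H, ∀ m' ∈ H, m < m' → (n + m).Prime →
      ¬ (n + m').Prime) :
    ∑ m ∈ H, ∑ n ∈ sieveRange N P₀ r,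
        (if (n + m).Prime then Real.log ((n + m : ℕ) : ℝ) else 0) * tupleSieve P H L l n ≤
      (Real.log N + Real.log 3) * ∑ n ∈ sieveRange N P₀ r, tupleSieve P H L l n := by
  have hN0 : (1 : ℝ) ≤ N := by exact_mod_cast hN
  rw [Finset.sum_comm, Finset.mul_sum]
  refine Finset.sum_le_sum fun n hn => ?_
  rw [← Finset.sum_mul]
  refine mul_le_mul_of_nonneg_right ?_ (sq_nonneg _)
  have hn' := Finset.mem_Ioc.1 (Finset.mem_filter.1 hn).1
  refine sum_log_primes_le_of_subsingleton ?_ ?_ (hno n hn)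
  · exact add_nonneg (Real.log_nonneg hN0) (Real.log_nonneg (by norm_num))
  · intro m hm
    rw [← Real.log_mul (by linarith) (by norm_num)]
    have h1 := hHN m hm
    refine Real.log_le_log (by exact_mod_cast (by omega : 0 < n + m)) ?_
    have : n + m ≤ N * 3 := by omega
    exact_mod_cast this

open Filter in
theorem eventually_exists_two_primes {ϑ η : ℝ} (hlevel : PrimesHaveLevel ϑ) (hη0 : 0 < η)
    (hη1 : η < 1 / 2) (hηϑ : 2 * η < ϑ) {l D₀ : ℕ} {H : Finset ℕ} (hl : 1 ≤ l)
    (hcard : H.card = (2 * l + 1) ^ 2) (hD₀ : 1 ≤ D₀) (hD₀k : 2 * H.card ≤ D₀)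
    (hD₀H : ∀ h ∈ H, h ≤ D₀)
    (hratio : Real.exp (2 * H.card / D₀) * ((l : ℝ) + 1) ^ 2 < η * (2 * l + 1) ^ 2)
    {r : ℕ → ℕ} (hr : ∀ p, p.Prime → p ≤ D₀ → ∀ h ∈ H, ¬ p ∣ r p + h) :
    ∀ᶠ N : ℕ in atTop, ∃ n > N, (∀ p, p.Prime → p ≤ D₀ → n ≡ r p [MOD p]) ∧
      ∃ h ∈ H, ∃ h' ∈ H, h < h' ∧ (n + h).Prime ∧ (n + h').Prime := by
  set k := H.card with hk
  have hk2 : 2 ≤ k := by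
    rw [hcard]
    calc 2 ≤ 3 ^ 2 := by norm_num
      _ ≤ (2 * l + 1) ^ 2 := Nat.pow_le_pow_left (by omega) 2
  set P₀ := (Finset.Icc 1 D₀).filter Nat.Prime with hP₀def
  have hP₀ : ∀ p ∈ P₀, p.Prime := fun p hp => (Finset.mem_filter.1 hp).2
  set W := ∏ p ∈ P₀, p with hW
  have hW0 : 0 < W := Finset.prod_pos fun p hp => (hP₀ p hp).pos
  have hWR : (0 : ℝ) < W := by exact_mod_cast hW0
  set c := (W.totient : ℝ) / W with hc
  have hφ : (0 : ℝ) < W.totient := by exact_mod_cast Nat.totient_pos.2 hW0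
  have hc0 : 0 < c := by positivity
  set e := Real.exp (2 * k / D₀) with he
  have he0 : 0 < e := Real.exp_pos _
  obtain ⟨C, hC0, hC⟩ := exists_sum_log_div_sub_le k (by omega)
  set a := l + 2 * k with ha
  -- There are `k` errors from the prime sums and one from the plain sum, in total `(k+1) δ N`. This
  -- is half of the slack `N / W`.
  set δ : ℝ := 1 / (2 * (k + 1) * W) with hδ
  have hδ0 : 0 < δ := by positivity
  -- Half of the room between `2η` and `ϑ` serves as `ε`, and the other half absorbs `W`. The power
  -- `2a + 1` of the logarithm beats the square of the weight bound `(1 + L)^a`.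
  obtain ⟨C₁, hC₁0, hC₁⟩ := exists_sum_pow_card_mul_maxThetaError_le hlevel
    (show 0 < (ϑ - 2 * η) / 2 by linarith) (16 * k) (2 * a + 1)
  have hmarg := eventually_margin (α := (2 * l + 1) * c / (l + 1) ^ 2)
    (β := e * c / (2 * l + 1)) (η := η) (C := C) (C₂ := k * (e * (W + 1))) hη0 (by
      rw [div_lt_iff₀ (by positivity)]
      have e1 : (2 * (l : ℝ) + 1) * c / (l + 1) ^ 2 * η * (2 * l + 1) =
          c * (η * (2 * l + 1) ^ 2 / (l + 1) ^ 2) := by ring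
      rw [e1, mul_comm e]
      refine mul_lt_mul_of_pos_left ?_ hc0
      rw [lt_div_iff₀ (by positivity)]
      exact hratio) hC0 (by positivity)
  have herr1 := eventually_polylog_mul_exp_le hη0 hη1 hδ0 a (16 * k)
  have herr2 := eventually_polylog_saving hη0 hη1 hδ0 (show 0 ≤ 6 * C₁ by positivity) a
  have hsmall1 : ∀ᶠ T : ℝ in atTop, (W : ℝ) ≤ Real.exp ((1 - 2 * η) * T) :=
    (Real.tendsto_exp_atTop.comp
      (tendsto_id.const_mul_atTop (show 0 < 1 - 2 * η by linarith))).eventually_ge_atTop _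
  have hsmall2 : ∀ᶠ T : ℝ in atTop, (W : ℝ) ≤ Real.exp ((ϑ - 2 * η) / 2 * T) :=
    (Real.tendsto_exp_atTop.comp
      (tendsto_id.const_mul_atTop (show 0 < (ϑ - 2 * η) / 2 by linarith))).eventually_ge_atTop _
  have hbig : ∀ᶠ T : ℝ in atTop, (D₀ : ℝ) ≤ Real.exp (η * T) :=
    (Real.tendsto_exp_atTop.comp (tendsto_id.const_mul_atTop hη0)).eventually_ge_atTop _
  have hTlim : Tendsto (fun N : ℕ => Real.log N) atTop atTop :=
    Real.tendsto_log_atTop.comp tendsto_natCast_atTop_atTop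
  have hNlim : Tendsto (fun N : ℕ => (N : ℝ)) atTop atTop := tendsto_natCast_atTop_atTop
  obtain ⟨x₀, hx₀⟩ := eventually_atTop.1 hC₁
  filter_upwards [hTlim.eventually hmarg, hTlim.eventually herr1, hTlim.eventually herr2,
    hTlim.eventually hsmall1, hTlim.eventually hsmall2, hTlim.eventually hbig,
    hTlim.eventually (eventually_ge_atTop (1 / η)), hNlim.eventually (eventually_ge_atTop x₀),
    hNlim.eventually (eventually_ge_atTop (Real.exp 1)), eventually_ge_atTop D₀]
    with N hmarg herr1 herr2 hsmall1 hsmall2 hbig hηT hNx₀ hNe hND₀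
  set T := Real.log N with hT
  set L := η * T with hLdef
  have hN0 : (0 : ℝ) < N := (Real.exp_pos 1).trans_le hNe
  have hexpT : Real.exp T = N := Real.exp_log hN0
  have hT1 : 1 ≤ T := (Real.le_log_iff_exp_le hN0).2 hNe
  have hL1 : 1 ≤ L := by rw [div_le_iff₀ hη0] at hηT; linarith
  have hLT : L ≤ T := by rw [hLdef]; nlinarith
  set X := ⌊Real.exp L⌋₊ with hX
  have hD₀X : D₀ ≤ X := Nat.le_floor hbig
  have hXN : X ≤ N := by
    have h1 : (X : ℝ) ≤ N := (Nat.floor_le (Real.exp_nonneg L)).trans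
      (hexpT ▸ Real.exp_le_exp.2 hLT)
    exact_mod_cast h1
  have hLX : L ≤ Real.log (X + 1) := by
    rw [Real.le_log_iff_exp_le (by positivity)]
    exact (Nat.lt_floor_add_one _).le
  set P := (Finset.Ioc D₀ X).filter Nat.Prime with hPdef
  have hPmem : ∀ p ∈ P, p.Prime ∧ D₀ < p := fun p hp => by
    simp only [hPdef, Finset.mem_filter, Finset.mem_Ioc] at hp
    exact ⟨hp.2, hp.1.1⟩
  have hP : ∀ p ∈ P, p.Prime ∧ 2 * k < p := fun p hp =>
    ⟨(hPmem p hp).1, hD₀k.trans_lt (hPmem p hp).2⟩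
  have hPH : ∀ p ∈ P, ∀ h ∈ H, h < p := fun p hp h hh => (hD₀H h hh).trans_lt (hPmem p hp).2
  have hd : Disjoint P₀ P := disjoint_filter_prime D₀ X
  have hPW : ∀ p ∈ P, ¬ p ∣ W := fun p hp hdvd => by
    obtain ⟨q, hq, hpq⟩ := ((hPmem p hp).1.prime.dvd_finsetProd_iff _).1 hdvd
    have e1 := (Nat.prime_dvd_prime_iff_eq (hPmem p hp).1 (hP₀ q hq)).1 hpq
    exact Finset.disjoint_left.1 hd hq (e1 ▸ hp)
  by_contra! hcon
  have hno : ∀ n ∈ sieveRange N P₀ r, ∀ m ∈ H, ∀ m' ∈ H, m < m' → (n + m).Prime →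
      ¬ (n + m').Prime := by
    intro n hn m hm m' hm' hlt hp
    rw [sieveRange, Finset.mem_filter, Finset.mem_Ioc] at hn
    refine hcon n hn.1.1 (fun p hpp hpD => hn.2 p ?_) m hm m' hm' hlt hp
    exact Finset.mem_filter.2 ⟨Finset.mem_Icc.2 ⟨hpp.one_le, hpD⟩, hpp⟩
  have hupper := sum_mul_tupleSieve_le (P := P) (L := L) (l := l) (by omega)
    (fun h hh => (hD₀H h hh).trans hND₀) hno
  have hS1 := sum_tupleSieve_le (N := N) (r := r) hP₀ hd (by omega) hP hPH hl (by linarith : 0 ≤ L)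
  rw [← hk] at hS1
  have hmom := mul_moment_add_le (P := P) (l := l) (k := k) (D₀ := D₀) (W := W) hl hcard hD₀ hW0
    (fun p hp => ⟨(hPmem p hp).1, hPW p hp, (hPmem p hp).2, (hP p hp).2.le⟩)
    (hC P fun p hp => ⟨(hPmem p hp).1, (hP p hp).2.le⟩) hmarg.1 hL1
    (Z := T + Real.log 3) (add_nonneg (by linarith) (Real.log_nonneg (by norm_num))) hmarg.2
  have hWexp : (W : ℝ) * Real.exp (2 * L) ≤ N := by
    calc (W : ℝ) * Real.exp (2 * L) ≤ Real.exp ((1 - 2 * η) * T) * Real.exp (2 * L) := by gcongr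
      _ = Real.exp T := by rw [← Real.exp_add, hLdef]; congr 1; ring
      _ = N := hexpT
  have hWexp2 : (W : ℝ) * Real.exp (2 * L) ≤ (N : ℝ) ^ (ϑ - (ϑ - 2 * η) / 2) := by
    calc (W : ℝ) * Real.exp (2 * L) ≤ Real.exp ((ϑ - 2 * η) / 2 * T) * Real.exp (2 * L) := by
          gcongr
      _ = Real.exp (T * (ϑ - (ϑ - 2 * η) / 2)) := by
          rw [← Real.exp_add, hLdef]; congr 1; ring
      _ = (N : ℝ) ^ (ϑ - (ϑ - 2 * η) / 2) := (Real.rpow_def_of_pos hN0 _).symm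
  have herror : ∀ x : ℝ, N ≤ x → x ≤ 3 * N →
      ∑ U ∈ P.powerset with ∑ p ∈ U, Real.log (p : ℕ) ≤ 2 * L,
        ((16 * k : ℕ) : ℝ) ^ U.card * maxThetaError x (∏ p ∈ P₀ ∪ U, p) ≤
          C₁ * (3 * N / T ^ (2 * a + 1)) := by
    intro x hx1 hx2
    refine (hx₀ x (hNx₀.trans hx1) P₀ P L hP₀ (fun p hp => (hPmem p hp).1) hd (by linarith)
      (hLT.trans (Real.log_le_log hN0 hx1)) (hWexp.trans hx1) (hWexp2.trans ?_)).trans ?_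
    · exact Real.rpow_le_rpow hN0.le hx1 (by linarith)
    · exact mul_le_mul_of_nonneg_left (div_log_pow_le hNe hx1 hx2 _) hC₁0
  have hS2 : ∀ m ∈ H, N / (W : ℝ) * (c / (l + 1) ^ 2 *
        subsetMoment P (fun p => ((k : ℝ) - 1) / (p - k)) (fun p => Real.log p) L (2 * l + 2)) -
        δ * N ≤ ∑ n ∈ sieveRange N P₀ r,
          (if (n + m).Prime then Real.log ((n + m : ℕ) : ℝ) else 0) * tupleSieve P H L l n := by
    intro m hm
    have h1 := le_sum_prime_mul_tupleSieve (P₀ := P₀) (P := P) (N := N) (r := r) (X := X) hd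
      (union_filter_prime hD₀X) hXN hLX hk2 hP hPH hl (by linarith : 0 ≤ L) hm
      (fun p hp => hr p (hP₀ p hp) (Finset.mem_Icc.1 (Finset.mem_filter.1 hp).1).2 m hm)
    refine le_trans ?_ h1
    have hmN : m ≤ N := (hD₀H m hm).trans hND₀
    have hmN' : (m : ℝ) ≤ N := by exact_mod_cast hmN
    have hm0 : (0 : ℝ) ≤ m := by positivity
    have h2 := herror ((2 * N + m : ℕ) : ℝ) (by push_cast; linarith) (by push_cast; linarith)
    have h3 := herror ((N + m : ℕ) : ℝ) (by push_cast; linarith) (by push_cast; linarith)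
    have h4 : ((1 + L) ^ a) ^ 2 * ∑ U ∈ P.powerset with ∑ p ∈ U, Real.log (p : ℕ) ≤ 2 * L,
          ((16 * k : ℕ) : ℝ) ^ U.card *
            (maxThetaError ((2 * N + m : ℕ) : ℝ) (∏ p ∈ P₀ ∪ U, p) +
              maxThetaError ((N + m : ℕ) : ℝ) (∏ p ∈ P₀ ∪ U, p)) ≤ δ * N := by
      simp_rw [mul_add, Finset.sum_add_distrib]
      calc _ ≤ ((1 + L) ^ a) ^ 2 * (C₁ * (3 * N / T ^ (2 * a + 1)) +
            C₁ * (3 * N / T ^ (2 * a + 1))) :=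
            mul_le_mul_of_nonneg_left (add_le_add h2 h3) (by positivity)
        _ = ((1 + L) ^ a) ^ 2 * (6 * C₁ / T ^ (2 * a + 1)) * N := by ring
        _ ≤ δ * N := mul_le_mul_of_nonneg_right herr2 hN0.le
    refine sub_le_sub (le_of_eq ?_) h4
    rw [prod_one_sub_inv_eq_totient_div hP₀, ← hW, ← hc, div_pow]
    have h5 : (W.totient : ℝ) = c * W := by rw [hc]; field_simp
    rw [h5]
    field_simp
    rfl
  have hsum := Finset.sum_le_sum hS2
  rw [Finset.sum_const, nsmul_eq_mul, ← hk] at hsum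
  set Q := subsetMoment P (fun p => ((k : ℝ) - 1) / (p - k) + 1 / (p - k)) (fun p => Real.log p) L
    (2 * l) with hQ
  set M := subsetMoment P (fun p => ((k : ℝ) - 1) / (p - k)) (fun p => Real.log p) L (2 * l + 2)
    with hM
  have hZ0 : 0 ≤ T + Real.log 3 := add_nonneg (by linarith) (Real.log_nonneg (by norm_num))
  have h1 := mul_le_mul_of_nonneg_left hS1 hZ0
  rw [mul_add] at h1
  rw [hexpT] at herr1
  have h2 : (T + Real.log 3) * (N / W * Q) + N / W ≤
      k * (N / W * (c / (l + 1) ^ 2 * M)) := by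
    have h := mul_le_mul_of_nonneg_left hmom (by positivity : 0 ≤ (N : ℝ) / W)
    rw [← hc] at h
    exact (le_of_eq (by ring)).trans (h.trans (le_of_eq (by ring)))
  have h3 : (k + 1 : ℝ) * (δ * N) = N / W / 2 := by
    rw [hδ]; field_simp
  have h4 : 0 < (N : ℝ) / W := by positivity
  rw [mul_sub] at hsum
  rw [add_mul, one_mul] at h3
  linarith

open Filter in
theorem exists_hasPrimePairs {ϑ : ℝ} (hϑ : 1 / 2 < ϑ) (hlevel : PrimesHaveLevel ϑ) :
    ∃ k, HasPrimePairs k := by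
  obtain ⟨η, hη, hη'⟩ : ∃ η, 1 / 4 < η ∧ η < min (ϑ / 2) (1 / 2) :=
    exists_between (lt_min (by linarith) (by norm_num))
  obtain ⟨hηϑ, hη1⟩ := lt_min_iff.1 hη'
  obtain ⟨l, hl⟩ := exists_nat_gt (max 1 (2 / (4 * η - 1)))
  obtain ⟨hl1, hl2⟩ := max_lt_iff.1 hl
  have hl1' : 1 ≤ l := by exact_mod_cast hl1.le
  rw [div_lt_iff₀ (by linarith)] at hl2
  -- As `l` grows, `(2l+1)²/(l+1)²` tends to 4, so `η > 1/4` suffices.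
  have hlη : ((l : ℝ) + 1) ^ 2 < η * (2 * l + 1) ^ 2 := by nlinarith
  -- `l` and `k` are fixed before `H`. The strict inequality `hlη` leaves room for the factor `exp
  -- (2k/D₀)`, which tends to 1 as `D₀` grows.
  refine ⟨(2 * l + 1) ^ 2, fun H hcard => ?_⟩
  have hlim : Tendsto (fun D : ℕ => Real.exp (2 * H.card / D) * ((l : ℝ) + 1) ^ 2) atTop
      (nhds (Real.exp 0 * ((l : ℝ) + 1) ^ 2)) :=
    ((Real.continuous_exp.tendsto 0).comp
      (tendsto_natCast_atTop_atTop.const_div_atTop (2 * (H.card : ℝ)))).mul_const _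
  rw [Real.exp_zero, one_mul] at hlim
  obtain ⟨D₁, hD₁⟩ := eventually_atTop.1 (hlim.eventually_lt_const hlη)
  refine ⟨max D₁ (max (2 * H.card + 1) (H.sup id)), fun D₀ hD₀ r hr N₀ => ?_⟩
  simp only [ge_iff_le, max_le_iff] at hD₀
  have hev := eventually_exists_two_primes hlevel (by linarith) hη1 (by linarith) hl1' hcard
    (by omega : 1 ≤ D₀) (by omega) (fun h hh => (Finset.le_sup (f := id) hh).trans hD₀.2.2)
    (hD₁ D₀ hD₀.1) hr
  obtain ⟨N, hN, n, hn, hrest⟩ := ((eventually_ge_atTop N₀).and hev).exists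
  exact ⟨n, by omega, hrest⟩

theorem theorem3 (ϑ : ℝ) (hϑ : 1 / 2 < ϑ) (hlevel : PrimesHaveLevel ϑ) :
    ∃ C C₀ : ℝ, ∀ x : ℝ, C₀ < x →
      ∃ d : ℕ, (d : ℝ) ∈ Set.Icc x (x + C) ∧ IsDePolignac d := by
  obtain ⟨k, hk⟩ := exists_hasPrimePairs hϑ hlevel
  exact exists_bounded_gaps_of_meets_differences fun H hcard hH =>
    hk.exists_isDePolignac_sub hcard hH
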